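/- Let $d\ge 2$, $T>0$, let $\Omega\subset\mathbf R^d$ be a bounded Lipschitz domain and $Q_T=(0,T)\times\Omega$. Let $\bar\rho>0$, let $\rho\in L^\infty(Q_T)$ satisfy $0\le\rho<\bar\rho$ a.e. in $Q_T$, let $u\in L^2(0,T;W^{1,2}_0(\Omega)^d)$, and suppose that $$\partial_t\rho+\operatorname{div}(\rho u)=0\quad\text{in }\mathcal D'(Q_T).$$ Let $b\in C^1([0,\bar\rho))$ be such that $b(\rho)\in L^2(Q_T)$, $b'(\rho)\in L^2(Q_T)$ and, for some $\alpha_0\in(0,\bar\rho)$, both $b$ and $b'$ are nondecreasing on $[\bar\rho-\alpha_0,\bar\rho)$. Extend $\rho$ and $u$ by zero to $(0,T)\times(\mathbf R^d\setminus\Omega)$. Then: 1. The renormalized continuity equation $$\partial_t b(\rho)+\operatorname{div}(b(\rho)u)+(b'(\rho)\rho-b(\rho))\operatorname{div}u=0\quad\text{in }\mathcal D'((0,T)\times\mathbf R^d)$$ holds (all the products being locally integrable). 2. For every $\alpha\in(0,\alpha_0)$ let $b_\alpha(s)=b(s)$ for $s\le\bar\rho-\alpha$ and $b_\alpha(s)=b(\bar\rho-\alpha)$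 for $s>\bar\rho-\alpha$. Then $$\partial_t b_\alpha(\rho)+\operatorname{div}(b_\alpha(\rho)u)+(b_\alpha'(\rho)\rho-b_\alpha(\rho))\operatorname{div}u=0\quad\text{in }\mathcal D'((0,T)\times\mathbf R^d),$$ where $b_\alpha'(\rho)$ is set to be $0$ on the set $\{\rho=\bar\rho-\alpha\}$. -/

import Mathlib

open MeasureTheory TopologicalSpace Set Filter Topology
open scoped Distributions ENNReal NNReal

namespace RenormCE

/-- `ℝ^d` with its Euclidean norm. -/
abbrev Space (d : ℕ) : Type := EuclideanSpace ℝ (Fin d)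

/-- A bounded Lipschitz domain: nonempty, connected, open (`Ω : Opens _`), bounded, and near each
boundary point `x₀` there is a unit vector `ν` such that `Ω` is the strict epigraph, in the
direction `ν`, of a Lipschitz function `γ` of the component `x - ⟪ν, x⟫ ν` of `x` orthogonal
to `ν`. -/
structure IsBoundedLipschitzDomain {d : ℕ} (Ω : Opens (Space d)) : Prop where
  bounded : Bornology.IsBounded (Ω : Set (Space d))
  connected : IsConnected (Ω : Set (Space d))
  lipschitz : ∀ x₀ ∈ frontier (Ω : Set (Space d)),
    ∃ (ν : Space d) (γ : Space d → ℝ) (K : ℝ≥0) (r : ℝ),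
      ‖ν‖ = 1 ∧ LipschitzWith K γ ∧ 0 < r ∧
        ∀ x ∈ Metric.ball x₀ r, x ∈ Ω ↔ γ (x - inner ℝ ν x • ν) < inner ℝ ν x

/-- The open cylinder `(0,T) × Ω`; `cylinder T ⊤` is `(0,T) × ℝ^d`. -/
def cylinder {d : ℕ} (T : ℝ) (Ω : Opens (Space d)) : Opens (ℝ × Space d) :=
  ⟨Ioo 0 T ×ˢ (Ω : Set (Space d)), isOpen_Ioo.prod Ω.isOpen⟩

/-- The `i`-th standard basis vector of `ℝ^d`. -/
noncomputable abbrev basisVec {d : ℕ} (i : Fin d) : Space d := EuclideanSpace.single i 1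

/-- `G i` is the weak partial derivative `∂_i v` of the vector field `v` on `Ω`, for every `i`. -/
def IsWeakGradient {d : ℕ} (Ω : Opens (Space d)) (v : Space d → Space d)
    (G : Fin d → Space d → Space d) : Prop :=
  ∀ (i : Fin d) (φ : 𝓓(Ω, ℝ)),
    ∫ x in (Ω : Set (Space d)), fderiv ℝ φ x (basisVec i) • v x
      = - ∫ x in (Ω : Set (Space d)), φ x • G i x

/-- `v ∈ W^{1,2}(Ω)^d`, with weak partial derivatives `G i = ∂_i v`. -/
structure MemW12 {d : ℕ} (Ω : Opens (Space d)) (v : Space d → Space d)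
    (G : Fin d → Space d → Space d) : Prop where
  memLp : MemLp v 2 (volume.restrict (Ω : Set (Space d)))
  memLp_grad : ∀ i, MemLp (G i) 2 (volume.restrict (Ω : Set (Space d)))
  isWeakGradient : IsWeakGradient Ω v G

/-- `v ∈ W^{1,2}_0(Ω)^d`, with weak partial derivatives `G i = ∂_i v`: the closure of
`C_c^∞(Ω)^d` in the norm of `W^{1,2}(Ω)^d`. -/
structure MemW12Zero {d : ℕ} (Ω : Opens (Space d)) (v : Space d → Space d)
    (G : Fin d → Space d → Space d) : Prop extends MemW12 Ω v G where
  approx : ∃ φ : ℕ → 𝓓(Ω, Space d),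
    Tendsto (fun n => eLpNorm (fun x => φ n x - v x) 2
      (volume.restrict (Ω : Set (Space d)))) atTop (𝓝 0) ∧
    ∀ i, Tendsto (fun n => eLpNorm (fun x => fderiv ℝ (φ n) x (basisVec i) - G i x) 2
      (volume.restrict (Ω : Set (Space d)))) atTop (𝓝 0)

/-- `u ∈ L²(0,T; W^{1,2}_0(Ω)^d)`, with weak spatial partial derivatives `Du i = ∂_{x_i} u`. -/
structure MemL2W12Zero {d : ℕ} (T : ℝ) (Ω : Opens (Space d)) (u : ℝ × Space d → Space d)
    (Du : Fin d → ℝ × Space d → Space d) : Prop where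
  memLp : MemLp u 2 (volume.restrict (cylinder T Ω : Set (ℝ × Space d)))
  memLp_grad : ∀ i, MemLp (Du i) 2 (volume.restrict (cylinder T Ω : Set (ℝ × Space d)))
  slice : ∀ᵐ t ∂(volume.restrict (Ioo 0 T)),
    MemW12Zero Ω (fun x => u (t, x)) (fun i x => Du i (t, x))

/-- The divergence `∑ i, ∂_i u_i` read off from the spatial partial derivatives `Du i = ∂_i u`. -/
noncomputable def divergence {d : ℕ} (Du : Fin d → ℝ × Space d → Space d)
    (p : ℝ × Space d) : ℝ :=
  ∑ i : Fin d, Du i p i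

/-- Extension by zero from `Ω` to `ℝ^d` in the space variable. -/
noncomputable def zeroExt {d : ℕ} {F : Type*} [Zero F] (Ω : Opens (Space d))
    (f : ℝ × Space d → F) : ℝ × Space d → F :=
  indicator {p | p.2 ∈ Ω} f

/-- The equation `∂_t r + div F + g = 0` in `𝒟'(O)`, for `r`, `F`, `g` in `L¹_loc(O)`. -/
structure HoldsInDistributions {d : ℕ} (O : Opens (ℝ × Space d)) (r : ℝ × Space d → ℝ)
    (F : ℝ × Space d → Space d) (g : ℝ × Space d → ℝ) : Prop where
  locallyIntegrable_density : LocallyIntegrableOn r (O : Set (ℝ × Space d)) volume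
  locallyIntegrable_flux : LocallyIntegrableOn F (O : Set (ℝ × Space d)) volume
  locallyIntegrable_source : LocallyIntegrableOn g (O : Set (ℝ × Space d)) volume
  weak : ∀ ψ : 𝓓(O, ℝ),
    ∫ p in (O : Set (ℝ × Space d)),
      (r p * fderiv ℝ ψ p (1, 0) + fderiv ℝ ψ p (0, F p) - g p * ψ p) = 0

/-- The equation `∂_t B(ρ) + div (B(ρ) u) + (B'(ρ) ρ - B(ρ)) div u = 0` in `𝒟'(O)`, where `B'`
and the divergence `divu` of `u` are given as functions. -/
def RenormalizedContinuityEq {d : ℕ} (O : Opens (ℝ × Space d)) (B B' : ℝ → ℝ)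
    (ρ : ℝ × Space d → ℝ) (u : ℝ × Space d → Space d) (divu : ℝ × Space d → ℝ) : Prop :=
  HoldsInDistributions O (fun p => B (ρ p)) (fun p => B (ρ p) • u p)
    (fun p => (B' (ρ p) * ρ p - B (ρ p)) * divu p)

/-- The derivative of a function on `[0, R)`, one-sided at `0`. -/
noncomputable def derivOn (R : ℝ) (b : ℝ → ℝ) (s : ℝ) : ℝ :=
  derivWithin b (Ico 0 R) s

/-- The truncation `b_α`: equal to `b` up to `R - α`, and constant afterwards. -/
noncomputable def truncation (R α : ℝ) (b : ℝ → ℝ) (s : ℝ) : ℝ :=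
  if s ≤ R - α then b s else b (R - α)

/-- The derivative of `b_α`, with value `0` at the kink `R - α`. -/
noncomputable def truncationDeriv (R α : ℝ) (b : ℝ → ℝ) (s : ℝ) : ℝ :=
  if s = R - α then 0 else derivOn R (truncation R α b) s

end RenormCE

namespace RenormCE

open scoped ContDiff

/-! The continuity equation is mollified in the space variable only. For a kernel `k` of radius `ε`
and fixed `x`, the function `t ↦ (ρ * k)(t, x)` has the integrable weak derivative `-div ((ρu) *
k)(t, x)`. It therefore agrees a.e. with an absolutely continuous function, and the chain rule in
one variable (`integral_comp_mul_deriv_of_weak_deriv`) gives the equation for `β(ρ * k)` when `β` is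
`C¹` and bounded with bounded derivative.

What remains is the limit `ε → 0` of `∫ β'(σ * k) div ((σv) * k) ζ` at almost every fixed time,
where `σ`, `v`, `ζ` are the slices of the density, the velocity and the test function. If `v` is
replaced by a smooth `φ`, then `div ((σφ) * k)` is `φ · ∇(σ * k)` minus a commutator. The first term
combines with `β'` into `φ · ∇β(σ * k)` and is integrated by parts. The commutator is bounded in
`L¹` by `‖∇φ‖₁` uniformly in `ε` (`lintegral_enorm_commutator_le`) and tends a.e. to `-σ div φ`
(`ae_tendsto_commutator`). Thus the functional is bounded uniformly in `ε` by the `W^{1,1}` size of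
the field and converges on smooth fields, hence on their limits (`SliceData.tendsto_mollifiedTerm`).
As `σ` is bounded, `W^{1,1}` suffices here. Dominated convergence in time concludes
(`TransportPair.renormalized`).

The extension by zero satisfies the continuity equation across `∂Ω` (`weak_extension`): cutting off
in a layer of width comparable to `ε` produces the error `ε⁻¹ ∫ |u|` over the layer. From a point at
distance less than `δ` from the complement one leaves a Lipschitz domain after a length `Cδ` along
one of finitely many directions. Integrating `∇u` along these segments bounds `δ⁻¹ ∫ |u|` by a
multiple of the integral of `|∇u|` over a slightly wider layer, which tends to zero because the
layers shrink to the empty set.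

Finally `b` may blow up at `R`. Multiplying `b'` by a cutoff and integrating gives bounded `C¹`
functions `β_n` with `|β_n'| ≤ |b'|`, and the monotonicity of `b` near `R` gives `|β_n| ≤ |b| + |b(R
- α₀)|`. Since `b(ρ)`, `b'(ρ)`, `u` and `div u` are square integrable, the equation passes to the
limit. Pushing the cutoff interval to `R` yields the equation for `b`. Shrinking it to the point `R
- α` from the left yields the one for `b_α`; the value `0` at the kink appears because every `β_n'`
vanishes there. -/

/-! ### The chain rule for weak derivatives in time. -/

theorem _root_.AbsolutelyContinuousOnInterval.lipschitzWith_comp {F β : ℝ → ℝ} {a b : ℝ} {K : ℝ≥0}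
    (hβ : LipschitzWith K β) (hF : AbsolutelyContinuousOnInterval F a b) :
    AbsolutelyContinuousOnInterval (fun t => β (F t)) a b := by
  rw [absolutelyContinuousOnInterval_iff] at hF ⊢
  intro ε hε
  -- `K + 1` instead of `K`, which may vanish.
  obtain ⟨δ, hδ, h⟩ := hF (ε / (K + 1)) (by positivity)
  refine ⟨δ, hδ, fun E hE hE' => ?_⟩
  have h1 := h E hE hE'
  calc ∑ i ∈ Finset.range E.1, dist (β (F (E.2 i).1)) (β (F (E.2 i).2))
      ≤ ∑ i ∈ Finset.range E.1, (K + 1 : ℝ) * dist (F (E.2 i).1) (F (E.2 i).2) := by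
        refine Finset.sum_le_sum fun i _ => (hβ.dist_le_mul _ _).trans ?_
        gcongr
        linarith
    _ = (K + 1) * ∑ i ∈ Finset.range E.1, dist (F (E.2 i).1) (F (E.2 i).2) := by
        rw [Finset.mul_sum]
    _ < (K + 1) * (ε / (K + 1)) := by
        have : (0 : ℝ) < K + 1 := by positivity
        gcongr
    _ = ε := by field_simp

theorem integral_eq_intervalIntegral_of_tsupport_subset {T : ℝ} (hT : 0 < T) {h : ℝ → ℝ}
    (hh : ∀ t, t ∉ Ioo 0 T → h t = 0) : ∫ t, h t = ∫ t in (0 : ℝ)..T, h t := by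
  rw [intervalIntegral.integral_of_le hT.le]
  refine (setIntegral_eq_integral_of_forall_compl_eq_zero fun t ht => hh t ?_).symm
  exact fun h' => ht (Ioo_subset_Ioc_self h')

/-- The primitive of an integrable function is absolutely continuous and stays so after composition
with a Lipschitz `β`, so integration by parts applies. The derivative comes from Lebesgue
differentiation and the classical chain rule, and the boundary terms vanish with `ξ`. -/
theorem integral_comp_primitive_mul_deriv {T : ℝ} (hT : 0 < T) {g : ℝ → ℝ}
    (hg : Integrable g) (c : ℝ) {β : ℝ → ℝ} (hβ : ContDiff ℝ 1 β) {K : ℝ≥0}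
    (hK : LipschitzWith K β) {ξ : ℝ → ℝ} (hξ : ContDiff ℝ ∞ ξ) (hξs : tsupport ξ ⊆ Ioo 0 T) :
    ∫ t, β (c - ∫ s in (0 : ℝ)..t, g s) * deriv ξ t
      = ∫ t, deriv β (c - ∫ s in (0 : ℝ)..t, g s) * g t * ξ t := by
  have hz : ∀ t, t ∉ Ioo 0 T → ξ t = 0 := fun t ht => image_eq_zero_of_notMem_tsupport
    fun h => ht (hξs h)
  have hz' : ∀ t, t ∉ Ioo 0 T → deriv ξ t = 0 := fun t ht => by
    by_contra hne
    exact ht (hξs (support_deriv_subset hne))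
  rw [integral_eq_intervalIntegral_of_tsupport_subset hT fun t ht => by simp [hz' t ht],
    integral_eq_intervalIntegral_of_tsupport_subset hT fun t ht => by simp [hz t ht]]
  have hgi : IntervalIntegrable g volume 0 T := hg.intervalIntegrable
  have hac := hgi.absolutelyContinuousOnInterval_intervalIntegral (c := 0) (by simp)
  have hac' : AbsolutelyContinuousOnInterval (fun t => c - ∫ s in (0 : ℝ)..t, g s) 0 T :=
    AbsolutelyContinuousOnInterval.sub (f := fun _ => c)
      ((contDiff_const (c := c) (n := 1)).contDiffOn.absolutelyContinuousOnInterval) hac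
  have h1 := (hac'.lipschitzWith_comp hK).integral_mul_deriv_eq_deriv_mul
    ((hξ.of_le (by simp)).contDiffOn.absolutelyContinuousOnInterval (f := ξ) (a := 0) (b := T))
  rw [h1, hz 0 (by simp), hz T (by simp)]
  simp only [mul_zero, sub_self, zero_sub, ← intervalIntegral.integral_neg]
  refine intervalIntegral.integral_congr_ae ?_
  filter_upwards [hgi.ae_hasDerivAt_integral] with t ht htT
  have h2 := (ht (uIoc_subset_uIcc htT) 0 (by simp)).const_sub c
  have h3 := ((hβ.differentiable one_ne_zero) (c - ∫ s in (0 : ℝ)..t, g s)).hasDerivAt.comp t h2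
  have h4 := h3.deriv
  simp only [Function.comp_def] at h4
  rw [h4]; ring

/-- The du Bois-Reymond lemma. Subtracting from a test function its mean times a fixed bump of mass
one leaves a function of mean zero, whose primitive is again a test function on `(0, T)`. The
constant is the integral of `h` against the bump. -/
theorem ae_eq_const_of_integral_mul_deriv_eq_zero {T : ℝ} (hT : 0 < T) {h : ℝ → ℝ}
    (hh : LocallyIntegrable h)
    (H : ∀ ξ : ℝ → ℝ, ContDiff ℝ ∞ ξ → HasCompactSupport ξ → tsupport ξ ⊆ Ioo 0 T →
      ∫ t, h t * deriv ξ t = 0) :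
    ∃ c, ∀ᵐ t, t ∈ Ioo 0 T → h t = c := by
  obtain ⟨ξ₀, hc₀, hs₀, ht₀, hi₀⟩ : ∃ ξ₀ : ℝ → ℝ, ContDiff ℝ ∞ ξ₀ ∧ HasCompactSupport ξ₀ ∧
      tsupport ξ₀ ⊆ Ioo 0 T ∧ ∫ t, ξ₀ t = 1 := by
    let φ : ContDiffBump (T / 2) := ⟨T / 8, T / 4, by positivity, by linarith⟩
    refine ⟨φ.normed volume, φ.contDiff_normed, φ.hasCompactSupport_normed, ?_,
      φ.integral_normed⟩
    rw [φ.tsupport_normed_eq, Real.closedBall_eq_Icc]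
    intro x hx
    have : φ.rOut = T / 4 := rfl
    rw [this] at hx
    constructor <;> [linarith [hx.1]; linarith [hx.2]]
  refine ⟨∫ t, h t * ξ₀ t, ?_⟩
  set c := ∫ t, h t * ξ₀ t with hc
  have hint : ∀ g : ℝ → ℝ, ContDiff ℝ ∞ g → HasCompactSupport g → Integrable fun t => h t * g t := by
    intro g hg hgs
    simpa [mul_comm] using hh.integrable_smul_left_of_hasCompactSupport hg.continuous hgs
  have key := isOpen_Ioo.ae_eq_zero_of_integral_contDiff_smul_eq_zero (E := ℝ) (μ := volume)
    (U := Ioo 0 T) (f := fun t => h t - c) (by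
      refine (LocallyIntegrable.sub hh (continuous_const.locallyIntegrable)).locallyIntegrableOn _)
    (by
      intro g hg hgs hgt
      have hgi : Integrable g := hg.continuous.integrable_of_hasCompactSupport hgs
      have h0i : Integrable ξ₀ := hc₀.continuous.integrable_of_hasCompactSupport hs₀
      set m := ∫ t, g t
      set θ : ℝ → ℝ := fun t => g t - m * ξ₀ t with hθ
      have hθc : ContDiff ℝ ∞ θ := hg.sub (contDiff_const.mul hc₀)
      have hθi : Integrable θ := hgi.sub (h0i.const_mul m)
      have hθint : ∫ t, θ t = 0 := by
        rw [hθ, integral_sub hgi (h0i.const_mul m), integral_const_mul, hi₀]; simp [m]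
      let K := tsupport g ∪ tsupport ξ₀
      have hK : IsCompact K := hgs.isCompact.union hs₀.isCompact
      have hKs : K ⊆ Ioo 0 T := union_subset hgt ht₀
      have hθK : ∀ t, t ∉ K → θ t = 0 := by
        intro t ht
        have h1 : t ∉ tsupport g := fun h => ht (Or.inl h)
        have h2 : t ∉ tsupport ξ₀ := fun h => ht (Or.inr h)
        simp [hθ, image_eq_zero_of_notMem_tsupport h1, image_eq_zero_of_notMem_tsupport h2]
      obtain ⟨a, b, hab, hKab, ha, hb⟩ : ∃ a b, a ≤ b ∧ K ⊆ Icc a b ∧ 0 < a ∧ b < T := by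
        rcases K.eq_empty_or_nonempty with hKe | hKn
        · exact ⟨T / 2, T / 2, le_rfl, by simp [hKe], by linarith, by linarith⟩
        · have h1 := hK.sInf_mem hKn
          have h2 := hK.sSup_mem hKn
          exact ⟨sInf K, sSup K, csInf_le hK.bddBelow h2,
            fun x hx => ⟨csInf_le hK.bddBelow hx, le_csSup hK.bddAbove hx⟩, (hKs h1).1, (hKs h2).2⟩
      let P : ℝ → ℝ := fun t => ∫ s in (0 : ℝ)..t, θ s
      have hPd : ∀ t, HasDerivAt P (θ t) t := fun t =>
        intervalIntegral.integral_hasDerivAt_right (hθc.continuous.intervalIntegrable _ _)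
          (hθc.continuous.stronglyMeasurableAtFilter _ _) hθc.continuous.continuousAt
      have hPderiv : deriv P = θ := funext fun t => (hPd t).deriv
      have hPc : ContDiff ℝ ∞ P := by
        rw [contDiff_infty_iff_deriv]
        exact ⟨fun t => (hPd t).differentiableAt, hPderiv ▸ hθc⟩
      have hPa : ∀ t, t < a → P t = 0 := by
        intro t ht
        refine (intervalIntegral.integral_congr (g := fun _ => (0 : ℝ)) fun s hs => ?_).trans (by simp)
        refine hθK s fun hsK => ?_
        have := (hKab hsK).1
        rcases le_total 0 t with h | h
        · rw [uIcc_of_le h] at hs; linarith [hs.2]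
        · rw [uIcc_of_ge h] at hs; linarith [hs.2]
      have hPb : ∀ t, b < t → P t = 0 := by
        intro t ht
        have : P t = ∫ s, θ s := by
          simp only [P]
          rw [intervalIntegral.integral_of_le (by linarith)]
          refine setIntegral_eq_integral_of_forall_compl_eq_zero fun s hs => hθK s fun hsK => hs ?_
          exact ⟨by linarith [(hKab hsK).1], by linarith [(hKab hsK).2]⟩
        rw [this, hθint]
      have hPt : tsupport P ⊆ Icc a b := by
        refine closure_minimal (fun t ht => ?_) isClosed_Icc
        by_contra hne
        rw [mem_Icc, not_and_or, not_le, not_le] at hne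
        rcases hne with h | h
        · exact ht (hPa t h)
        · exact ht (hPb t h)
      have hPz := H P hPc (isCompact_Icc.of_isClosed_subset (isClosed_tsupport _) hPt)
        (hPt.trans fun t ht => ⟨by linarith [ht.1], by linarith [ht.2]⟩)
      rw [hPderiv] at hPz
      have e1 : ∫ t, h t * θ t = (∫ t, h t * g t) - m * c := by
        rw [hc, ← integral_const_mul, ← integral_sub (hint g hg hgs) ((hint ξ₀ hc₀ hs₀).const_mul m)]
        refine integral_congr_ae (Eventually.of_forall fun t => ?_)
        simp only [hθ]; ring
      have e2 : ∫ t, g t • (h t - c) = (∫ t, h t * g t) - m * c := by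
        rw [← integral_mul_const, ← integral_sub (hint g hg hgs) (hgi.mul_const c)]
        refine integral_congr_ae (Eventually.of_forall fun t => ?_)
        simp only [smul_eq_mul]; ring
      rw [e2, ← e1, hPz])
  filter_upwards [key] with t ht htT
  linarith [ht htT]

/-- If `f' = -g` weakly on `(0, T)`, then `β(f)' = -β'(f) g` weakly on `(0, T)`. -/
theorem integral_comp_mul_deriv_of_weak_deriv {T : ℝ} (hT : 0 < T) {f g : ℝ → ℝ}
    (hf : Integrable f) (hg : Integrable g)
    (H : ∀ ξ : ℝ → ℝ, ContDiff ℝ ∞ ξ → HasCompactSupport ξ → tsupport ξ ⊆ Ioo 0 T →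
      ∫ t, f t * deriv ξ t = ∫ t, g t * ξ t)
    {β : ℝ → ℝ} (hβ : ContDiff ℝ 1 β) {K : ℝ≥0} (hK : LipschitzWith K β)
    {ξ : ℝ → ℝ} (hξ : ContDiff ℝ ∞ ξ) (hξs : tsupport ξ ⊆ Ioo 0 T) :
    ∫ t, β (f t) * deriv ξ t = ∫ t, deriv β (f t) * g t * ξ t := by
  let F : ℝ → ℝ := fun t => 0 - ∫ s in (0 : ℝ)..t, g s
  have hFc : Continuous F :=
    continuous_const.sub (intervalIntegral.continuous_primitive (fun a b => hg.intervalIntegrable) 0)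
  -- `f` and the primitive `F` of `-g` have the same weak derivative, so they differ by a constant
  -- a.e.; the case `β = id` of the preceding chain rule supplies the weak derivative of `F`.
  obtain ⟨c, hc⟩ := ae_eq_const_of_integral_mul_deriv_eq_zero hT (h := fun t => f t - F t)
    (hf.locallyIntegrable.sub hFc.locallyIntegrable) (by
      intro ζ hζ hζs hζt
      have h1 := H ζ hζ hζs hζt
      have h2 := integral_comp_primitive_mul_deriv hT hg 0 (β := id) contDiff_id
        (LipschitzWith.id) hζ hζt
      simp only [id, deriv_id, one_mul] at h2
      have hd : Continuous (deriv ζ) := hζ.continuous_deriv (by simp)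
      have hi1 : Integrable fun t => f t * deriv ζ t := by
        simpa [mul_comm] using hf.locallyIntegrable.integrable_smul_left_of_hasCompactSupport hd
          hζs.deriv
      have hi2 : Integrable fun t => F t * deriv ζ t :=
        (hFc.mul hd).integrable_of_hasCompactSupport hζs.deriv.mul_left
      simp only [sub_mul]
      rw [integral_sub hi1 hi2, h1, ← h2]
      simp [F])
  have h3 := integral_comp_primitive_mul_deriv hT hg c hβ hK hξ hξs
  have hfe : ∀ᵐ t, t ∈ Ioo 0 T → f t = c - ∫ s in (0 : ℝ)..t, g s := by
    filter_upwards [hc] with t ht htT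
    have := ht htT
    simp only [F] at this
    linarith
  have hz : ∀ t, t ∉ Ioo 0 T → ξ t = 0 := fun t ht => image_eq_zero_of_notMem_tsupport
    fun h => ht (hξs h)
  have hz' : ∀ t, t ∉ Ioo 0 T → deriv ξ t = 0 := fun t ht => by
    by_contra hne
    exact ht (hξs (support_deriv_subset hne))
  rw [integral_congr_ae (g := fun t => β (c - ∫ s in (0 : ℝ)..t, g s) * deriv ξ t), h3]
  · refine integral_congr_ae ?_
    filter_upwards [hfe] with t ht
    by_cases h : t ∈ Ioo 0 T
    · simp only [ht h]
    · simp [hz t h]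
  · filter_upwards [hfe] with t ht
    by_cases h : t ∈ Ioo 0 T
    · simp only [ht h]
    · simp [hz' t h]

/-! ### Mollifiers and Lebesgue points. -/

/-- `k` is a smooth kernel of mass one supported in the ball of radius `ε`, with the natural bounds
on `k` and its derivative. -/
structure IsMollifier {d : ℕ} (C ε : ℝ) (k : Space d → ℝ) : Prop where
  pos : 0 < ε
  smooth : ContDiff ℝ ∞ k
  eq_zero : ∀ w, ε < ‖w‖ → k w = 0
  integral_eq_one : ∫ w, k w = 1
  bound : ∀ w, ‖k w‖ ≤ C / volume.real (Metric.closedBall (0 : Space d) ε)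
  bound_fderiv : ∀ w, ‖fderiv ℝ k w‖ ≤ C / (ε * volume.real (Metric.closedBall (0 : Space d) ε))

theorem volume_closedBall_pos {d : ℕ} {ε : ℝ} (hε : 0 < ε) (x : Space d) :
    0 < volume.real (Metric.closedBall x ε) :=
  ENNReal.toReal_pos (Metric.measure_closedBall_pos _ _ hε).ne' measure_closedBall_lt_top.ne

/-- Rescaling one bump. The bounds are measured against the volume of the ball of radius `ε`, so
that kernels can be compared with averages over balls, and the constant does not depend on `ε`. -/
theorem exists_isMollifier (d : ℕ) :
    ∃ C : ℝ, 0 < C ∧ ∀ ε : ℝ, 0 < ε → ∃ k : Space d → ℝ, IsMollifier C ε k := by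
  let φ : ContDiffBump (0 : Space d) := ⟨1 / 2, 1, by norm_num, by norm_num⟩
  let η : Space d → ℝ := φ.normed volume
  have hη : ContDiff ℝ ∞ η := φ.contDiff_normed
  have hηs : HasCompactSupport η := φ.hasCompactSupport_normed
  have hη0 : ∀ w, 1 < ‖w‖ → η w = 0 := by
    intro w hw
    refine image_eq_zero_of_notMem_tsupport ?_
    rw [φ.tsupport_normed_eq]
    simp only [Metric.mem_closedBall, dist_zero_right, not_le]
    exact hw
  obtain ⟨A, hA⟩ := hη.continuous.bounded_above_of_compact_support hηs
  obtain ⟨B, hB⟩ := (hη.continuous_fderiv (by simp)).bounded_above_of_compact_support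
    (hηs.fderiv (𝕜 := ℝ))
  set V := volume.real (Metric.closedBall (0 : Space d) 1) with hV
  have hVpos : 0 < V := volume_closedBall_pos one_pos _
  have hA0 : 0 ≤ A := (norm_nonneg _).trans (hA 0)
  have hB0 : 0 ≤ B := (norm_nonneg _).trans (hB 0)
  -- `A` and `B` bound the bump and its derivative; the summand `1` only makes the constant
  -- positive.
  refine ⟨(A + B + 1) * V, by positivity, fun ε hε => ?_⟩
  have hVε : volume.real (Metric.closedBall (0 : Space d) ε) = ε ^ d * V := by
    rw [Measure.addHaar_real_closedBall volume (0 : Space d) hε.le, hV,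
      Measure.addHaar_real_closedBall volume (0 : Space d) one_pos.le]
    simp
  refine ⟨fun w => (ε ^ d)⁻¹ * η (ε⁻¹ • w), hε, ?_, ?_, ?_, ?_, ?_⟩
  · exact contDiff_const.mul (hη.comp (contDiff_const_smul _))
  · intro w hw
    rw [hη0, mul_zero]
    rw [norm_smul, norm_inv, Real.norm_of_nonneg hε.le, inv_mul_eq_div, lt_div_iff₀ hε]
    linarith
  · rw [integral_const_mul, Measure.integral_comp_smul]
    have : ∫ w, η w = 1 := φ.integral_normed
    rw [this]
    simp [abs_of_pos hε]
    field_simp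
  · intro w
    rw [hVε, norm_mul, norm_inv, norm_pow, Real.norm_of_nonneg hε.le]
    calc (ε ^ d)⁻¹ * ‖η (ε⁻¹ • w)‖ ≤ (ε ^ d)⁻¹ * (A + B + 1) := by
          gcongr
          linarith [hA (ε⁻¹ • w)]
      _ = (A + B + 1) * V / (ε ^ d * V) := by field_simp
  · intro w
    have h1 : HasFDerivAt (fun w => (ε ^ d)⁻¹ * η (ε⁻¹ • w))
        ((ε ^ d)⁻¹ • (fderiv ℝ η (ε⁻¹ • w)).comp (ε⁻¹ • ContinuousLinearMap.id ℝ (Space d))) w := by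
      refine HasFDerivAt.const_mul ?_ _
      exact HasFDerivAt.comp w ((hη.differentiable (by simp)) (ε⁻¹ • w)).hasFDerivAt
        ((hasFDerivAt_id w).const_smul ε⁻¹)
    rw [h1.fderiv, hVε, norm_smul, norm_inv, norm_pow, Real.norm_of_nonneg hε.le]
    have h2 : ‖(fderiv ℝ η (ε⁻¹ • w)).comp (ε⁻¹ • ContinuousLinearMap.id ℝ (Space d))‖
        ≤ (A + B + 1) * ε⁻¹ := by
      refine (ContinuousLinearMap.opNorm_comp_le _ _).trans ?_
      gcongr
      · linarith [hB (ε⁻¹ • w)]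
      · rw [norm_smul, norm_inv, Real.norm_of_nonneg hε.le]
        have := ContinuousLinearMap.norm_id_le (𝕜 := ℝ) (E := Space d)
        have h3 : 0 < ε⁻¹ := by positivity
        nlinarith
    calc (ε ^ d)⁻¹ * _ ≤ (ε ^ d)⁻¹ * ((A + B + 1) * ε⁻¹) := by gcongr
      _ = (A + B + 1) * V / (ε * (ε ^ d * V)) := by field_simp

theorem integral_norm_le_of_bound_closedBall {d : ℕ} {F : Type*} [NormedAddCommGroup F] {ε A : ℝ}
    {h : Space d → F} (hε : 0 < ε) (h0 : ∀ w, ε < ‖w‖ → h w = 0)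
    (hb : ∀ w, ‖h w‖ ≤ A / volume.real (Metric.closedBall (0 : Space d) ε)) :
    ∫ w, ‖h w‖ ≤ A := by
  have hV := volume_closedBall_pos hε (0 : Space d)
  have h1 : ∫ w, ‖h w‖ = ∫ w in Metric.closedBall (0 : Space d) ε, ‖h w‖ := by
    refine (setIntegral_eq_integral_of_forall_compl_eq_zero fun w hw => ?_).symm
    rw [h0 w (by simpa using hw), norm_zero]
  rw [h1]
  calc ∫ w in Metric.closedBall (0 : Space d) ε, ‖h w‖
      ≤ ∫ _ in Metric.closedBall (0 : Space d) ε,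
          A / volume.real (Metric.closedBall (0 : Space d) ε) := by
        refine integral_mono_of_nonneg (Eventually.of_forall fun _ => norm_nonneg _)
          (integrableOn_const measure_closedBall_lt_top.ne) (Eventually.of_forall hb)
    _ = A := by
        rw [setIntegral_const, smul_eq_mul]
        field_simp

namespace IsMollifier

variable {d : ℕ} {C ε : ℝ} {k : Space d → ℝ}

theorem const_nonneg (hk : IsMollifier C ε k) : 0 ≤ C := by
  have h := (norm_nonneg _).trans (hk.bound 0)
  have hV := volume_closedBall_pos hk.pos (0 : Space d)
  by_contra hC
  exact absurd h (not_le.2 (div_neg_of_neg_of_pos (not_le.1 hC) hV))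

theorem fderiv_eq_zero (hk : IsMollifier C ε k) {w : Space d} (hw : ε < ‖w‖) :
    fderiv ℝ k w = 0 := by
  have : k =ᶠ[𝓝 w] fun _ => 0 := by
    filter_upwards [(isOpen_lt continuous_const continuous_norm).mem_nhds hw] with z hz
    exact hk.eq_zero z hz
  rw [this.fderiv_eq]; simp

theorem hasCompactSupport (hk : IsMollifier C ε k) : HasCompactSupport k :=
  HasCompactSupport.intro (isCompact_closedBall (0 : Space d) ε)
    fun w hw => hk.eq_zero w (by simpa using hw)

theorem continuous (hk : IsMollifier C ε k) : Continuous k := hk.smooth.continuous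

theorem continuous_fderiv (hk : IsMollifier C ε k) : Continuous (fderiv ℝ k) :=
  hk.smooth.continuous_fderiv (by simp)

theorem integrable (hk : IsMollifier C ε k) : Integrable k :=
  hk.continuous.integrable_of_hasCompactSupport hk.hasCompactSupport

theorem integrable_fderiv (hk : IsMollifier C ε k) : Integrable (fderiv ℝ k) :=
  hk.continuous_fderiv.integrable_of_hasCompactSupport (hk.hasCompactSupport.fderiv (𝕜 := ℝ))

theorem integral_norm_le (hk : IsMollifier C ε k) : ∫ w, ‖k w‖ ≤ C :=
  integral_norm_le_of_bound_closedBall hk.pos hk.eq_zero hk.bound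

theorem integral_norm_fderiv_le (hk : IsMollifier C ε k) : ∫ w, ‖fderiv ℝ k w‖ ≤ C / ε :=
  integral_norm_le_of_bound_closedBall hk.pos
    (fun _ hw => hk.fderiv_eq_zero hw) fun w => (hk.bound_fderiv w).trans_eq (by rw [div_div])

end IsMollifier

/-- At Lebesgue points of `σ`, kernels concentrating at the origin do not see `σ - σ x`. -/
theorem ae_tendsto_integral_kernel_mul_sub {d : ℕ} {σ : Space d → ℝ} (hσ : LocallyIntegrable σ) :
    ∀ᵐ x, ∀ (A : ℝ) (ε : ℕ → ℝ) (h : ℕ → Space d → ℝ), (∀ n, 0 < ε n) →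
      Tendsto ε atTop (𝓝 0) → (∀ n w, ε n < ‖w‖ → h n w = 0) →
      (∀ n w, ‖h n w‖ ≤ A / volume.real (Metric.closedBall (0 : Space d) (ε n))) →
      Tendsto (fun n => ∫ y, h n (x - y) * (σ y - σ x)) atTop (𝓝 0) := by
  filter_upwards [IsUnifLocDoublingMeasure.ae_tendsto_average_norm_sub (μ := volume) hσ 0] with
    x hx A ε h hε hε0 h0 hb
  have h1 := hx (fun _ => x) ε (tendsto_nhdsWithin_iff.2 ⟨hε0, Eventually.of_forall hε⟩)
    (Eventually.of_forall fun n => by simp)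
  refine squeeze_zero_norm (fun n => ?_) (by simpa using h1.const_mul A)
  have hVeq : volume.real (Metric.closedBall x (ε n))
      = volume.real (Metric.closedBall (0 : Space d) (ε n)) := by
    simp only [Measure.real, Measure.addHaar_closedBall_center]
  rw [setAverage_eq, hVeq, smul_eq_mul, ← mul_assoc, ← div_eq_mul_inv, ← integral_const_mul]
  have h2 : ∫ y, h n (x - y) * (σ y - σ x)
      = ∫ y in Metric.closedBall x (ε n), h n (x - y) * (σ y - σ x) := by
    refine (setIntegral_eq_integral_of_forall_compl_eq_zero fun y hy => ?_).symm
    rw [h0 n _ (by simpa [dist_eq_norm'] using hy), zero_mul]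
  rw [h2]
  refine norm_integral_le_of_norm_le ?_ (Eventually.of_forall fun y => ?_)
  · exact (((hσ.integrableOn_isCompact (isCompact_closedBall _ _)).sub
      (integrableOn_const measure_closedBall_lt_top.ne)).norm).const_mul _
  · rw [norm_mul]
    exact mul_le_mul_of_nonneg_right (hb n _) (norm_nonneg _)

/-! ### Divergence, mollification and commutator. -/

/-- The divergence of a differentiable vector field. -/
noncomputable def fieldDiv {d : ℕ} (φ : Space d → Space d) (x : Space d) : ℝ :=
  ∑ i, fderiv ℝ φ x (basisVec i) i

/-- The mollification `σ * k`. -/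
noncomputable def mollify {d : ℕ} (k σ : Space d → ℝ) (x : Space d) : ℝ :=
  ∫ y, σ y * k (x - y)

/-- The divergence of the mollification `(σ v) * k`. -/
noncomputable def mollifyDiv {d : ℕ} (k σ : Space d → ℝ) (v : Space d → Space d)
    (x : Space d) : ℝ :=
  ∫ y, σ y * fderiv ℝ k (x - y) (v y)

/-- The commutator `φ · ∇(σ * k) - div ((σ φ) * k)`. -/
noncomputable def commutator {d : ℕ} (k σ : Space d → ℝ) (φ : Space d → Space d)
    (x : Space d) : ℝ :=
  ∫ y, σ y * fderiv ℝ k (x - y) (φ x - φ y)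

/-! ### Integration by parts and translation estimates for vector fields. -/

section Fields

variable {d : ℕ}

theorem sum_basisVec (w : Space d) : ∑ i, w i • (basisVec i : Space d) = w := by
  simpa using (EuclideanSpace.basisFun (Fin d) ℝ).sum_repr w

theorem norm_apply_le (w : Space d) (i : Fin d) : ‖w i‖ ≤ ‖w‖ := PiLp.norm_apply_le w i

theorem clm_apply_eq_sum {F : Type*} [NormedAddCommGroup F] [NormedSpace ℝ F]
    (A : Space d →L[ℝ] F) (w : Space d) : A w = ∑ i, w i • A (basisVec i) := by
  conv_lhs => rw [← sum_basisVec w]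
  simp only [map_sum, map_smul]

theorem norm_clm_le_sum {F : Type*} [NormedAddCommGroup F] [NormedSpace ℝ F]
    (A : Space d →L[ℝ] F) : ‖A‖ ≤ ∑ i, ‖A (basisVec i)‖ := by
  refine A.opNorm_le_bound (Finset.sum_nonneg fun _ _ => norm_nonneg _) fun w => ?_
  rw [clm_apply_eq_sum A w, Finset.sum_mul]
  refine (norm_sum_le _ _).trans (Finset.sum_le_sum fun i _ => ?_)
  rw [norm_smul, mul_comm]
  gcongr
  exact norm_apply_le w i

theorem norm_fieldDiv_le_sum (φ : Space d → Space d) (x : Space d) :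
    ‖fieldDiv φ x‖ ≤ ∑ i, ‖fderiv ℝ φ x (basisVec i)‖ :=
  (norm_sum_le _ _).trans (Finset.sum_le_sum fun _ _ => norm_apply_le _ _)

theorem continuous_fieldDiv {φ : Space d → Space d} (hφ : ContDiff ℝ 1 φ) :
    Continuous (fieldDiv φ) := by
  have := hφ.continuous_fderiv one_ne_zero
  unfold fieldDiv
  refine continuous_finsetSum _ fun i _ => ?_
  exact (EuclideanSpace.proj i : Space d →L[ℝ] ℝ).continuous.comp (this.clm_apply continuous_const)

theorem fieldDiv_eq_zero {φ : Space d → Space d} {x : Space d} (hx : x ∉ tsupport φ) :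
    fieldDiv φ x = 0 := by
  have : fderiv ℝ φ x = 0 := by
    by_contra h
    exact hx (support_fderiv_subset ℝ h)
  simp [fieldDiv, this]

theorem fieldDiv_smul {ζ : Space d → ℝ} {φ : Space d → Space d} {x : Space d}
    (hζ : DifferentiableAt ℝ ζ x) (hφ : DifferentiableAt ℝ φ x) :
    fieldDiv (fun x => ζ x • φ x) x = ζ x * fieldDiv φ x + fderiv ℝ ζ x (φ x) := by
  have : fderiv ℝ (fun x => ζ x • φ x) x = ζ x • fderiv ℝ φ x + (fderiv ℝ ζ x).smulRight (φ x) :=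
    (hζ.hasFDerivAt.smul hφ.hasFDerivAt).fderiv
  unfold fieldDiv
  rw [clm_apply_eq_sum (fderiv ℝ ζ x) (φ x), Finset.mul_sum, ← Finset.sum_add_distrib]
  refine Finset.sum_congr rfl fun i _ => ?_
  simp [this, mul_comm]

theorem integral_fderiv_apply_eq_neg {w : Space d → ℝ} {Φ : Space d → Space d}
    (hw : ContDiff ℝ 1 w) (hΦ : ContDiff ℝ 1 Φ) (hΦs : HasCompactSupport Φ) :
    ∫ x, fderiv ℝ w x (Φ x) = - ∫ x, w x * fieldDiv Φ x := by
  have hcomp : ∀ i : Fin d, ContDiff ℝ 1 (fun x => Φ x i) := fun i =>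
    (EuclideanSpace.proj i : Space d →L[ℝ] ℝ).contDiff.comp hΦ
  have hcomps : ∀ i : Fin d, HasCompactSupport (fun x => Φ x i) := fun i =>
    hΦs.comp_left (g := fun z : Space d => z i) (by simp)
  have hfd : ∀ (i : Fin d) x, fderiv ℝ (fun x => Φ x i) x (basisVec i)
      = fderiv ℝ Φ x (basisVec i) i := by
    intro i x
    have h := ((EuclideanSpace.proj i : Space d →L[ℝ] ℝ).hasFDerivAt (x := Φ x)).comp x
      (hΦ.differentiable one_ne_zero x).hasFDerivAt
    have h' : fderiv ℝ (fun x => Φ x i) x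
      = (EuclideanSpace.proj i : Space d →L[ℝ] ℝ).comp (fderiv ℝ Φ x) := h.fderiv
    rw [h']; simp
  have hcw : ∀ i : Fin d, Continuous fun x => fderiv ℝ w x (basisVec i) := fun i =>
    (hw.continuous_fderiv one_ne_zero).clm_apply continuous_const
  have hcΦ : ∀ i : Fin d, Continuous fun x => fderiv ℝ (fun x => Φ x i) x (basisVec i) := fun i =>
    ((hcomp i).continuous_fderiv one_ne_zero).clm_apply continuous_const
  have hsΦ : ∀ i : Fin d, HasCompactSupport fun x =>
      fderiv ℝ (fun x => Φ x i) x (basisVec i) := fun i => (hcomps i).fderiv_apply (𝕜 := ℝ) _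
  have i1 : ∀ i : Fin d, Integrable fun x => fderiv ℝ w x (basisVec i) * Φ x i := fun i =>
    ((hcw i).mul (hcomp i).continuous).integrable_of_hasCompactSupport (hcomps i).mul_left
  have i2 : ∀ i : Fin d, Integrable fun x =>
      w x * fderiv ℝ (fun x => Φ x i) x (basisVec i) := fun i =>
    (hw.continuous.mul (hcΦ i)).integrable_of_hasCompactSupport (hsΦ i).mul_left
  have i3 : ∀ i : Fin d, Integrable fun x => w x * Φ x i := fun i =>
    (hw.continuous.mul (hcomp i).continuous).integrable_of_hasCompactSupport (hcomps i).mul_left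
  have key : ∀ i : Fin d, ∫ x, fderiv ℝ w x (basisVec i) * Φ x i
      = - ∫ x, w x * fderiv ℝ (fun x => Φ x i) x (basisVec i) := fun i => by
    rw [integral_mul_fderiv_eq_neg_fderiv_mul_of_integrable (i1 i) (i2 i) (i3 i)
      (fun x _ => hw.differentiable one_ne_zero x)
      (fun x _ => (hcomp i).differentiable one_ne_zero x), neg_neg]
  have e1 : ∀ x, fderiv ℝ w x (Φ x) = ∑ i, fderiv ℝ w x (basisVec i) * Φ x i := fun x => by
    rw [clm_apply_eq_sum]
    exact Finset.sum_congr rfl fun i _ => by rw [smul_eq_mul, mul_comm]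
  simp only [e1, fieldDiv, Finset.mul_sum]
  simp only [← hfd]
  rw [integral_finsetSum _ fun i _ => i1 i, integral_finsetSum _ fun i _ => i2 i,
    ← Finset.sum_neg_distrib]
  exact Finset.sum_congr rfl fun i _ => key i

/-- The fundamental theorem of calculus along the segment from `x` to `x - w`. It serves twice: for
the commutator estimate and for the estimate in boundary layers. -/
theorem enorm_sub_le_lintegral_fderiv {φ : Space d → Space d} (hφ : ContDiff ℝ 1 φ)
    (x w : Space d) :
    ‖φ x - φ (x - w)‖ₑ ≤ ∫⁻ s in Ioc (0 : ℝ) 1, ‖fderiv ℝ φ (x - s • w)‖ₑ * ‖w‖ₑ := by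
  have h1 : ∀ s : ℝ, HasDerivAt (fun s : ℝ => φ (x - s • w)) (fderiv ℝ φ (x - s • w) (-w)) s := by
    intro s
    have h2 : HasDerivAt (fun s : ℝ => x - s • w) (-w) s := by
      simpa using ((hasDerivAt_id s).smul_const w).const_sub x
    exact ((hφ.differentiable one_ne_zero (x - s • w)).hasFDerivAt).comp_hasDerivAt s h2
  have hc : Continuous fun s : ℝ => fderiv ℝ φ (x - s • w) (-w) :=
    ((hφ.continuous_fderiv one_ne_zero).comp (by fun_prop)).clm_apply continuous_const
  have h3 := intervalIntegral.integral_eq_sub_of_hasDerivAt (a := 0) (b := 1)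
    (fun s _ => h1 s) (hc.intervalIntegrable _ _)
  rw [← enorm_neg, neg_sub]
  simp only [one_smul, zero_smul, sub_zero] at h3
  rw [← h3, intervalIntegral.integral_of_le zero_le_one]
  refine (enorm_integral_le_lintegral_enorm _).trans (lintegral_mono fun s => ?_)
  simpa using (fderiv ℝ φ (x - s • w)).le_opENorm (-w)

theorem lintegral_enorm_sub_translate_le {φ : Space d → Space d} (hφ : ContDiff ℝ 1 φ)
    (w : Space d) :
    ∫⁻ x, ‖φ x - φ (x - w)‖ₑ ≤ ‖w‖ₑ * ∫⁻ x, ‖fderiv ℝ φ x‖ₑ := by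
  have hc : Continuous (fderiv ℝ φ) := hφ.continuous_fderiv one_ne_zero
  calc ∫⁻ x, ‖φ x - φ (x - w)‖ₑ
      ≤ ∫⁻ x, ∫⁻ s in Ioc (0 : ℝ) 1, ‖fderiv ℝ φ (x - s • w)‖ₑ * ‖w‖ₑ :=
        lintegral_mono fun x => enorm_sub_le_lintegral_fderiv hφ x w
    _ = ∫⁻ s in Ioc (0 : ℝ) 1, ∫⁻ x, ‖fderiv ℝ φ (x - s • w)‖ₑ * ‖w‖ₑ := by
        refine lintegral_lintegral_swap (Measurable.aemeasurable ?_)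
        exact (Continuous.measurable (by fun_prop)).mul_const _
    _ = ∫⁻ _ in Ioc (0 : ℝ) 1, (∫⁻ x, ‖fderiv ℝ φ x‖ₑ) * ‖w‖ₑ := by
        refine lintegral_congr fun s => ?_
        rw [lintegral_mul_const _ (Continuous.measurable (by fun_prop)),
          lintegral_sub_right_eq_self (fun x => ‖fderiv ℝ φ x‖ₑ)]
    _ = ‖w‖ₑ * ∫⁻ x, ‖fderiv ℝ φ x‖ₑ := by
        simp [mul_comm]

end Fields

/-! ### Bounds for mollifications and commutators. -/

section Mollify

variable {d : ℕ} {C ε M : ℝ} {k σ : Space d → ℝ}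

theorem locallyIntegrable_of_bounded (hσ : AEStronglyMeasurable σ volume) (hM : ∀ x, ‖σ x‖ ≤ M) :
    LocallyIntegrable σ :=
  (memLp_top_of_bound hσ M (Eventually.of_forall hM)).locallyIntegrable le_top

theorem mollify_eq_convolution (k σ : Space d → ℝ) :
    mollify k σ = MeasureTheory.convolution σ k (ContinuousLinearMap.mul ℝ ℝ) volume := rfl

theorem contDiff_mollify (hk : IsMollifier C ε k) (hσ : LocallyIntegrable σ) :
    ContDiff ℝ 1 (mollify k σ) := by
  rw [mollify_eq_convolution]
  exact hk.hasCompactSupport.contDiff_convolution_right _ hσ (hk.smooth.of_le (by simp))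

theorem integrable_smul_fderiv_kernel (hk : IsMollifier C ε k) (hσ : LocallyIntegrable σ)
    (x : Space d) : Integrable fun y => σ y • fderiv ℝ k (x - y) := by
  have hc : Continuous fun y => fderiv ℝ k (x - y) := hk.continuous_fderiv.comp (by fun_prop)
  have hs : HasCompactSupport fun y => fderiv ℝ k (x - y) :=
    (hk.hasCompactSupport.fderiv (𝕜 := ℝ)).comp_homeomorph (Homeomorph.subLeft x)
  exact hσ.integrable_smul_right_of_hasCompactSupport hc hs

theorem fderiv_mollify_apply (hk : IsMollifier C ε k) (hσ : LocallyIntegrable σ)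
    (x w : Space d) : fderiv ℝ (mollify k σ) x w = ∫ y, σ y * fderiv ℝ k (x - y) w := by
  have h := (hk.hasCompactSupport.hasFDerivAt_convolution_right (ContinuousLinearMap.mul ℝ ℝ)
    hσ (hk.smooth.of_le (by simp)) x).fderiv
  rw [mollify_eq_convolution, h]
  have h2 : MeasureTheory.convolution σ (fderiv ℝ k)
      ((ContinuousLinearMap.mul ℝ ℝ).precompR (Space d)) volume x
        = ∫ y, σ y • fderiv ℝ k (x - y) := by
    refine integral_congr_ae (Eventually.of_forall fun y => ?_)
    ext z; simp [ContinuousLinearMap.precompR]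
  rw [h2, ContinuousLinearMap.integral_apply (integrable_smul_fderiv_kernel hk hσ x)]
  simp

theorem norm_mollify_le (hk : IsMollifier C ε k) (hM : ∀ x, ‖σ x‖ ≤ M) (x : Space d) :
    ‖mollify k σ x‖ ≤ M * C := by
  have hM0 : 0 ≤ M := (norm_nonneg _).trans (hM 0)
  have hi : Integrable fun y => k (x - y) := hk.integrable.comp_sub_left x
  calc ‖mollify k σ x‖ ≤ ∫ y, M * ‖k (x - y)‖ := by
        refine norm_integral_le_of_norm_le (hi.norm.const_mul M) (Eventually.of_forall fun y => ?_)
        rw [norm_mul]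
        gcongr
        exact hM y
    _ = M * ∫ y, ‖k y‖ := by
        rw [integral_const_mul, integral_sub_left_eq_self (fun y => ‖k y‖)]
    _ ≤ M * C := by gcongr; exact hk.integral_norm_le

theorem integrable_mollifyDiv_kernel (hk : IsMollifier C ε k) (hσ : AEStronglyMeasurable σ volume)
    (hM : ∀ x, ‖σ x‖ ≤ M) {v : Space d → Space d} (hv : Integrable v) (x : Space d) :
    Integrable fun y => σ y * fderiv ℝ k (x - y) (v y) := by
  have hM0 : 0 ≤ M := (norm_nonneg _).trans (hM 0)
  set B := C / (ε * volume.real (Metric.closedBall (0 : Space d) ε))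
  refine Integrable.mono' (hv.norm.const_mul (M * B)) ?_ (Eventually.of_forall fun y => ?_)
  · refine hσ.mul ?_
    have h1 : Continuous fun y => fderiv ℝ k (x - y) := hk.continuous_fderiv.comp (by fun_prop)
    exact (ContinuousLinearMap.apply ℝ ℝ).flip.aestronglyMeasurable_comp₂
      h1.aestronglyMeasurable hv.aestronglyMeasurable
  · rw [norm_mul, mul_assoc]
    gcongr
    · exact hM y
    · exact (ContinuousLinearMap.le_opNorm _ _).trans (by gcongr; exact hk.bound_fderiv _)

/-- A crude bound whose constant blows up as `ε → 0`. It is used at fixed `ε` only, for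
integrability and for continuity in the velocity field. -/
theorem norm_mollifyDiv_le (hk : IsMollifier C ε k)
    (hM : ∀ x, ‖σ x‖ ≤ M) {v : Space d → Space d} (hv : Integrable v) (x : Space d) :
    ‖mollifyDiv k σ v x‖
      ≤ M * (C / (ε * volume.real (Metric.closedBall (0 : Space d) ε))) * ∫ y, ‖v y‖ := by
  have hM0 : 0 ≤ M := (norm_nonneg _).trans (hM 0)
  set B := C / (ε * volume.real (Metric.closedBall (0 : Space d) ε))
  rw [← integral_const_mul]
  refine norm_integral_le_of_norm_le (hv.norm.const_mul (M * B)) (Eventually.of_forall fun y => ?_)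
  rw [norm_mul, mul_assoc]
  gcongr
  · exact hM y
  · exact (ContinuousLinearMap.le_opNorm _ _).trans (by gcongr; exact hk.bound_fderiv _)

theorem mollifyDiv_sub (hk : IsMollifier C ε k) (hσ : AEStronglyMeasurable σ volume)
    (hM : ∀ x, ‖σ x‖ ≤ M) {v w : Space d → Space d} (hv : Integrable v) (hw : Integrable w)
    (x : Space d) :
    mollifyDiv k σ (fun y => v y - w y) x = mollifyDiv k σ v x - mollifyDiv k σ w x := by
  unfold mollifyDiv
  rw [← integral_sub (integrable_mollifyDiv_kernel hk hσ hM hv x)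
    (integrable_mollifyDiv_kernel hk hσ hM hw x)]
  simp only [map_sub, mul_sub]

theorem mollifyDiv_eq_sub_commutator (hk : IsMollifier C ε k)
    (hσ : AEStronglyMeasurable σ volume) (hM : ∀ x, ‖σ x‖ ≤ M) {φ : Space d → Space d}
    (hφ : Integrable φ) (x : Space d) :
    mollifyDiv k σ φ x = fderiv ℝ (mollify k σ) x (φ x) - commutator k σ φ x := by
  have hl := locallyIntegrable_of_bounded hσ hM
  have h1 : Integrable fun y => σ y * fderiv ℝ k (x - y) (φ x) := by
    simpa using (integrable_smul_fderiv_kernel hk hl x).apply_continuousLinearMap (φ x)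
  have h2 := integrable_mollifyDiv_kernel hk hσ hM hφ x
  rw [fderiv_mollify_apply hk hl, commutator]
  simp only [map_sub, mul_sub]
  rw [integral_sub h1 h2]
  simp [mollifyDiv]

/-- The factor `1 / ε` in the size of `∇k` is absorbed by `|φ x - φ y| ≤ Λ ε` on the support of the
kernel. Being uniform in `ε` and `x` for a fixed smooth field, the bound serves as a majorant in
dominated convergence. -/
theorem norm_commutator_le (hk : IsMollifier C ε k) (hM : ∀ x, ‖σ x‖ ≤ M)
    {φ : Space d → Space d} {Λ : ℝ≥0} (hφ : LipschitzWith Λ φ) (x : Space d) :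
    ‖commutator k σ φ x‖ ≤ M * C * Λ := by
  have hM0 : 0 ≤ M := (norm_nonneg _).trans (hM 0)
  have hε := hk.pos
  have hi : Integrable fun y => fderiv ℝ k (x - y) := hk.integrable_fderiv.comp_sub_left x
  calc ‖commutator k σ φ x‖ ≤ ∫ y, M * (Λ * ε) * ‖fderiv ℝ k (x - y)‖ := by
        refine norm_integral_le_of_norm_le (hi.norm.const_mul _) (Eventually.of_forall fun y => ?_)
        rw [norm_mul, mul_assoc]
        gcongr
        · exact hM y
        · rcases lt_or_ge ε ‖x - y‖ with h | h
          · simp [hk.fderiv_eq_zero h]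
          · refine (ContinuousLinearMap.le_opNorm _ _).trans ?_
            rw [mul_comm]
            gcongr
            refine (hφ.norm_sub_le x y).trans ?_
            gcongr
    _ = M * (Λ * ε) * ∫ y, ‖fderiv ℝ k y‖ := by
        rw [integral_const_mul, integral_sub_left_eq_self (fun y => ‖fderiv ℝ k y‖)]
    _ ≤ M * (Λ * ε) * (C / ε) := by gcongr; exact hk.integral_norm_fderiv_le
    _ = M * C * Λ := by field_simp

/-- The commutator estimate of DiPerna and Lions. After the substitution `y = x - w`, the `L¹` norm
of `φ - φ(· - w)` is at most `|w| ‖∇φ‖₁`, and `|w| ≤ ε` on the support compensates `‖∇k‖₁ ≤ C / ε`.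
Only the sup norm of `σ` and the `L¹` norm of `∇φ` enter, which is what allows density arguments in
`φ`. -/
theorem lintegral_enorm_commutator_le (hk : IsMollifier C ε k) (hM : ∀ x, ‖σ x‖ ≤ M)
    {φ : Space d → Space d} (hφ : ContDiff ℝ 1 φ) :
    ∫⁻ x, ‖commutator k σ φ x‖ₑ ≤ ENNReal.ofReal (M * C) * ∫⁻ x, ‖fderiv ℝ φ x‖ₑ := by
  have hM0 : 0 ≤ M := (norm_nonneg _).trans (hM 0)
  have hε := hk.pos
  have hkc := hk.continuous_fderiv
  have hφc := hφ.continuous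
  have h1 : ∀ x, ‖commutator k σ φ x‖ₑ
      ≤ ENNReal.ofReal M * ∫⁻ w, ‖fderiv ℝ k w‖ₑ * ‖φ x - φ (x - w)‖ₑ := by
    intro x
    rw [← lintegral_const_mul' _ _ ENNReal.ofReal_ne_top, ← lintegral_sub_left_eq_self _ x]
    refine (enorm_integral_le_lintegral_enorm _).trans (lintegral_mono fun y => ?_)
    rw [enorm_mul, sub_sub_cancel]
    gcongr
    · rw [← ofReal_norm]; exact ENNReal.ofReal_le_ofReal (hM y)
    · exact ContinuousLinearMap.le_opENorm _ _
  have h2 : ∀ w, ‖fderiv ℝ k w‖ₑ * ‖w‖ₑ ≤ ‖fderiv ℝ k w‖ₑ * ENNReal.ofReal ε := by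
    intro w
    rcases lt_or_ge ε ‖w‖ with h | h
    · rw [← ofReal_norm (fderiv ℝ k w), hk.fderiv_eq_zero h, norm_zero, ENNReal.ofReal_zero,
        zero_mul, zero_mul]
    · gcongr
      rw [← ofReal_norm]; exact ENNReal.ofReal_le_ofReal h
  have h3 : ∫⁻ w, ‖fderiv ℝ k w‖ₑ ≤ ENNReal.ofReal (C / ε) := by
    rw [← ofReal_integral_norm_eq_lintegral_enorm hk.integrable_fderiv]
    exact ENNReal.ofReal_le_ofReal hk.integral_norm_fderiv_le
  calc ∫⁻ x, ‖commutator k σ φ x‖ₑ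
      ≤ ∫⁻ x, ENNReal.ofReal M * ∫⁻ w, ‖fderiv ℝ k w‖ₑ * ‖φ x - φ (x - w)‖ₑ := lintegral_mono h1
    _ = ENNReal.ofReal M * ∫⁻ x, ∫⁻ w, ‖fderiv ℝ k w‖ₑ * ‖φ x - φ (x - w)‖ₑ := by
        rw [lintegral_const_mul' _ _ ENNReal.ofReal_ne_top]
    _ = ENNReal.ofReal M * ∫⁻ w, ∫⁻ x, ‖fderiv ℝ k w‖ₑ * ‖φ x - φ (x - w)‖ₑ := by
        rw [lintegral_lintegral_swap]
        have m1 : Measurable fun p : Space d × Space d => ‖fderiv ℝ k p.2‖ₑ :=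
          Continuous.measurable (by fun_prop)
        have m2 : Measurable fun p : Space d × Space d => ‖φ p.1 - φ (p.1 - p.2)‖ₑ :=
          Continuous.measurable (by fun_prop)
        exact (m1.mul m2).aemeasurable
    _ ≤ ENNReal.ofReal M *
          ∫⁻ w, ‖fderiv ℝ k w‖ₑ * (ENNReal.ofReal ε * ∫⁻ x, ‖fderiv ℝ φ x‖ₑ) := by
        gcongr with w
        rw [lintegral_const_mul _ (Continuous.measurable (by fun_prop)), ← mul_assoc]
        refine (mul_le_mul_right (lintegral_enorm_sub_translate_le hφ w) _).trans ?_
        rw [← mul_assoc]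
        exact mul_le_mul_left (h2 w) _
    _ = ENNReal.ofReal M * ((∫⁻ w, ‖fderiv ℝ k w‖ₑ)
          * (ENNReal.ofReal ε * ∫⁻ x, ‖fderiv ℝ φ x‖ₑ)) := by
        rw [lintegral_mul_const _ (Continuous.measurable (by fun_prop))]
    _ ≤ ENNReal.ofReal M * (ENNReal.ofReal (C / ε)
          * (ENNReal.ofReal ε * ∫⁻ x, ‖fderiv ℝ φ x‖ₑ)) := by gcongr
    _ = ENNReal.ofReal (M * C) * ∫⁻ x, ‖fderiv ℝ φ x‖ₑ := by
        rw [← mul_assoc, ← mul_assoc, ← ENNReal.ofReal_mul hM0,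
          ← ENNReal.ofReal_mul (by have := hk.const_nonneg; positivity)]
        congr 2
        field_simp

end Mollify

/-! ### Pointwise limits of mollifications and commutators. -/

section Limits

variable {d : ℕ} {C M : ℝ} {σ : Space d → ℝ} {ε : ℕ → ℝ} {k : ℕ → Space d → ℝ}

theorem mollify_eq_add {C ε : ℝ} {k : Space d → ℝ} (hk : IsMollifier C ε k)
    (hσ : LocallyIntegrable σ) (x : Space d) :
    mollify k σ x = σ x + ∫ y, k (x - y) * (σ y - σ x) := by
  have hc : Continuous fun y => k (x - y) := hk.continuous.comp (by fun_prop)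
  have hs : HasCompactSupport fun y => k (x - y) :=
    hk.hasCompactSupport.comp_homeomorph (Homeomorph.subLeft x)
  have h1 : Integrable fun y => k (x - y) * σ y := by
    simpa using hσ.integrable_smul_left_of_hasCompactSupport hc hs
  have h2 : Integrable fun y => k (x - y) * σ x := (hk.integrable.comp_sub_left x).mul_const _
  simp only [mul_sub]
  rw [integral_sub h1 h2, integral_mul_const, integral_sub_left_eq_self k, hk.integral_eq_one]
  simp [mollify, mul_comm]

theorem ae_tendsto_mollify (hk : ∀ n, IsMollifier C (ε n) (k n)) (hε : Tendsto ε atTop (𝓝 0))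
    (hσ : LocallyIntegrable σ) :
    ∀ᵐ x, Tendsto (fun n => mollify (k n) σ x) atTop (𝓝 (σ x)) := by
  filter_upwards [ae_tendsto_integral_kernel_mul_sub hσ] with x hx
  have h := hx C ε k (fun n => (hk n).pos) hε (fun n => (hk n).eq_zero) (fun n => (hk n).bound)
  simp only [fun n => mollify_eq_add (hk n) hσ x]
  simpa using h.const_add (σ x)

/-- The mollification of the constant `1` is constant; its derivative is this integral. -/
theorem integral_fderiv_kernel_eq_zero {C ε : ℝ} {k : Space d → ℝ} (hk : IsMollifier C ε k)
    (x w : Space d) : ∫ y, fderiv ℝ k (x - y) w = 0 := by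
  have h1 := fderiv_mollify_apply hk (σ := fun _ => 1) (locallyIntegrable_const 1) x w
  have h2 : mollify k (fun _ => 1) = fun _ => 1 := by
    funext z
    simp only [mollify, one_mul]
    rw [integral_sub_left_eq_self k, hk.integral_eq_one]
  rw [h2] at h1
  simpa using h1.symm

theorem integral_fderiv_kernel_apply {C ε : ℝ} {k : Space d → ℝ} (hk : IsMollifier C ε k)
    {φ : Space d → Space d} (hφ : ContDiff ℝ 1 φ) (hφs : HasCompactSupport φ) (x : Space d) :
    ∫ y, fderiv ℝ k (x - y) (φ y) = mollify k (fieldDiv φ) x := by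
  have hw : ContDiff ℝ 1 fun y => k (x - y) :=
    (hk.smooth.of_le (by simp)).comp (contDiff_const.sub contDiff_id)
  have h := integral_fderiv_apply_eq_neg hw hφ hφs
  have hd : ∀ y, fderiv ℝ (fun y => k (x - y)) y = - fderiv ℝ k (x - y) := by
    intro y
    have h1 := ((hk.smooth.differentiable (by simp)) (x - y)).hasFDerivAt.comp y
      ((hasFDerivAt_id y).const_sub x)
    have h2 := h1.fderiv
    simp only [Function.comp_def] at h2
    rw [h2]
    ext z; simp
  simp only [hd, neg_apply, integral_neg, neg_inj] at h
  rw [h]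
  simp only [mollify, mul_comm]

/-- At a Lebesgue point of `σ`, the value `σ y` may be replaced by `σ x`. The commutator of the
constant `1` is `-(div φ) * k`, because `∇k` has mean zero and the other term integrates by parts;
this tends to `-div φ`. -/
theorem ae_tendsto_commutator (hk : ∀ n, IsMollifier C (ε n) (k n)) (hε : Tendsto ε atTop (𝓝 0))
    (hσ : AEStronglyMeasurable σ volume) (hM : ∀ x, ‖σ x‖ ≤ M) {φ : Space d → Space d}
    (hφ : ContDiff ℝ 1 φ) (hφs : HasCompactSupport φ) :
    ∀ᵐ x, Tendsto (fun n => commutator (k n) σ φ x) atTop (𝓝 (-(σ x * fieldDiv φ x))) := by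
  have hl := locallyIntegrable_of_bounded hσ hM
  obtain ⟨Λ, hΛ⟩ := hφ.lipschitzWith_of_hasCompactSupport hφs one_ne_zero
  have hφi : Integrable φ := hφ.continuous.integrable_of_hasCompactSupport hφs
  filter_upwards [ae_tendsto_integral_kernel_mul_sub hl,
    ae_tendsto_mollify hk hε (continuous_fieldDiv hφ).locallyIntegrable] with x hx hx2
  -- This kernel depends on `x` itself, so it is essential that the exceptional null set of the
  -- Lebesgue-point lemma is chosen before the kernels. The Lipschitz bound on `φ` gives it the size
  -- `CΛ` divided by the volume of the ball.
  let h : ℕ → Space d → ℝ := fun n w => fderiv ℝ (k n) w (φ x - φ (x - w))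
  have h1 := hx (C * Λ) ε h (fun n => (hk n).pos) hε
    (fun n w hw => by simp [h, (hk n).fderiv_eq_zero hw]) (by
      intro n w
      have hεn := (hk n).pos
      have hC := (hk n).const_nonneg
      have hV := volume_closedBall_pos hεn (0 : Space d)
      rcases lt_or_ge (ε n) ‖w‖ with hw | hw
      · simp only [h, (hk n).fderiv_eq_zero hw]
        rw [zero_apply, norm_zero]
        positivity
      · refine (ContinuousLinearMap.le_opNorm _ _).trans ?_
        calc _ ≤ C / (ε n * volume.real (Metric.closedBall (0 : Space d) (ε n))) * (Λ * ε n) := by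
              gcongr
              · exact (hk n).bound_fderiv w
              · refine (hΛ.norm_sub_le _ _).trans ?_
                rw [sub_sub_cancel]
                gcongr
          _ = _ := by field_simp)
  have e : ∀ n, commutator (k n) σ φ x
      = (∫ y, h n (x - y) * (σ y - σ x)) - σ x * mollify (k n) (fieldDiv φ) x := by
    intro n
    have i1 : Integrable fun y => fderiv ℝ (k n) (x - y) (φ x) :=
      ((hk n).integrable_fderiv.comp_sub_left x).apply_continuousLinearMap (φ x)
    have i2 : Integrable fun y => fderiv ℝ (k n) (x - y) (φ y) := by
      simpa using integrable_mollifyDiv_kernel (hk n) (σ := fun _ => 1) (M := 1)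
        aestronglyMeasurable_const (by simp) hφi x
    have i3 : Integrable fun y => σ y * fderiv ℝ (k n) (x - y) (φ x) := by
      simpa using (integrable_smul_fderiv_kernel (hk n) hl x).apply_continuousLinearMap (φ x)
    have i4 := integrable_mollifyDiv_kernel (hk n) hσ hM hφi x
    have i5 : Integrable fun y => σ y * fderiv ℝ (k n) (x - y) (φ x - φ y) := by
      simp only [map_sub, mul_sub]; exact i3.sub i4
    have i6 : Integrable fun y => fderiv ℝ (k n) (x - y) (φ x - φ y) := by
      simp only [map_sub]; exact i1.sub i2
    have e1 : ∫ y, fderiv ℝ (k n) (x - y) (φ x - φ y) = - mollify (k n) (fieldDiv φ) x := by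
      simp only [map_sub]
      rw [integral_sub i1 i2, integral_fderiv_kernel_eq_zero (hk n),
        integral_fderiv_kernel_apply (hk n) hφ hφs, zero_sub]
    have e2 : ∫ y, h n (x - y) * (σ y - σ x)
        = commutator (k n) σ φ x - (∫ y, fderiv ℝ (k n) (x - y) (φ x - φ y)) * σ x := by
      rw [commutator, ← integral_mul_const, ← integral_sub i5 (i6.mul_const _)]
      refine integral_congr_ae (Eventually.of_forall fun y => ?_)
      simp only [h, sub_sub_cancel]
      ring
    rw [e2, e1]; ring
  simp only [e]
  simpa using h1.sub (hx2.const_mul (σ x))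

end Limits

/-! ### The mollified equation at a fixed time, for smooth velocity fields. -/

theorem aestronglyMeasurable_mollifyDiv {d : ℕ} {C ε : ℝ} {k : Space d → ℝ} (hk : IsMollifier C ε k)
    {σ : Space d → ℝ} (hσ : AEStronglyMeasurable σ volume) {v : Space d → Space d}
    (hv : AEStronglyMeasurable v volume) : AEStronglyMeasurable (mollifyDiv k σ v) volume := by
  have hkc := hk.continuous_fderiv
  have h1 : Continuous fun p : Space d × Space d => fderiv ℝ k (p.1 - p.2) := by fun_prop
  have h2 : AEStronglyMeasurable
      (fun p : Space d × Space d => σ p.2 * fderiv ℝ k (p.1 - p.2) (v p.2))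
      ((volume : Measure (Space d)).prod volume) := by
    refine (hσ.comp_snd).mul ?_
    exact (ContinuousLinearMap.apply ℝ ℝ).flip.aestronglyMeasurable_comp₂
      h1.aestronglyMeasurable hv.comp_snd
  exact h2.integral_prod_right'

/-- `∫ β'(σ * k) div ((σ v) * k) ζ`. -/
noncomputable def mollifiedTerm {d : ℕ} (β : ℝ → ℝ) (k σ ζ : Space d → ℝ)
    (v : Space d → Space d) : ℝ :=
  ∫ x, deriv β (mollify k σ x) * mollifyDiv k σ v x * ζ x

/-- `∫ (β'(σ) σ - β(σ)) ζ tr G - β(σ) v · ∇ζ`. -/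
noncomputable def limitTerm {d : ℕ} (β : ℝ → ℝ) (σ ζ : Space d → ℝ)
    (v : Space d → Space d) (G : Fin d → Space d → Space d) : ℝ :=
  ∫ x, ((deriv β (σ x) * σ x - β (σ x)) * (∑ i, G i x i) * ζ x - β (σ x) * fderiv ℝ ζ x (v x))

/-- The `W^{1,1}` size of a vector field `v` with gradient `G`. -/
noncomputable def fieldSize {d : ℕ} (v : Space d → Space d) (G : Fin d → Space d → Space d) : ℝ :=
  (∫ x, ‖v x‖) + ∑ i, ∫ x, ‖G i x‖

/-- The data of a renormalizing function and of a test function at a fixed time. -/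
structure SliceData {d : ℕ} (M K₀ K₁ Z : ℝ) (β : ℝ → ℝ) (σ ζ : Space d → ℝ) : Prop where
  contDiff : ContDiff ℝ 1 β
  bound : ∀ s, ‖β s‖ ≤ K₀
  bound_deriv : ∀ s, ‖deriv β s‖ ≤ K₁
  measurable : AEStronglyMeasurable σ volume
  bound_density : ∀ x, ‖σ x‖ ≤ M
  smooth : ContDiff ℝ 1 ζ
  hasCompactSupport : HasCompactSupport ζ
  bound_test : ∀ x, ‖ζ x‖ ≤ Z
  bound_test_fderiv : ∀ x, ‖fderiv ℝ ζ x‖ ≤ Z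

namespace SliceData

variable {d : ℕ} {C ε M K₀ K₁ Z : ℝ} {β : ℝ → ℝ} {k σ ζ : Space d → ℝ}

theorem nonneg (h : SliceData M K₀ K₁ Z β σ ζ) : 0 ≤ M ∧ 0 ≤ K₀ ∧ 0 ≤ K₁ ∧ 0 ≤ Z :=
  ⟨(norm_nonneg _).trans (h.bound_density 0), (norm_nonneg _).trans (h.bound 0),
    (norm_nonneg _).trans (h.bound_deriv 0), (norm_nonneg _).trans (h.bound_test 0)⟩

theorem continuous_deriv (h : SliceData M K₀ K₁ Z β σ ζ) : Continuous (deriv β) :=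
  h.contDiff.continuous_deriv le_rfl

theorem locallyIntegrable (h : SliceData M K₀ K₁ Z β σ ζ) : LocallyIntegrable σ :=
  locallyIntegrable_of_bounded h.measurable h.bound_density

theorem integrable_test (h : SliceData M K₀ K₁ Z β σ ζ) : Integrable ζ :=
  h.smooth.continuous.integrable_of_hasCompactSupport h.hasCompactSupport

theorem continuous_comp_mollify (h : SliceData M K₀ K₁ Z β σ ζ) (hk : IsMollifier C ε k) :
    Continuous fun x => deriv β (mollify k σ x) :=
  h.continuous_deriv.comp (contDiff_mollify hk h.locallyIntegrable).continuous

theorem integrable_mollifiedTerm (h : SliceData M K₀ K₁ Z β σ ζ) (hk : IsMollifier C ε k)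
    {v : Space d → Space d} (hv : Integrable v) :
    Integrable fun x => deriv β (mollify k σ x) * mollifyDiv k σ v x * ζ x := by
  refine h.integrable_test.bdd_mul
    (c := K₁ * (M * (C / (ε * volume.real (Metric.closedBall (0 : Space d) ε))) * ∫ y, ‖v y‖))
    ((h.continuous_comp_mollify hk).aestronglyMeasurable.mul
      (aestronglyMeasurable_mollifyDiv hk h.measurable hv.aestronglyMeasurable))
    (Eventually.of_forall fun x => ?_)
  rw [norm_mul]
  have := h.nonneg.2.2.1
  gcongr
  · exact h.bound_deriv _
  · exact norm_mollifyDiv_le hk h.bound_density hv x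

theorem mollifiedTerm_sub (h : SliceData M K₀ K₁ Z β σ ζ) (hk : IsMollifier C ε k)
    {v w : Space d → Space d} (hv : Integrable v) (hw : Integrable w) :
    mollifiedTerm β k σ ζ (fun x => v x - w x)
      = mollifiedTerm β k σ ζ v - mollifiedTerm β k σ ζ w := by
  unfold mollifiedTerm
  rw [← integral_sub (h.integrable_mollifiedTerm hk hv) (h.integrable_mollifiedTerm hk hw)]
  refine integral_congr_ae (Eventually.of_forall fun x => ?_)
  simp only [mollifyDiv_sub hk h.measurable h.bound_density hv hw]
  ring

theorem norm_mollifiedTerm_le_integral_norm (h : SliceData M K₀ K₁ Z β σ ζ)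
    (hk : IsMollifier C ε k) {v : Space d → Space d} (hv : Integrable v) :
    ‖mollifiedTerm β k σ ζ v‖
      ≤ (K₁ * (M * (C / (ε * volume.real (Metric.closedBall (0 : Space d) ε)))) * ∫ x, ‖ζ x‖)
        * ∫ x, ‖v x‖ := by
  have hn := h.nonneg
  have := hn.2.2.1
  set B := M * (C / (ε * volume.real (Metric.closedBall (0 : Space d) ε))) with hB
  calc ‖mollifiedTerm β k σ ζ v‖ ≤ ∫ x, K₁ * (B * ∫ y, ‖v y‖) * ‖ζ x‖ := by
        refine norm_integral_le_of_norm_le (h.integrable_test.norm.const_mul _)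
          (Eventually.of_forall fun x => ?_)
        rw [norm_mul, norm_mul]
        gcongr
        · exact h.bound_deriv _
        · exact norm_mollifyDiv_le hk h.bound_density hv x
    _ = _ := by rw [integral_const_mul]; ring

theorem integrable_commutator_mul (h : SliceData M K₀ K₁ Z β σ ζ) (hk : IsMollifier C ε k)
    {φ : Space d → Space d} (hφ : ContDiff ℝ 1 φ) (hφs : HasCompactSupport φ) :
    AEStronglyMeasurable (commutator k σ φ) volume ∧
      Integrable fun x => deriv β (mollify k σ x) * commutator k σ φ x * ζ x := by
  obtain ⟨Λ, hΛ⟩ := hφ.lipschitzWith_of_hasCompactSupport hφs one_ne_zero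
  have hφi : Integrable φ := hφ.continuous.integrable_of_hasCompactSupport hφs
  have hm : AEStronglyMeasurable (commutator k σ φ) volume := by
    have : commutator k σ φ = fun x => fderiv ℝ (mollify k σ) x (φ x) - mollifyDiv k σ φ x := by
      funext x
      rw [mollifyDiv_eq_sub_commutator hk h.measurable h.bound_density hφi]; ring
    rw [this]
    refine AEStronglyMeasurable.sub (Continuous.aestronglyMeasurable ?_)
      (aestronglyMeasurable_mollifyDiv hk h.measurable hφi.aestronglyMeasurable)
    exact ((contDiff_mollify hk h.locallyIntegrable).continuous_fderiv one_ne_zero).clm_apply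
      hφ.continuous
  refine ⟨hm, h.integrable_test.bdd_mul (c := K₁ * (M * C * Λ))
    ((h.continuous_comp_mollify hk).aestronglyMeasurable.mul hm)
    (Eventually.of_forall fun x => ?_)⟩
  rw [norm_mul]
  have := h.nonneg.2.2.1
  gcongr
  · exact h.bound_deriv _
  · exact norm_commutator_le hk h.bound_density hΛ x

theorem integrable_comp_mollify_mul (h : SliceData M K₀ K₁ Z β σ ζ) (hk : IsMollifier C ε k)
    {φ : Space d → Space d} (hφ : ContDiff ℝ 1 φ) (hφs : HasCompactSupport φ) :
    Integrable fun x => β (mollify k σ x) * (ζ x * fieldDiv φ x + fderiv ℝ ζ x (φ x)) := by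
  have hc : Continuous fun x => ζ x * fieldDiv φ x + fderiv ℝ ζ x (φ x) :=
    (h.smooth.continuous.mul (continuous_fieldDiv hφ)).add
      ((h.smooth.continuous_fderiv one_ne_zero).clm_apply hφ.continuous)
  refine ((h.contDiff.continuous.comp
    (contDiff_mollify hk h.locallyIntegrable).continuous).mul hc).integrable_of_hasCompactSupport ?_
  refine HasCompactSupport.intro hφs.isCompact fun x hx => ?_
  simp [fieldDiv_eq_zero hx, image_eq_zero_of_notMem_tsupport hx]

/-- Since `β'(σ * k) ∇(σ * k) = ∇(β(σ * k))`, the transport part of `div ((σφ) * k)` is a gradient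
and can be integrated by parts against `ζ φ`. No derivative falls on `σ * k` any more, except
through the commutator. -/
theorem mollifiedTerm_eq (h : SliceData M K₀ K₁ Z β σ ζ) (hk : IsMollifier C ε k)
    {φ : Space d → Space d} (hφ : ContDiff ℝ 1 φ) (hφs : HasCompactSupport φ) :
    mollifiedTerm β k σ ζ φ
      = - (∫ x, β (mollify k σ x) * (ζ x * fieldDiv φ x + fderiv ℝ ζ x (φ x)))
        - ∫ x, deriv β (mollify k σ x) * commutator k σ φ x * ζ x := by
  have hφi : Integrable φ := hφ.continuous.integrable_of_hasCompactSupport hφs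
  have hm := contDiff_mollify hk h.locallyIntegrable
  have hw : ContDiff ℝ 1 fun x => β (mollify k σ x) := h.contDiff.comp hm
  have hd : ∀ x, fderiv ℝ (fun x => β (mollify k σ x)) x
      = deriv β (mollify k σ x) • fderiv ℝ (mollify k σ) x := fun x =>
    ((h.contDiff.differentiable one_ne_zero _).hasDerivAt.comp_hasFDerivAt x
      (hm.differentiable one_ne_zero x).hasFDerivAt).fderiv
  have h1 := integral_fderiv_apply_eq_neg hw (h.smooth.smul hφ) hφs.smul_left
  have h2 : ∀ x, fieldDiv (fun x => ζ x • φ x) x = ζ x * fieldDiv φ x + fderiv ℝ ζ x (φ x) :=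
    fun x => fieldDiv_smul (h.smooth.differentiable one_ne_zero x)
      (hφ.differentiable one_ne_zero x)
  change ∫ x, fderiv ℝ (fun x => β (mollify k σ x)) x (ζ x • φ x)
    = - ∫ x, β (mollify k σ x) * fieldDiv (fun x => ζ x • φ x) x at h1
  simp only [h2] at h1
  rw [← h1, ← integral_sub]
  · refine integral_congr_ae (Eventually.of_forall fun x => ?_)
    simp only [hd, mollifyDiv_eq_sub_commutator hk h.measurable h.bound_density hφi, smul_apply,
      map_smul, smul_eq_mul]
    ring
  · refine Continuous.integrable_of_hasCompactSupport ?_ ?_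
    · exact (hw.continuous_fderiv one_ne_zero).clm_apply (h.smooth.continuous.smul hφ.continuous)
    · refine HasCompactSupport.intro hφs.isCompact fun x hx => ?_
      simp [image_eq_zero_of_notMem_tsupport hx]
  · exact (h.integrable_commutator_mul hk hφ hφs).2

/-- The essential point is that the constant does not involve `ε`: the first term after integration
by parts is controlled by the bound on `β`, the second by the `L¹` commutator estimate. -/
theorem norm_mollifiedTerm_le (h : SliceData M K₀ K₁ Z β σ ζ) (hk : IsMollifier C ε k)
    {φ : Space d → Space d} (hφ : ContDiff ℝ 1 φ) (hφs : HasCompactSupport φ) :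
    ‖mollifiedTerm β k σ ζ φ‖
      ≤ Z * (K₀ + K₁ * (M * C)) * fieldSize φ (fun i x => fderiv ℝ φ x (basisVec i)) := by
  obtain ⟨hM, hK₀, hK₁, hZ⟩ := h.nonneg
  have hC := hk.const_nonneg
  have hφi : Integrable φ := hφ.continuous.integrable_of_hasCompactSupport hφs
  have hdi : ∀ i, Integrable fun x => fderiv ℝ φ x (basisVec i) := fun i =>
    ((hφ.continuous_fderiv one_ne_zero).clm_apply
      continuous_const).integrable_of_hasCompactSupport (hφs.fderiv_apply (𝕜 := ℝ) _)
  have hDi : Integrable (fderiv ℝ φ) := (hφ.continuous_fderiv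
    one_ne_zero).integrable_of_hasCompactSupport (hφs.fderiv (𝕜 := ℝ))
  set S := ∑ i, ∫ x, ‖fderiv ℝ φ x (basisVec i)‖ with hS
  have hSsum : S = ∫ x, ∑ i, ‖fderiv ℝ φ x (basisVec i)‖ :=
    (integral_finsetSum _ fun i _ => (hdi i).norm).symm
  have hDS : ∫ x, ‖fderiv ℝ φ x‖ ≤ S := by
    rw [hSsum]
    exact integral_mono hDi.norm (integrable_finsetSum _ fun i _ => (hdi i).norm)
      fun x => norm_clm_le_sum _
  have hcomm : ∫ x, ‖commutator k σ φ x‖ ≤ M * C * S := by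
    refine le_trans ?_ (mul_le_mul_of_nonneg_left hDS (by positivity))
    have h1 := lintegral_enorm_commutator_le hk h.bound_density hφ
    rw [integral_norm_eq_lintegral_enorm (h.integrable_commutator_mul hk hφ hφs).1,
      integral_norm_eq_lintegral_enorm hDi.aestronglyMeasurable]
    have h2 := ENNReal.toReal_mono (ENNReal.mul_ne_top ENNReal.ofReal_ne_top hDi.2.ne) h1
    rwa [ENNReal.toReal_mul, ENNReal.toReal_ofReal (by positivity)] at h2
  have hcommi : Integrable (commutator k σ φ) := by
    refine ⟨(h.integrable_commutator_mul hk hφ hφs).1, ?_⟩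
    exact (lintegral_enorm_commutator_le hk h.bound_density hφ).trans_lt
      (ENNReal.mul_lt_top ENNReal.ofReal_lt_top hDi.2)
  have t1 : ‖∫ x, β (mollify k σ x) * (ζ x * fieldDiv φ x + fderiv ℝ ζ x (φ x))‖
      ≤ K₀ * Z * ((∫ x, ‖φ x‖) + S) := by
    rw [hSsum, ← integral_add hφi.norm (integrable_finsetSum _ fun i _ => (hdi i).norm),
      ← integral_const_mul]
    refine norm_integral_le_of_norm_le ((hφi.norm.add
      (integrable_finsetSum _ fun i _ => (hdi i).norm)).const_mul _)
      (Eventually.of_forall fun x => ?_)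
    rw [norm_mul, mul_assoc]
    gcongr
    · exact h.bound _
    · refine (norm_add_le _ _).trans ?_
      rw [mul_add, add_comm, norm_mul]
      gcongr
      · exact (ContinuousLinearMap.le_opNorm _ _).trans (by gcongr; exact h.bound_test_fderiv x)
      · exact h.bound_test x
      · exact norm_fieldDiv_le_sum φ x
  have t2 : ‖∫ x, deriv β (mollify k σ x) * commutator k σ φ x * ζ x‖ ≤ K₁ * Z * (M * C * S) := by
    refine le_trans ?_ (mul_le_mul_of_nonneg_left hcomm (by positivity))
    rw [← integral_const_mul]
    refine norm_integral_le_of_norm_le (hcommi.norm.const_mul _) (Eventually.of_forall fun x => ?_)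
    rw [norm_mul, norm_mul]
    have a1 := h.bound_deriv (mollify k σ x)
    have a2 := h.bound_test x
    calc _ ≤ K₁ * ‖commutator k σ φ x‖ * Z := by gcongr
      _ = _ := by ring
  rw [h.mollifiedTerm_eq hk hφ hφs]
  have hI : 0 ≤ ∫ x, ‖φ x‖ := integral_nonneg fun _ => norm_nonneg _
  calc _ ≤ K₀ * Z * ((∫ x, ‖φ x‖) + S) + K₁ * Z * (M * C * S) := by
        refine (norm_sub_le _ _).trans ?_
        rw [norm_neg]
        exact add_le_add t1 t2
    _ ≤ Z * (K₀ + K₁ * (M * C)) * ((∫ x, ‖φ x‖) + S) := by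
        have : 0 ≤ Z * (K₁ * (M * C)) * ∫ x, ‖φ x‖ := by positivity
        nlinarith

/-- Both integrals of `mollifiedTerm_eq` converge by dominated convergence. The limit `-σ div φ` of
the commutator turns `-β(σ) div φ` into `(β'(σ) σ - β(σ)) div φ`. -/
theorem tendsto_mollifiedTerm_of_contDiff (h : SliceData M K₀ K₁ Z β σ ζ) {ε : ℕ → ℝ}
    {k : ℕ → Space d → ℝ} (hk : ∀ n, IsMollifier C (ε n) (k n)) (hε : Tendsto ε atTop (𝓝 0))
    {φ : Space d → Space d} (hφ : ContDiff ℝ 1 φ) (hφs : HasCompactSupport φ) :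
    Tendsto (fun n => mollifiedTerm β (k n) σ ζ φ) atTop
      (𝓝 (limitTerm β σ ζ φ (fun i x => fderiv ℝ φ x (basisVec i)))) := by
  obtain ⟨hM, hK₀, hK₁, hZ⟩ := h.nonneg
  have hC := (hk 0).const_nonneg
  obtain ⟨Λ, hΛ⟩ := hφ.lipschitzWith_of_hasCompactSupport hφs one_ne_zero
  have hc : Continuous fun x => ζ x * fieldDiv φ x + fderiv ℝ ζ x (φ x) :=
    (h.smooth.continuous.mul (continuous_fieldDiv hφ)).add
      ((h.smooth.continuous_fderiv one_ne_zero).clm_apply hφ.continuous)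
  have hcs : HasCompactSupport fun x => ζ x * fieldDiv φ x + fderiv ℝ ζ x (φ x) :=
    HasCompactSupport.intro hφs.isCompact fun x hx => by
      simp [fieldDiv_eq_zero hx, image_eq_zero_of_notMem_tsupport hx]
  have hci := hc.integrable_of_hasCompactSupport hcs (μ := volume)
  have l1 : Tendsto (fun n => ∫ x, β (mollify (k n) σ x)
      * (ζ x * fieldDiv φ x + fderiv ℝ ζ x (φ x))) atTop
      (𝓝 (∫ x, β (σ x) * (ζ x * fieldDiv φ x + fderiv ℝ ζ x (φ x)))) := by
    refine tendsto_integral_of_dominated_convergence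
      (fun x => K₀ * ‖ζ x * fieldDiv φ x + fderiv ℝ ζ x (φ x)‖)
      (fun n => (h.integrable_comp_mollify_mul (hk n) hφ hφs).aestronglyMeasurable)
      (hci.norm.const_mul _)
      (fun n => Eventually.of_forall fun x => by rw [norm_mul]; gcongr; exact h.bound _) ?_
    filter_upwards [ae_tendsto_mollify hk hε h.locallyIntegrable] with x hx
    exact ((h.contDiff.continuous.tendsto _).comp hx).mul_const _
  have l2 : Tendsto (fun n => ∫ x, deriv β (mollify (k n) σ x) * commutator (k n) σ φ x * ζ x)
      atTop (𝓝 (∫ x, deriv β (σ x) * (-(σ x * fieldDiv φ x)) * ζ x)) := by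
    refine tendsto_integral_of_dominated_convergence (fun x => K₁ * (M * C * Λ) * ‖ζ x‖)
      (fun n => (h.integrable_commutator_mul (hk n) hφ hφs).2.aestronglyMeasurable)
      (h.integrable_test.norm.const_mul _)
      (fun n => Eventually.of_forall fun x => ?_) ?_
    · rw [norm_mul, norm_mul]
      gcongr
      · exact h.bound_deriv _
      · exact norm_commutator_le (hk n) h.bound_density hΛ x
    · filter_upwards [ae_tendsto_mollify hk hε h.locallyIntegrable,
        ae_tendsto_commutator hk hε h.measurable h.bound_density hφ hφs] with x hx hx2
      exact (((h.continuous_deriv.tendsto _).comp hx).mul hx2).mul_const _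
  have hi1 : Integrable fun x => β (σ x) * (ζ x * fieldDiv φ x + fderiv ℝ ζ x (φ x)) :=
    hci.bdd_mul (c := K₀)
      (h.contDiff.continuous.comp_aestronglyMeasurable h.measurable)
      (Eventually.of_forall fun x => h.bound _)
  have hi2 : Integrable fun x => deriv β (σ x) * (-(σ x * fieldDiv φ x)) * ζ x := by
    have hz : Integrable fun x => fieldDiv φ x * ζ x :=
      ((continuous_fieldDiv hφ).mul h.smooth.continuous).integrable_of_hasCompactSupport
        h.hasCompactSupport.mul_left
    have := hz.bdd_mul (c := K₁ * M) (f := fun x => -(deriv β (σ x) * σ x))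
      ((h.continuous_deriv.comp_aestronglyMeasurable h.measurable).mul h.measurable).neg
      (Eventually.of_forall fun x => by
        rw [norm_neg, norm_mul]
        gcongr
        · exact h.bound_deriv _
        · exact h.bound_density x)
    refine this.congr (Eventually.of_forall fun x => ?_)
    simp only; ring
  have e : limitTerm β σ ζ φ (fun i x => fderiv ℝ φ x (basisVec i))
      = - (∫ x, β (σ x) * (ζ x * fieldDiv φ x + fderiv ℝ ζ x (φ x)))
        - ∫ x, deriv β (σ x) * (-(σ x * fieldDiv φ x)) * ζ x := by
    rw [← integral_neg, ← integral_sub hi1.fun_neg hi2]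
    refine integral_congr_ae (Eventually.of_forall fun x => ?_)
    simp only [fieldDiv]; ring
  rw [e]
  simp only [fun n => h.mollifiedTerm_eq (hk n) hφ hφs]
  exact l1.neg.sub l2

end SliceData

/-! ### The mollified equation at a fixed time, for Sobolev velocity fields. -/

/-- `v`, with gradient `G`, is the limit in `W^{1,1}` of smooth fields with compact support
in `Ω`. -/
structure IsSobolevLimit {d : ℕ} (Ω : Set (Space d)) (v : Space d → Space d)
    (G : Fin d → Space d → Space d) : Prop where
  integrable : Integrable v
  integrable_grad : ∀ i, Integrable (G i)
  approx : ∃ φ : ℕ → Space d → Space d, (∀ n, ContDiff ℝ ∞ (φ n)) ∧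
    (∀ n, HasCompactSupport (φ n)) ∧ (∀ n, tsupport (φ n) ⊆ Ω) ∧
    Tendsto (fun n => fieldSize (fun x => φ n x - v x)
      (fun i x => fderiv ℝ (φ n) x (basisVec i) - G i x)) atTop (𝓝 0)

section Size

variable {d : ℕ} {v w : Space d → Space d} {G H : Fin d → Space d → Space d}

theorem fieldSize_le_add (hv : Integrable v) (hw : Integrable w) (hG : ∀ i, Integrable (G i))
    (hH : ∀ i, Integrable (H i)) :
    fieldSize v G ≤ fieldSize (fun x => v x - w x) (fun i x => G i x - H i x) + fieldSize w H := by
  have key : ∀ {a b : Space d → Space d}, Integrable a → Integrable b →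
      ∫ x, ‖a x‖ ≤ (∫ x, ‖a x - b x‖) + ∫ x, ‖b x‖ := by
    intro a b ha hb
    have hab : Integrable fun x => a x - b x := ha.sub hb
    rw [← integral_add hab.norm hb.norm]
    refine integral_mono ha.norm (hab.norm.add hb.norm) fun x => ?_
    simpa using norm_add_le (a x - b x) (b x)
  unfold fieldSize
  have h1 := key hv hw
  have h2 := Finset.sum_le_sum fun i (_ : i ∈ Finset.univ) => key (hG i) (hH i)
  rw [Finset.sum_add_distrib] at h2
  linarith

theorem fieldSize_sub_comm :
    fieldSize (fun x => v x - w x) (fun i x => G i x - H i x)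
      = fieldSize (fun x => w x - v x) (fun i x => H i x - G i x) := by
  simp only [fieldSize, norm_sub_rev]

theorem integral_norm_le_fieldSize : ∫ x, ‖v x‖ ≤ fieldSize v G :=
  le_add_of_nonneg_right (Finset.sum_nonneg fun _ _ => integral_nonneg fun _ => norm_nonneg _)

theorem integrable_of_contDiff {φ : Space d → Space d} (hφ : ContDiff ℝ ∞ φ)
    (hφs : HasCompactSupport φ) : Integrable φ ∧
      ∀ i, Integrable fun x => fderiv ℝ φ x (basisVec i) :=
  ⟨hφ.continuous.integrable_of_hasCompactSupport hφs, fun _ =>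
    ((hφ.continuous_fderiv (by simp)).clm_apply
      continuous_const).integrable_of_hasCompactSupport (hφs.fderiv_apply (𝕜 := ℝ) _)⟩

theorem IsSobolevLimit.sub {Ω : Set (Space d)} (h : IsSobolevLimit Ω v G) {ψ : Space d → Space d}
    (hψ : ContDiff ℝ ∞ ψ) (hψs : HasCompactSupport ψ) (hψt : tsupport ψ ⊆ Ω) :
    IsSobolevLimit Ω (fun x => ψ x - v x) (fun i x => fderiv ℝ ψ x (basisVec i) - G i x) := by
  obtain ⟨φ, hφ, hφs, hφt, hlim⟩ := h.approx
  obtain ⟨hi, hdi⟩ := integrable_of_contDiff hψ hψs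
  refine ⟨hi.sub h.integrable, fun i => (hdi i).sub (h.integrable_grad i),
    fun n x => ψ x - φ n x, fun n => hψ.sub (hφ n), fun n => hψs.sub (hφs n), fun n => ?_, ?_⟩
  · exact (tsupport_sub ψ (φ n)).trans (union_subset hψt (hφt n))
  · refine hlim.congr fun n => ?_
    have e : ∀ i x, fderiv ℝ (fun x => ψ x - φ n x) x (basisVec i)
        = fderiv ℝ ψ x (basisVec i) - fderiv ℝ (φ n) x (basisVec i) := by
      intro i x
      rw [fderiv_fun_sub (hψ.differentiable (by simp) x) ((hφ n).differentiable (by simp) x)]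
      rfl
    simp only [e, sub_sub_sub_cancel_left]
    exact fieldSize_sub_comm

end Size

namespace SliceData

variable {d : ℕ} {C ε M K₀ K₁ Z : ℝ} {β : ℝ → ℝ} {k σ ζ : Space d → ℝ} {Ω : Set (Space d)}
  {v w : Space d → Space d} {G H : Fin d → Space d → Space d}

theorem norm_mollifiedTerm_le_fieldSize (h : SliceData M K₀ K₁ Z β σ ζ) (hk : IsMollifier C ε k)
    (hv : IsSobolevLimit Ω v G) :
    ‖mollifiedTerm β k σ ζ v‖ ≤ Z * (K₀ + K₁ * (M * C)) * fieldSize v G := by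
  obtain ⟨hM, hK₀, hK₁, hZ⟩ := h.nonneg
  have hC := hk.const_nonneg
  obtain ⟨φ, hφ, hφs, -, hlim⟩ := hv.approx
  set A := Z * (K₀ + K₁ * (M * C)) with hA
  have hA0 : 0 ≤ A := by positivity
  set B := K₁ * (M * (C / (ε * volume.real (Metric.closedBall (0 : Space d) ε)))) * ∫ x, ‖ζ x‖
  have hB0 : 0 ≤ B := by
    have := hk.pos
    have : 0 ≤ ∫ x, ‖ζ x‖ := integral_nonneg fun _ => norm_nonneg _
    positivity
  -- The constant `B` depends badly on `ε`, but it multiplies only the approximation error, which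
  -- tends to zero while `ε` is fixed.
  have key : ∀ n, ‖mollifiedTerm β k σ ζ v‖ ≤ A * fieldSize v G
      + (A + B) * fieldSize (fun x => φ n x - v x)
          (fun i x => fderiv ℝ (φ n) x (basisVec i) - G i x) := by
    intro n
    obtain ⟨hi, hdi⟩ := integrable_of_contDiff (hφ n) (hφs n)
    have h1 := h.norm_mollifiedTerm_le hk ((hφ n).of_le (by simp)) (hφs n)
    have h2 := h.norm_mollifiedTerm_le_integral_norm hk (hi.sub hv.integrable)
    have h3 := fieldSize_le_add hi hv.integrable hdi hv.integrable_grad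
    have h4 : ∫ x, ‖φ n x - v x‖ ≤ _ := integral_norm_le_fieldSize
      (G := fun i x => fderiv ℝ (φ n) x (basisVec i) - G i x)
    have h5 := h.mollifiedTerm_sub hk hi hv.integrable
    have h6 : ‖mollifiedTerm β k σ ζ v‖ ≤ ‖mollifiedTerm β k σ ζ (φ n)‖
        + ‖mollifiedTerm β k σ ζ (fun x => φ n x - v x)‖ := by
      rw [h5]
      simpa using norm_sub_le (mollifiedTerm β k σ ζ (φ n))
        (mollifiedTerm β k σ ζ (φ n) - mollifiedTerm β k σ ζ v)
    have h7 : ‖mollifiedTerm β k σ ζ (fun x => φ n x - v x)‖ ≤ B * _ :=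
      h2.trans (mul_le_mul_of_nonneg_left h4 hB0)
    have h8 := h1.trans (mul_le_mul_of_nonneg_left h3 hA0)
    linarith
  have hl := (hlim.const_mul (A + B)).const_add (A * fieldSize v G)
  rw [mul_zero, add_zero] at hl
  exact ge_of_tendsto' hl key

theorem integrable_limitTerm (h : SliceData M K₀ K₁ Z β σ ζ) (hv : Integrable v)
    (hG : ∀ i, Integrable (G i)) :
    Integrable fun x => (deriv β (σ x) * σ x - β (σ x)) * (∑ i, G i x i) * ζ x
      - β (σ x) * fderiv ℝ ζ x (v x) := by
  obtain ⟨hM, hK₀, hK₁, hZ⟩ := h.nonneg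
  have hβm : AEStronglyMeasurable (fun x => β (σ x)) volume :=
    h.contDiff.continuous.comp_aestronglyMeasurable h.measurable
  refine Integrable.sub ?_ ?_
  · have hs : Integrable fun x => ∑ i, G i x i :=
      integrable_finsetSum _ fun i _ =>
        (EuclideanSpace.proj i : Space d →L[ℝ] ℝ).integrable_comp (hG i)
    refine (hs.bdd_mul (c := K₁ * M + K₀) (((h.continuous_deriv.comp_aestronglyMeasurable
      h.measurable).mul h.measurable).sub hβm) (Eventually.of_forall fun x => ?_)).mul_bdd
        (c := Z) h.smooth.continuous.aestronglyMeasurable (Eventually.of_forall h.bound_test)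
    refine (norm_sub_le _ _).trans ?_
    change ‖deriv β (σ x) * σ x‖ + ‖β (σ x)‖ ≤ _
    rw [norm_mul]
    gcongr
    · exact h.bound_deriv _
    · exact h.bound_density _
    · exact h.bound _
  · refine Integrable.bdd_mul (c := K₀) ?_ hβm (Eventually.of_forall fun x => h.bound _)
    refine Integrable.mono' (hv.norm.const_mul Z) ?_ (Eventually.of_forall fun x => ?_)
    · exact (ContinuousLinearMap.apply ℝ ℝ).flip.aestronglyMeasurable_comp₂
        (h.smooth.continuous_fderiv one_ne_zero).aestronglyMeasurable hv.aestronglyMeasurable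
    · exact (ContinuousLinearMap.le_opNorm _ _).trans (by gcongr; exact h.bound_test_fderiv x)

theorem limitTerm_sub (h : SliceData M K₀ K₁ Z β σ ζ) (hv : Integrable v)
    (hG : ∀ i, Integrable (G i)) (hw : Integrable w) (hH : ∀ i, Integrable (H i)) :
    limitTerm β σ ζ (fun x => v x - w x) (fun i x => G i x - H i x)
      = limitTerm β σ ζ v G - limitTerm β σ ζ w H := by
  unfold limitTerm
  rw [← integral_sub (h.integrable_limitTerm hv hG) (h.integrable_limitTerm hw hH)]
  refine integral_congr_ae (Eventually.of_forall fun x => ?_)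
  simp only [map_sub, PiLp.sub_apply, Finset.sum_sub_distrib]
  ring

theorem norm_limitTerm_le (h : SliceData M K₀ K₁ Z β σ ζ) (hv : Integrable v)
    (hG : ∀ i, Integrable (G i)) :
    ‖limitTerm β σ ζ v G‖ ≤ Z * (K₁ * M + K₀) * fieldSize v G := by
  obtain ⟨hM, hK₀, hK₁, hZ⟩ := h.nonneg
  have hGs : Integrable fun x => ∑ i, ‖G i x‖ := integrable_finsetSum _ fun i _ => (hG i).norm
  unfold fieldSize
  rw [← integral_finsetSum _ fun i _ => (hG i).norm, ← integral_add hv.norm hGs,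
    ← integral_const_mul]
  refine norm_integral_le_of_norm_le ((hv.norm.add hGs).const_mul _)
    (Eventually.of_forall fun x => ?_)
  have a1 : ‖(deriv β (σ x) * σ x - β (σ x)) * (∑ i, G i x i) * ζ x‖
      ≤ (K₁ * M + K₀) * (∑ i, ‖G i x‖) * Z := by
    rw [norm_mul, norm_mul]
    gcongr
    · refine (norm_sub_le _ _).trans ?_
      rw [norm_mul]
      gcongr
      · exact h.bound_deriv _
      · exact h.bound_density _
      · exact h.bound _
    · exact (norm_sum_le _ _).trans (Finset.sum_le_sum fun i _ => norm_apply_le _ _)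
    · exact h.bound_test x
  have a2 : ‖β (σ x) * fderiv ℝ ζ x (v x)‖ ≤ (K₁ * M + K₀) * (Z * ‖v x‖) := by
    rw [norm_mul]
    gcongr
    · exact (h.bound _).trans (le_add_of_nonneg_left (by positivity))
    · exact (ContinuousLinearMap.le_opNorm _ _).trans (by gcongr; exact h.bound_test_fderiv x)
  refine (norm_sub_le _ _).trans ((add_le_add a1 a2).trans (le_of_eq ?_))
  ring

/-- Uniformly bounded linear functionals that converge on a dense set converge everywhere. Linearity
in the velocity reduces the error for `v` to the error for a smooth `φ m` plus two terms of the size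
of `φ m - v`. -/
theorem tendsto_mollifiedTerm (h : SliceData M K₀ K₁ Z β σ ζ) {ε : ℕ → ℝ}
    {k : ℕ → Space d → ℝ} (hk : ∀ n, IsMollifier C (ε n) (k n)) (hε : Tendsto ε atTop (𝓝 0))
    (hv : IsSobolevLimit Ω v G) :
    Tendsto (fun n => mollifiedTerm β (k n) σ ζ v) atTop (𝓝 (limitTerm β σ ζ v G)) := by
  obtain ⟨hM, hK₀, hK₁, hZ⟩ := h.nonneg
  have hC := (hk 0).const_nonneg
  obtain ⟨φ, hφ, hφs, hφt, hlim⟩ := hv.approx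
  set A := Z * (K₀ + K₁ * (M * C))
  set B := Z * (K₁ * M + K₀)
  have hAB := hlim.const_mul (A + B)
  rw [mul_zero] at hAB
  rw [Metric.tendsto_atTop]
  intro δ hδ
  obtain ⟨m, hm⟩ := (hAB.eventually (gt_mem_nhds (half_pos hδ))).exists
  obtain ⟨hi, hdi⟩ := integrable_of_contDiff (hφ m) (hφs m)
  obtain ⟨N, hN⟩ := Metric.tendsto_atTop.1
    (h.tendsto_mollifiedTerm_of_contDiff hk hε ((hφ m).of_le (by simp)) (hφs m)) (δ / 2)
    (half_pos hδ)
  refine ⟨N, fun n hn => ?_⟩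
  have h1 := h.norm_mollifiedTerm_le_fieldSize (hk n) (hv.sub (hφ m) (hφs m) (hφt m))
  rw [h.mollifiedTerm_sub (hk n) hi hv.integrable] at h1
  have h2 := h.norm_limitTerm_le (hi.sub hv.integrable)
    (G := fun i x => fderiv ℝ (φ m) x (basisVec i) - G i x)
    (fun i => (hdi i).sub (hv.integrable_grad i))
  have h2' := h.limitTerm_sub hi hdi hv.integrable hv.integrable_grad
  change ‖limitTerm β σ ζ (fun x => φ m x - v x) _‖ ≤ B *
    fieldSize (fun x => φ m x - v x) _ at h2
  rw [h2'] at h2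
  have h3 := hN n hn
  rw [dist_eq_norm] at h3 ⊢
  have e : mollifiedTerm β (k n) σ ζ v - limitTerm β σ ζ v G
      = -(mollifiedTerm β (k n) σ ζ (φ m) - mollifiedTerm β (k n) σ ζ v)
        + (mollifiedTerm β (k n) σ ζ (φ m)
            - limitTerm β σ ζ (φ m) (fun i x => fderiv ℝ (φ m) x (basisVec i)))
        + (limitTerm β σ ζ (φ m) (fun i x => fderiv ℝ (φ m) x (basisVec i))
            - limitTerm β σ ζ v G) := by ring
  rw [e]
  refine (norm_add₃_le).trans_lt ?_
  rw [norm_neg]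
  linarith

end SliceData

/-! ### Integration in time and the renormalized equation for bounded functions. -/

/-- A bounded density and an integrable velocity field on `ℝ × ℝ^d`, whose time slices are limits of
smooth fields, and which satisfy the continuity equation tested with products `ξ(t) κ(x)`, where `κ`
need not vanish near the boundary of `Ω`. -/
structure TransportPair {d : ℕ} (T M : ℝ) (Ω : Set (Space d)) (ρ : ℝ × Space d → ℝ)
    (u : ℝ × Space d → Space d) (G : Fin d → ℝ × Space d → Space d) : Prop where
  pos : 0 < T
  measurable : StronglyMeasurable ρ
  bound : ∀ p, ‖ρ p‖ ≤ M
  integrable : Integrable ρ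
  measurable_velocity : StronglyMeasurable u
  integrable_velocity : Integrable u
  integrable_grad : ∀ i, Integrable (G i)
  slice : ∀ᵐ t : ℝ, IsSobolevLimit Ω (fun x => u (t, x)) (fun i x => G i (t, x))
  weak : ∀ (ξ : ℝ → ℝ) (κ : Space d → ℝ), ContDiff ℝ ∞ ξ → HasCompactSupport ξ →
    tsupport ξ ⊆ Ioo 0 T → ContDiff ℝ ∞ κ → HasCompactSupport κ →
    ∫ p : ℝ × Space d, (ρ p * (deriv ξ p.1 * κ p.2) + ρ p * ξ p.1 * fderiv ℝ κ p.2 (u p)) = 0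

theorem fderiv_slice {d : ℕ} {ψ : ℝ × Space d → ℝ} (hψ : ContDiff ℝ ∞ ψ) (t : ℝ) (x w : Space d) :
    fderiv ℝ (fun x => ψ (t, x)) x w = fderiv ℝ ψ (t, x) (0, w) := by
  have h := ((hψ.differentiable (by simp)) (t, x)).hasFDerivAt.comp x (hasFDerivAt_prodMk_right t x)
  have h' : fderiv ℝ (fun x => ψ (t, x)) x
      = (fderiv ℝ ψ (t, x)).comp (ContinuousLinearMap.inr ℝ ℝ (Space d)) := h.fderiv
  rw [h']; simp

theorem deriv_slice {d : ℕ} {ψ : ℝ × Space d → ℝ} (hψ : ContDiff ℝ ∞ ψ) (t : ℝ) (x : Space d) :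
    deriv (fun t => ψ (t, x)) t = fderiv ℝ ψ (t, x) (1, 0) := by
  have h := HasFDerivAt.comp (f := fun t : ℝ => (t, x)) t
    ((hψ.differentiable (by simp)) (t, x)).hasFDerivAt (hasFDerivAt_prodMk_left t x)
  have h' : deriv (fun t => ψ (t, x)) t
      = (fderiv ℝ ψ (t, x)).comp (ContinuousLinearMap.inl ℝ ℝ (Space d)) 1 := h.hasDerivAt.deriv
  rw [h']; simp

theorem tsupport_slice_subset {d : ℕ} {ψ : ℝ × Space d → ℝ} {T : ℝ}
    (hψt : tsupport ψ ⊆ Ioo 0 T ×ˢ univ) (x : Space d) :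
    tsupport (fun t => ψ (t, x)) ⊆ Ioo 0 T := fun _ ht =>
  (hψt (tsupport_comp_subset_preimage ψ (f := fun t => (t, x)) (by fun_prop) ht)).1

theorem hasCompactSupport_slice {d : ℕ} {ψ : ℝ × Space d → ℝ} (hψs : HasCompactSupport ψ)
    (t : ℝ) : HasCompactSupport (fun x => ψ (t, x)) :=
  HasCompactSupport.intro (hψs.isCompact.image continuous_snd) fun x hx =>
    image_eq_zero_of_notMem_tsupport fun h => hx ⟨(t, x), h, rfl⟩

namespace TransportPair

variable {d : ℕ} {T M C ε K₀ K₁ : ℝ} {Ω : Set (Space d)} {ρ : ℝ × Space d → ℝ}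
  {u : ℝ × Space d → Space d} {G : Fin d → ℝ × Space d → Space d} {k : Space d → ℝ} {β : ℝ → ℝ}
  {ψ : ℝ × Space d → ℝ}

theorem integrable_density_kernel (h : TransportPair T M Ω ρ u G) (hk : IsMollifier C ε k)
    (x : Space d) : Integrable fun p : ℝ × Space d => ρ p * k (x - p.2) := by
  refine h.integrable.mul_bdd (c := C / volume.real (Metric.closedBall (0 : Space d) ε)) ?_
    (Eventually.of_forall fun p => hk.bound _)
  exact (hk.continuous.comp (by fun_prop)).aestronglyMeasurable

theorem integrable_flux_kernel (h : TransportPair T M Ω ρ u G) (hk : IsMollifier C ε k)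
    (x : Space d) : Integrable fun p : ℝ × Space d => ρ p * fderiv ℝ k (x - p.2) (u p) := by
  refine Integrable.bdd_mul (c := M) ?_ h.measurable.aestronglyMeasurable
    (Eventually.of_forall h.bound)
  refine Integrable.mono' (h.integrable_velocity.norm.const_mul
    (C / (ε * volume.real (Metric.closedBall (0 : Space d) ε)))) ?_ (Eventually.of_forall fun p => ?_)
  · have hc : Continuous fun p : ℝ × Space d => fderiv ℝ k (x - p.2) :=
      hk.continuous_fderiv.comp (by fun_prop)
    exact (ContinuousLinearMap.apply ℝ ℝ).flip.aestronglyMeasurable_comp₂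
      hc.aestronglyMeasurable h.integrable_velocity.aestronglyMeasurable
  · exact (ContinuousLinearMap.le_opNorm _ _).trans (by gcongr; exact hk.bound_fderiv _)

/-- The continuity equation is tested with `ξ(t) k(x - y)`. Such a test function does not vanish
near `∂Ω`, which is why the equation is required on the whole space. -/
theorem integral_mollify_mul_deriv (h : TransportPair T M Ω ρ u G) (hk : IsMollifier C ε k)
    (x : Space d) {ξ : ℝ → ℝ} (hξ : ContDiff ℝ ∞ ξ) (hξs : HasCompactSupport ξ)
    (hξt : tsupport ξ ⊆ Ioo 0 T) :
    ∫ t, mollify k (fun y => ρ (t, y)) x * deriv ξ t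
      = ∫ t, mollifyDiv k (fun y => ρ (t, y)) (fun y => u (t, y)) x * ξ t := by
  have hκ : ContDiff ℝ ∞ fun y => k (x - y) := hk.smooth.comp (contDiff_const.sub contDiff_id)
  have hκs : HasCompactSupport fun y => k (x - y) :=
    hk.hasCompactSupport.comp_homeomorph (Homeomorph.subLeft x)
  have hd : ∀ y, fderiv ℝ (fun y => k (x - y)) y = - fderiv ℝ k (x - y) := by
    intro y
    have h1 := ((hk.smooth.differentiable (by simp)) (x - y)).hasFDerivAt.comp y
      ((hasFDerivAt_id y).const_sub x)
    have h2 := h1.fderiv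
    simp only [Function.comp_def] at h2
    rw [h2]
    ext z; simp
  have hw := h.weak ξ (fun y => k (x - y)) hξ hξs hξt hκ hκs
  simp only [hd, neg_apply, mul_neg] at hw
  obtain ⟨A, hA⟩ := (hξ.continuous_deriv (by simp)).bounded_above_of_compact_support hξs.deriv
  obtain ⟨B, hB⟩ := hξ.continuous.bounded_above_of_compact_support hξs
  have i1 : Integrable fun p : ℝ × Space d => ρ p * k (x - p.2) * deriv ξ p.1 :=
    (h.integrable_density_kernel hk x).mul_bdd (c := A)
      ((hξ.continuous_deriv (by simp)).comp continuous_fst).aestronglyMeasurable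
      (Eventually.of_forall fun p => hA _)
  have i2 : Integrable fun p : ℝ × Space d => ρ p * fderiv ℝ k (x - p.2) (u p) * ξ p.1 :=
    (h.integrable_flux_kernel hk x).mul_bdd (c := B)
      (hξ.continuous.comp continuous_fst).aestronglyMeasurable
      (Eventually.of_forall fun p => hB _)
  have e1 : ∫ p : ℝ × Space d, (ρ p * k (x - p.2) * deriv ξ p.1
      - ρ p * fderiv ℝ k (x - p.2) (u p) * ξ p.1) = 0 := by
    rw [← hw]
    refine integral_congr_ae (Eventually.of_forall fun p => ?_)
    simp only; ring
  rw [integral_sub i1 i2, sub_eq_zero, Measure.volume_eq_prod, integral_prod _ i1,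
    integral_prod _ i2] at e1
  simp only [integral_mul_const] at e1
  exact e1

theorem integral_comp_mollify_mul_deriv (h : TransportPair T M Ω ρ u G) (hk : IsMollifier C ε k)
    (hβ : ContDiff ℝ 1 β) (hβ' : ∀ s, ‖deriv β s‖ ≤ K₁) (x : Space d) {ξ : ℝ → ℝ}
    (hξ : ContDiff ℝ ∞ ξ) (hξt : tsupport ξ ⊆ Ioo 0 T) :
    ∫ t, β (mollify k (fun y => ρ (t, y)) x) * deriv ξ t
      = ∫ t, deriv β (mollify k (fun y => ρ (t, y)) x)
          * mollifyDiv k (fun y => ρ (t, y)) (fun y => u (t, y)) x * ξ t := by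
  have hK : LipschitzWith (Real.toNNReal K₁) β :=
    lipschitzWith_of_nnnorm_deriv_le (hβ.differentiable one_ne_zero) fun s => by
      rw [← NNReal.coe_le_coe, coe_nnnorm]
      exact (hβ' s).trans (Real.le_coe_toNNReal _)
  have i1 := h.integrable_density_kernel hk x
  have i2 := h.integrable_flux_kernel hk x
  rw [Measure.volume_eq_prod] at i1 i2
  exact integral_comp_mul_deriv_of_weak_deriv h.pos i1.integral_prod_left i2.integral_prod_left
    (fun ξ hξ hξs hξt => h.integral_mollify_mul_deriv hk x hξ hξs hξt) hβ hK hξ hξt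

theorem stronglyMeasurable_mollify (h : TransportPair T M Ω ρ u G) (hk : IsMollifier C ε k) :
    StronglyMeasurable fun p : ℝ × Space d => mollify k (fun y => ρ (p.1, y)) p.2 := by
  have h1 : StronglyMeasurable fun q : (ℝ × Space d) × Space d => ρ (q.1.1, q.2) * k (q.1.2 - q.2) :=
    (h.measurable.comp_measurable (by fun_prop)).mul
      (hk.continuous.comp (by fun_prop)).stronglyMeasurable
  exact h1.integral_prod_right (f := fun p : ℝ × Space d => fun y => ρ (p.1, y) * k (p.2 - y))

theorem stronglyMeasurable_mollifyDiv (h : TransportPair T M Ω ρ u G) (hk : IsMollifier C ε k) :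
    StronglyMeasurable fun p : ℝ × Space d =>
      mollifyDiv k (fun y => ρ (p.1, y)) (fun y => u (p.1, y)) p.2 := by
  have hc : Continuous fun q : (ℝ × Space d) × Space d => fderiv ℝ k (q.1.2 - q.2) :=
    hk.continuous_fderiv.comp (by fun_prop)
  have h1 : StronglyMeasurable fun q : (ℝ × Space d) × Space d =>
      ρ (q.1.1, q.2) * fderiv ℝ k (q.1.2 - q.2) (u (q.1.1, q.2)) := by
    refine (h.measurable.comp_measurable (by fun_prop)).mul ?_
    have h2 : StronglyMeasurable fun q : (ℝ × Space d) × Space d =>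
        (fderiv ℝ k (q.1.2 - q.2), u (q.1.1, q.2)) :=
      hc.stronglyMeasurable.prodMk (h.measurable_velocity.comp_measurable (by fun_prop))
    exact (isBoundedBilinearMap_apply (𝕜 := ℝ) (E := Space d)
      (F := ℝ)).continuous.comp_stronglyMeasurable h2
  exact h1.integral_prod_right (f := fun p : ℝ × Space d => fun y =>
    ρ (p.1, y) * fderiv ℝ k (p.2 - y) (u (p.1, y)))

theorem exists_sliceData (h : TransportPair T M Ω ρ u G) (hβ : ContDiff ℝ 1 β)
    (hβ₀ : ∀ s, ‖β s‖ ≤ K₀) (hβ₁ : ∀ s, ‖deriv β s‖ ≤ K₁) (hψ : ContDiff ℝ ∞ ψ)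
    (hψs : HasCompactSupport ψ) :
    ∃ Z, ∀ t, SliceData M K₀ K₁ Z β (fun x => ρ (t, x)) (fun x => ψ (t, x)) := by
  obtain ⟨A, hA⟩ := hψ.continuous.bounded_above_of_compact_support hψs
  obtain ⟨B, hB⟩ := (hψ.continuous_fderiv (by simp)).bounded_above_of_compact_support
    (hψs.fderiv (𝕜 := ℝ))
  refine ⟨max A B, fun t => ⟨hβ, hβ₀, hβ₁,
    (h.measurable.comp_measurable (by fun_prop)).aestronglyMeasurable, fun x => h.bound _,
    (hψ.of_le (by simp)).comp (by fun_prop), hasCompactSupport_slice hψs t,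
    fun x => (hA _).trans (le_max_left _ _), fun x => ?_⟩⟩
  have hB0 : 0 ≤ B := (norm_nonneg _).trans (hB 0)
  refine ContinuousLinearMap.opNorm_le_bound _ (hB0.trans (le_max_right _ _)) fun w => ?_
  rw [fderiv_slice hψ]
  refine (ContinuousLinearMap.le_opNorm _ _).trans ?_
  have : ‖((0 : ℝ), w)‖ = ‖w‖ := by simp [Prod.norm_def]
  rw [this]
  gcongr
  exact (hB _).trans (le_max_right _ _)

theorem integrable_comp_mollify_mul_deriv (h : TransportPair T M Ω ρ u G) (hk : IsMollifier C ε k)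
    (hβ : ContDiff ℝ 1 β) (hβ₀ : ∀ s, ‖β s‖ ≤ K₀) (hψ : ContDiff ℝ ∞ ψ)
    (hψs : HasCompactSupport ψ) :
    Integrable fun p : ℝ × Space d =>
      β (mollify k (fun y => ρ (p.1, y)) p.2) * fderiv ℝ ψ p (1, 0) := by
  have hi : Integrable fun p : ℝ × Space d => fderiv ℝ ψ p (1, 0) :=
    ((hψ.continuous_fderiv (by simp)).clm_apply
      continuous_const).integrable_of_hasCompactSupport (hψs.fderiv_apply (𝕜 := ℝ) _)
  exact hi.bdd_mul (c := K₀) (hβ.continuous.comp_stronglyMeasurable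
    (h.stronglyMeasurable_mollify hk)).aestronglyMeasurable (Eventually.of_forall fun p => hβ₀ _)

/-- At fixed `ε`, the mollified divergence is bounded by a multiple of `‖u(t)‖₁`, so the majorant is
a product of an integrable function of `t` and the indicator of the spatial projection of the
support of `ψ`. -/
theorem integrable_mollifiedTerm_integrand (h : TransportPair T M Ω ρ u G)
    (hk : IsMollifier C ε k) (hβ : ContDiff ℝ 1 β) (hβ₁ : ∀ s, ‖deriv β s‖ ≤ K₁)
    (hψ : ContDiff ℝ ∞ ψ) (hψs : HasCompactSupport ψ) :
    Integrable fun p : ℝ × Space d => deriv β (mollify k (fun y => ρ (p.1, y)) p.2)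
      * mollifyDiv k (fun y => ρ (p.1, y)) (fun y => u (p.1, y)) p.2 * ψ p := by
  have hK₁ : 0 ≤ K₁ := (norm_nonneg _).trans (hβ₁ 0)
  have hM : 0 ≤ M := (norm_nonneg _).trans (h.bound 0)
  have hC := hk.const_nonneg
  have hε := hk.pos
  obtain ⟨A, hA⟩ := hψ.continuous.bounded_above_of_compact_support hψs
  let S : Set (Space d) := Prod.snd '' tsupport ψ
  have hS : IsCompact S := hψs.isCompact.image continuous_snd
  set B := M * (C / (ε * volume.real (Metric.closedBall (0 : Space d) ε))) with hB
  have hu := h.integrable_velocity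
  rw [Measure.volume_eq_prod] at hu
  have hU : Integrable fun t => ∫ y, ‖u (t, y)‖ := hu.integral_norm_prod_left
  have hI : Integrable (S.indicator fun _ => A) :=
    (integrable_indicator_iff hS.measurableSet).2 (integrableOn_const hS.measure_lt_top.ne)
  have hdom : Integrable fun p : ℝ × Space d =>
      (K₁ * B) * ((∫ y, ‖u (p.1, y)‖) * S.indicator (fun _ => A) p.2) := by
    rw [Measure.volume_eq_prod]
    exact (hU.mul_prod hI).const_mul _
  refine Integrable.mono' hdom ?_ ?_
  · exact (((hβ.continuous_deriv le_rfl).comp_stronglyMeasurable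
      (h.stronglyMeasurable_mollify hk)).mul (h.stronglyMeasurable_mollifyDiv hk)).mul
      hψ.continuous.stronglyMeasurable |>.aestronglyMeasurable
  · have hae : ∀ᵐ p : ℝ × Space d, Integrable fun y => u (p.1, y) := by
      rw [Measure.volume_eq_prod]
      exact Measure.quasiMeasurePreserving_fst.ae hu.prod_right_ae
    filter_upwards [hae] with p hp
    have a1 : ‖ψ p‖ ≤ S.indicator (fun _ => A) p.2 := by
      by_cases hpS : p.2 ∈ S
      · simpa [hpS] using hA p
      · rw [indicator_of_notMem hpS, image_eq_zero_of_notMem_tsupport fun hp' => hpS ⟨p, hp', rfl⟩,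
          norm_zero]
    have a2 := norm_mollifyDiv_le hk (σ := fun y => ρ (p.1, y)) (fun x => h.bound _) hp p.2
    rw [norm_mul, norm_mul]
    have hB0 : 0 ≤ B := by positivity
    have hU0 : 0 ≤ ∫ y, ‖u (p.1, y)‖ := integral_nonneg fun _ => norm_nonneg _
    calc _ ≤ K₁ * (B * ∫ y, ‖u (p.1, y)‖) * S.indicator (fun _ => A) p.2 := by
          gcongr
          exact hβ₁ _
      _ = _ := by ring

/-- The chain rule in time holds for each fixed `x`, whereas the limit `ε → 0` is taken at fixed
`t`; Fubini mediates between the two. -/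
theorem integral_mollified_eq (h : TransportPair T M Ω ρ u G) (hk : IsMollifier C ε k)
    (hβ : ContDiff ℝ 1 β) (hβ₀ : ∀ s, ‖β s‖ ≤ K₀) (hβ₁ : ∀ s, ‖deriv β s‖ ≤ K₁)
    (hψ : ContDiff ℝ ∞ ψ) (hψs : HasCompactSupport ψ) (hψt : tsupport ψ ⊆ Ioo 0 T ×ˢ univ) :
    ∫ t, ∫ x, β (mollify k (fun y => ρ (t, y)) x) * fderiv ℝ ψ (t, x) (1, 0)
      = ∫ t, mollifiedTerm β k (fun x => ρ (t, x)) (fun x => ψ (t, x)) (fun x => u (t, x)) := by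
  have i1 := h.integrable_comp_mollify_mul_deriv hk hβ hβ₀ hψ hψs
  have i2 := h.integrable_mollifiedTerm_integrand hk hβ hβ₁ hψ hψs
  rw [Measure.volume_eq_prod] at i1 i2
  refine (integral_integral_swap i1).trans (Eq.trans ?_ (integral_integral_swap i2).symm)
  refine integral_congr_ae (Eventually.of_forall fun x => ?_)
  have h1 := h.integral_comp_mollify_mul_deriv hk hβ hβ₁ x (ξ := fun t => ψ (t, x))
    (hψ.comp (by fun_prop)) (tsupport_slice_subset hψt x)
  simp only [deriv_slice hψ] at h1
  exact h1

theorem integrable_fieldSize (h : TransportPair T M Ω ρ u G) :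
    Integrable fun t => fieldSize (fun x => u (t, x)) (fun i x => G i (t, x)) := by
  have hu := h.integrable_velocity
  have hG := h.integrable_grad
  simp only [Measure.volume_eq_prod] at hu hG
  exact hu.integral_norm_prod_left.add
    (integrable_finsetSum _ fun i _ => (hG i).integral_norm_prod_left)

/-- The renormalized continuity equation for bounded `C¹` functions with bounded derivative. -/
theorem renormalized (h : TransportPair T M Ω ρ u G) (hβ : ContDiff ℝ 1 β)
    (hβ₀ : ∀ s, ‖β s‖ ≤ K₀) (hβ₁ : ∀ s, ‖deriv β s‖ ≤ K₁)
    (hψ : ContDiff ℝ ∞ ψ) (hψs : HasCompactSupport ψ) (hψt : tsupport ψ ⊆ Ioo 0 T ×ˢ univ) :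
    ∫ p, (β (ρ p) * fderiv ℝ ψ p (1, 0) + fderiv ℝ ψ p (0, β (ρ p) • u p)
      - (deriv β (ρ p) * ρ p - β (ρ p)) * (∑ i, G i p i) * ψ p) = 0 := by
  obtain ⟨C, -, hmol⟩ := exists_isMollifier d
  let ε : ℕ → ℝ := fun n => 1 / ((n : ℝ) + 1)
  have hε0 : ∀ n, 0 < ε n := fun n => by positivity
  have hε : Tendsto ε atTop (𝓝 0) := tendsto_one_div_add_atTop_nhds_zero_nat
  choose k hk using fun n => hmol (ε n) (hε0 n)
  obtain ⟨Z, hZ⟩ := h.exists_sliceData hβ hβ₀ hβ₁ hψ hψs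
  have hψd : Integrable fun p : ℝ × Space d => fderiv ℝ ψ p (1, 0) :=
    ((hψ.continuous_fderiv (by simp)).clm_apply
      continuous_const).integrable_of_hasCompactSupport (hψs.fderiv_apply (𝕜 := ℝ) _)
  have hβρ : StronglyMeasurable fun p => β (ρ p) := hβ.continuous.comp_stronglyMeasurable h.measurable
  have hi1 : Integrable fun p : ℝ × Space d => β (ρ p) * fderiv ℝ ψ p (1, 0) :=
    hψd.bdd_mul (c := K₀) hβρ.aestronglyMeasurable (Eventually.of_forall fun p => hβ₀ _)
  have l1 : Tendsto (fun n => ∫ t, ∫ x,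
      β (mollify (k n) (fun y => ρ (t, y)) x) * fderiv ℝ ψ (t, x) (1, 0)) atTop
      (𝓝 (∫ t, ∫ x, β (ρ (t, x)) * fderiv ℝ ψ (t, x) (1, 0))) := by
    have hψd' := hψd
    rw [Measure.volume_eq_prod] at hψd'
    have hsl : ∀ t, Integrable fun x => fderiv ℝ ψ (t, x) (1, 0) := fun t => by
      refine Continuous.integrable_of_hasCompactSupport (((hψ.continuous_fderiv
        (by simp)).comp (by fun_prop)).clm_apply continuous_const) ?_
      refine HasCompactSupport.intro (hψs.isCompact.image continuous_snd) fun x hx => ?_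
      have : fderiv ℝ ψ (t, x) = 0 := by
        by_contra hne
        exact hx ⟨(t, x), support_fderiv_subset ℝ hne, rfl⟩
      simp [this]
    refine tendsto_integral_of_dominated_convergence
      (fun t => ∫ x, K₀ * ‖fderiv ℝ ψ (t, x) (1, 0)‖) (fun n => ?_) ?_ (fun n => ?_) ?_
    · have := h.integrable_comp_mollify_mul_deriv (hk n) hβ hβ₀ hψ hψs
      rw [Measure.volume_eq_prod] at this
      exact this.integral_prod_left.aestronglyMeasurable
    · exact (hψd'.norm.const_mul K₀).integral_prod_left
    · refine Eventually.of_forall fun t => norm_integral_le_of_norm_le ((hsl t).norm.const_mul _)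
        (Eventually.of_forall fun x => ?_)
      rw [norm_mul]
      gcongr
      exact hβ₀ _
    · refine Eventually.of_forall fun t => ?_
      refine tendsto_integral_of_dominated_convergence
        (fun x => K₀ * ‖fderiv ℝ ψ (t, x) (1, 0)‖) (fun n => ?_) ((hsl t).norm.const_mul _)
        (fun n => Eventually.of_forall fun x => ?_) ?_
      · exact (hβ.continuous.comp (contDiff_mollify (hk n)
          (hZ t).locallyIntegrable).continuous).aestronglyMeasurable.mul (hsl t).aestronglyMeasurable
      · rw [norm_mul]
        gcongr
        exact hβ₀ _
      · filter_upwards [ae_tendsto_mollify hk hε (hZ t).locallyIntegrable] with x hx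
        exact ((hβ.continuous.tendsto _).comp hx).mul_const _
  -- The bound uniform in `ε` provides a multiple of the `W^{1,1}` size of the slices, integrable in
  -- `t`, as majorant.
  have l2 : Tendsto (fun n => ∫ t,
      mollifiedTerm β (k n) (fun x => ρ (t, x)) (fun x => ψ (t, x)) (fun x => u (t, x))) atTop
      (𝓝 (∫ t, limitTerm β (fun x => ρ (t, x)) (fun x => ψ (t, x)) (fun x => u (t, x))
        (fun i x => G i (t, x)))) := by
    refine tendsto_integral_of_dominated_convergence
      (fun t => Z * (K₀ + K₁ * (M * C)) * fieldSize (fun x => u (t, x)) (fun i x => G i (t, x)))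
      (fun n => ?_) (h.integrable_fieldSize.const_mul _) (fun n => ?_) ?_
    · have := h.integrable_mollifiedTerm_integrand (hk n) hβ hβ₁ hψ hψs
      rw [Measure.volume_eq_prod] at this
      exact this.integral_prod_left.aestronglyMeasurable
    · filter_upwards [h.slice] with t ht
      exact (hZ t).norm_mollifiedTerm_le_fieldSize (hk n) ht
    · filter_upwards [h.slice] with t ht
      exact (hZ t).tendsto_mollifiedTerm hk hε ht
  have key := tendsto_nhds_unique l1 (l2.congr fun n =>
    (h.integral_mollified_eq (hk n) hβ hβ₀ hβ₁ hψ hψs hψt).symm)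
  have hK₁ : 0 ≤ K₁ := (norm_nonneg _).trans (hβ₁ 0)
  have hi2 : Integrable fun p : ℝ × Space d =>
      (deriv β (ρ p) * ρ p - β (ρ p)) * (∑ i, G i p i) * ψ p
        - β (ρ p) * fderiv ℝ ψ p (0, u p) := by
    obtain ⟨A, hA⟩ := hψ.continuous.bounded_above_of_compact_support hψs
    obtain ⟨B, hB⟩ := (hψ.continuous_fderiv (by simp)).bounded_above_of_compact_support
      (hψs.fderiv (𝕜 := ℝ))
    refine Integrable.sub ?_ ?_
    · have hs : Integrable fun p => ∑ i, G i p i := integrable_finsetSum _ fun i _ =>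
        (EuclideanSpace.proj i : Space d →L[ℝ] ℝ).integrable_comp (h.integrable_grad i)
      refine (hs.bdd_mul (c := K₁ * M + K₀) ((((hβ.continuous_deriv
        le_rfl).comp_stronglyMeasurable h.measurable).mul h.measurable).sub
          hβρ).aestronglyMeasurable (Eventually.of_forall fun p => ?_)).mul_bdd (c := A)
        hψ.continuous.aestronglyMeasurable (Eventually.of_forall hA)
      refine (norm_sub_le _ _).trans ?_
      change ‖deriv β (ρ p) * ρ p‖ + ‖β (ρ p)‖ ≤ _
      rw [norm_mul]
      gcongr
      · exact hβ₁ _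
      · exact h.bound p
      · exact hβ₀ _
    · refine Integrable.bdd_mul (c := K₀) ?_ hβρ.aestronglyMeasurable
        (Eventually.of_forall fun p => hβ₀ _)
      refine Integrable.mono' (h.integrable_velocity.norm.const_mul B) ?_
        (Eventually.of_forall fun p => ?_)
      · exact (ContinuousLinearMap.apply ℝ ℝ).flip.aestronglyMeasurable_comp₂
          (hψ.continuous_fderiv (by simp)).aestronglyMeasurable
          (aestronglyMeasurable_const.prodMk h.integrable_velocity.aestronglyMeasurable)
      · refine (ContinuousLinearMap.le_opNorm _ _).trans ?_
        have : ‖((0 : ℝ), u p)‖ = ‖u p‖ := by simp [Prod.norm_def]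
        rw [this]
        gcongr
        exact hB p
  have e1 : ∫ p, (β (ρ p) * fderiv ℝ ψ p (1, 0) + fderiv ℝ ψ p (0, β (ρ p) • u p)
      - (deriv β (ρ p) * ρ p - β (ρ p)) * (∑ i, G i p i) * ψ p)
      = (∫ p, β (ρ p) * fderiv ℝ ψ p (1, 0)) - ∫ p,
        ((deriv β (ρ p) * ρ p - β (ρ p)) * (∑ i, G i p i) * ψ p
        - β (ρ p) * fderiv ℝ ψ p (0, u p)) := by
    rw [← integral_sub hi1 hi2]
    refine integral_congr_ae (Eventually.of_forall fun p => ?_)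
    have : ((0 : ℝ), β (ρ p) • u p) = β (ρ p) • ((0 : ℝ), u p) := by simp
    simp only [this, map_smul, smul_eq_mul]
    ring
  rw [e1, sub_eq_zero, Measure.volume_eq_prod, integral_prod _ (by simpa using! hi1),
    integral_prod _ (by simpa using! hi2), key]
  simp only [limitTerm, fderiv_slice hψ]

end TransportPair

/-! ### Smooth cutoff functions. -/

section Cutoff

variable {d : ℕ}

/-- Mollification at scale `ε` of the indicator of the points at distance at least `2ε` from `S`.
The intermediate radius leaves room for the kernel on both sides. -/
theorem exists_cutoff (d : ℕ) :
    ∃ C : ℝ, 0 < C ∧ ∀ (S : Set (Space d)) (ε : ℝ), 0 < ε → ∃ χ : Space d → ℝ,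
      ContDiff ℝ ∞ χ ∧ (∀ x ∈ Metric.thickening ε S, χ x = 0) ∧
      (∀ x, x ∉ Metric.thickening (3 * ε) S → χ x = 1) ∧ (∀ x, ‖χ x‖ ≤ C) ∧
      (∀ x, ‖fderiv ℝ χ x‖ ≤ C / ε) ∧
      (∀ x, x ∉ Metric.thickening (3 * ε) S → fderiv ℝ χ x = 0) := by
  obtain ⟨C, hC, hmol⟩ := exists_isMollifier d
  refine ⟨C, hC, fun S ε hε => ?_⟩
  obtain ⟨k, hk⟩ := hmol ε hε
  let A : Set (Space d) := (Metric.thickening (2 * ε) S)ᶜ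
  have hA : MeasurableSet A := Metric.isOpen_thickening.measurableSet.compl
  let σ : Space d → ℝ := A.indicator fun _ => 1
  have hσm : AEStronglyMeasurable σ volume :=
    (stronglyMeasurable_const.indicator hA).aestronglyMeasurable
  have hσ1 : ∀ x, ‖σ x‖ ≤ 1 := fun x => by
    by_cases h : x ∈ A <;> simp [σ, h]
  have hl := locallyIntegrable_of_bounded hσm hσ1
  have hout : ∀ x y : Space d, x ∉ Metric.thickening (3 * ε) S → ‖x - y‖ ≤ ε → σ y = 1 := by
    intro x y hx hxy
    suffices hy : y ∈ A from indicator_of_mem hy _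
    intro hy
    refine hx ?_
    rw [Metric.mem_thickening_iff] at hy ⊢
    obtain ⟨z, hz, hyz⟩ := hy
    refine ⟨z, hz, (dist_triangle x y z).trans_lt ?_⟩
    rw [dist_eq_norm x y]; linarith
  refine ⟨mollify k σ, ?_, ?_, ?_, fun x => by simpa using norm_mollify_le hk hσ1 x, ?_, ?_⟩
  · rw [mollify_eq_convolution]
    exact hk.hasCompactSupport.contDiff_convolution_right _ hl hk.smooth
  · intro x hx
    rw [mollify]
    refine (integral_congr_ae (Eventually.of_forall fun y => ?_)).trans (integral_zero _ _)
    rcases lt_or_ge ε ‖x - y‖ with h | h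
    · simp [hk.eq_zero _ h]
    · have : σ y = 0 := by
        suffices hy : y ∈ Metric.thickening (2 * ε) S from
          indicator_of_notMem (s := A) (fun h => h hy) _
        rw [Metric.mem_thickening_iff] at hx ⊢
        obtain ⟨z, hz, hxz⟩ := hx
        refine ⟨z, hz, (dist_triangle y x z).trans_lt ?_⟩
        rw [dist_comm, dist_eq_norm x y]; linarith
      simp [this]
  · intro x hx
    rw [mollify]
    have : ∫ y, σ y * k (x - y) = ∫ y, k (x - y) := by
      refine integral_congr_ae (Eventually.of_forall fun y => ?_)
      rcases lt_or_ge ε ‖x - y‖ with h | h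
      · simp [hk.eq_zero _ h]
      · simp [hout x y hx h]
    rw [this, integral_sub_left_eq_self k, hk.integral_eq_one]
  · intro x
    refine ContinuousLinearMap.opNorm_le_bound _ (by positivity) fun w => ?_
    rw [fderiv_mollify_apply hk hl]
    have hi : Integrable fun y => fderiv ℝ k (x - y) := hk.integrable_fderiv.comp_sub_left x
    calc _ ≤ ∫ y, ‖fderiv ℝ k (x - y)‖ * ‖w‖ := by
          refine norm_integral_le_of_norm_le (hi.norm.mul_const _)
            (Eventually.of_forall fun y => ?_)
          rw [norm_mul]
          calc _ ≤ 1 * (‖fderiv ℝ k (x - y)‖ * ‖w‖) := by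
                gcongr
                · exact hσ1 y
                · exact ContinuousLinearMap.le_opNorm _ _
            _ = _ := one_mul _
      _ ≤ C / ε * ‖w‖ := by
          rw [integral_mul_const, integral_sub_left_eq_self (fun y => ‖fderiv ℝ k y‖)]
          gcongr
          exact hk.integral_norm_fderiv_le
  · intro x hx
    ext w
    rw [fderiv_mollify_apply hk hl]
    -- The complement of the open thickening is closed, so local constancy does not cover its
    -- boundary points; `∫ ∇k = 0` does.
    have : ∫ y, σ y * fderiv ℝ k (x - y) w = ∫ y, fderiv ℝ k (x - y) w := by
      refine integral_congr_ae (Eventually.of_forall fun y => ?_)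
      rcases lt_or_ge ε ‖x - y‖ with h | h
      · simp [hk.fderiv_eq_zero h]
      · simp [hout x y hx h]
    rw [this, integral_fderiv_kernel_eq_zero hk]
    simp

end Cutoff

/-! ### Velocity fields with zero trace in boundary layers. -/

theorem exists_mem_segment_frontier {d : ℕ} {U : Set (Space d)} (hU : IsOpen U) {x z : Space d}
    (hx : x ∈ U) (hz : z ∉ U) : ∃ y ∈ segment ℝ x z, y ∈ frontier U := by
  by_contra! hcon
  have hpre : IsPreconnected (segment ℝ x z) := (convex_segment x z).isPreconnected
  have hsub : segment ℝ x z ⊆ U ∪ (closure U)ᶜ := by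
    intro y hy
    by_contra hne
    rw [mem_union, not_or, mem_compl_iff, not_not] at hne
    exact hcon y hy ⟨hne.2, fun h => hne.1 (interior_subset h)⟩
  obtain ⟨y, -, hy1, hy2⟩ := hpre U (closure U)ᶜ hU isClosed_closure.isOpen_compl hsub
    ⟨x, left_mem_segment ℝ x z, hx⟩
    ⟨z, right_mem_segment ℝ x z, (hsub (right_mem_segment ℝ x z)).resolve_left hz⟩
  exact hy2 (subset_closure hy1)

/-- Finitely many directions suffice to leave a bounded Lipschitz domain from the points near its
boundary, along segments whose length is comparable to the distance to the complement. -/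
theorem IsBoundedLipschitzDomain.exists_exit_directions {d : ℕ} {Ω : Opens (Space d)}
    (hΩ : IsBoundedLipschitzDomain Ω) :
    ∃ (N : Finset (Space d)) (C δ₀ : ℝ), 0 < C ∧ 0 < δ₀ ∧ (∀ ν ∈ N, ‖ν‖ = 1) ∧
      ∀ δ, 0 < δ → δ < δ₀ → ∀ x ∈ Ω, x ∈ Metric.thickening δ (Ω : Set (Space d))ᶜ →
        ∃ ν ∈ N, x - (C * δ) • ν ∉ Ω := by
  classical
  have hcomp : IsCompact (frontier (Ω : Set (Space d))) :=
    Metric.isCompact_of_isClosed_isBounded isClosed_frontier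
      (hΩ.bounded.closure.subset frontier_subset_closure)
  choose! ν γ K r h1 hγ hr hchart using hΩ.lipschitz
  obtain ⟨I, hI, hcov⟩ := hcomp.elim_nhds_subcover (fun x₀ => Metric.ball x₀ (r x₀))
    (fun x₀ hx₀ => Metric.ball_mem_nhds _ (hr x₀ hx₀))
  -- A Lebesgue number gives one radius `l` such that every ball of radius `l` about a boundary
  -- point lies in a single chart.
  obtain ⟨l, hl, hleb⟩ := lebesgue_number_lemma_of_metric hcomp
    (c := fun i : I => Metric.ball (i : Space d) (r i)) (fun _ => Metric.isOpen_ball)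
    (by simpa [iUnion_subtype] using hcov)
  obtain ⟨L, hL⟩ : ∃ L : ℝ, ∀ i ∈ I, (K i : ℝ) ≤ L :=
    ⟨∑ i ∈ I, (K i : ℝ), fun i hi =>
      Finset.single_le_sum (f := fun i => (K i : ℝ)) (fun _ _ => NNReal.coe_nonneg _) hi⟩
  set L' := max L 0 with hL'
  have hL'0 : 0 ≤ L' := le_max_right _ _
  -- Passing from a boundary point `y` to `x` changes the height by at most `δ` and the graph by at
  -- most `L' δ`, so a descent by `(1 + L') δ` goes below the graph. The end point is then at
  -- distance less than `(2 + L') δ` from `y`, which must not exceed `l`.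
  refine ⟨I.image ν, 1 + L', l / (2 + L'), by positivity, by positivity, ?_, ?_⟩
  · intro w hw
    obtain ⟨i, hi, rfl⟩ := Finset.mem_image.1 hw
    exact h1 i (hI i hi)
  · intro δ hδ hδ₀ x hx hxt
    rw [Metric.mem_thickening_iff] at hxt
    obtain ⟨z, hz, hxz⟩ := hxt
    obtain ⟨y, hys, hyf⟩ := exists_mem_segment_frontier Ω.isOpen hx hz
    have hxy : dist x y < δ := by
      have h := dist_add_dist_of_mem_segment hys
      linarith [dist_nonneg (x := y) (y := z)]
    have hyΩ : y ∉ Ω := fun h => by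
      rw [Ω.isOpen.frontier_eq] at hyf
      exact hyf.2 h
    obtain ⟨⟨i, hi⟩, hball⟩ := hleb y hyf
    simp only at hball
    refine ⟨ν i, Finset.mem_image_of_mem _ hi, ?_⟩
    have hν := h1 i (hI i hi)
    set s := (1 + L') * δ with hs
    have hs0 : 0 < s := by positivity
    have hsl : δ + s < l := by
      rw [lt_div_iff₀ (by positivity)] at hδ₀
      rw [hs]; linarith
    have hmem : x - s • ν i ∈ Metric.ball (i : Space d) (r i) := by
      refine hball ?_
      rw [Metric.mem_ball]
      calc dist (x - s • ν i) y ≤ dist (x - s • ν i) x + dist x y := dist_triangle _ _ _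
        _ < s + δ := by
            have : dist (x - s • ν i) x = s := by
              rw [dist_eq_norm]
              simp [norm_smul, hν, abs_of_pos hs0]
            linarith
        _ < l := by linarith
    rw [hchart i (hI i hi) _ hmem, not_lt]
    have hymem : y ∈ Metric.ball (i : Space d) (r i) := hball (Metric.mem_ball_self hl)
    have hyγ : inner ℝ (ν i) y ≤ γ i (y - inner ℝ (ν i) y • ν i) := by
      by_contra hlt
      exact hyΩ ((hchart i (hI i hi) y hymem).2 (not_le.1 hlt))
    have hin : inner ℝ (ν i) (x - s • ν i) = inner ℝ (ν i) x - s := by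
      rw [inner_sub_right, inner_smul_right, real_inner_self_eq_norm_sq, hν]; ring
    have horth : (x - s • ν i) - inner ℝ (ν i) (x - s • ν i) • ν i
        = x - inner ℝ (ν i) x • ν i := by
      rw [hin, sub_smul]; abel
    rw [horth, hin]
    have hproj : ‖(y - inner ℝ (ν i) y • ν i) - (x - inner ℝ (ν i) x • ν i)‖ ≤ ‖y - x‖ := by
      have e : (y - inner ℝ (ν i) y • ν i) - (x - inner ℝ (ν i) x • ν i)
          = (y - x) - inner ℝ (ν i) (y - x) • ν i := by
        rw [inner_sub_right, sub_smul]; abel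
      rw [e]
      have h2 : ‖(y - x) - inner ℝ (ν i) (y - x) • ν i‖ ^ 2 ≤ ‖y - x‖ ^ 2 := by
        rw [norm_sub_sq_real, inner_smul_right, norm_smul, hν, real_inner_comm]
        have : ‖inner ℝ (y - x) (ν i)‖ ^ 2 = inner ℝ (y - x) (ν i) ^ 2 := by
          rw [Real.norm_eq_abs, sq_abs]
        rw [mul_one, this]
        nlinarith [sq_nonneg (inner ℝ (y - x) (ν i) : ℝ)]
      exact le_of_sq_le_sq h2 (norm_nonneg _)
    have hLip := (hγ i (hI i hi)).norm_sub_le (y - inner ℝ (ν i) y • ν i)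
      (x - inner ℝ (ν i) x • ν i)
    have hKL : (K i : ℝ) ≤ L' := (hL i hi).trans (le_max_left _ _)
    have hyx : ‖y - x‖ ≤ δ := by rw [← dist_eq_norm, dist_comm]; exact hxy.le
    have h3 : ‖γ i (y - inner ℝ (ν i) y • ν i) - γ i (x - inner ℝ (ν i) x • ν i)‖ ≤ L' * δ := by
      refine hLip.trans ?_
      gcongr
      exact hproj.trans hyx
    have h4 : ‖inner ℝ (ν i) (x - y)‖ ≤ δ := by
      refine (norm_inner_le_norm _ _).trans ?_
      rw [hν, one_mul, norm_sub_rev]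
      exact hyx
    rw [inner_sub_right] at h4
    have h5 := (abs_le.1 h3).2
    have h6 := (abs_le.1 h4).2
    rw [hs]
    linarith

/-- The points of `U` at distance less than `δ` from the complement of `U`. -/
def collar {d : ℕ} (U : Set (Space d)) (δ : ℝ) : Set (Space d) :=
  U ∩ Metric.thickening δ Uᶜ

theorem measurableSet_collar {d : ℕ} {U : Set (Space d)} (hU : IsOpen U) (δ : ℝ) :
    MeasurableSet (collar U δ) :=
  (hU.inter Metric.isOpen_thickening).measurableSet

theorem collar_mono {d : ℕ} (U : Set (Space d)) {δ δ' : ℝ} (h : δ ≤ δ') :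
    collar U δ ⊆ collar U δ' :=
  inter_subset_inter_right _ (Metric.thickening_mono h _)

/-- The boundary layers shrink to the empty set, a point of an open set being at positive distance
from the complement. -/
theorem eventually_notMem_thickening {d : ℕ} {U : Set (Space d)} (hU : IsOpen U) {x : Space d}
    (hx : x ∈ U) {δ : ℕ → ℝ} (hδ : Tendsto δ atTop (𝓝 0)) :
    ∀ᶠ n in atTop, x ∉ Metric.thickening (δ n) Uᶜ := by
  obtain ⟨r, hr, hb⟩ := Metric.isOpen_iff.1 hU x hx
  filter_upwards [hδ.eventually (gt_mem_nhds hr)] with n hn hmem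
  rw [Metric.mem_thickening_iff] at hmem
  obtain ⟨z, hz, hxz⟩ := hmem
  exact hz (hb (by rw [Metric.mem_ball, dist_comm]; linarith))

/-- From each point of the layer, one of the segments of length `Cδ` ends outside `U`, where `φ`
vanishes, so `|φ x|` is at most the integral of `|∇φ|` along it. Summing over all directions removes
the dependence of the direction on `x`; Tonelli and translation invariance do the rest. -/
theorem lintegral_collar_le_of_contDiff {d : ℕ} {U : Set (Space d)} (hU : IsOpen U)
    {N : Finset (Space d)} {C δ : ℝ} (hC : 0 < C) (hδ : 0 < δ) (hN : ∀ ν ∈ N, ‖ν‖ = 1)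
    (hexit : ∀ x ∈ U, x ∈ Metric.thickening δ Uᶜ → ∃ ν ∈ N, x - (C * δ) • ν ∉ U)
    {φ : Space d → Space d} (hφ : ContDiff ℝ 1 φ) (hφt : tsupport φ ⊆ U) :
    ∫⁻ x in collar U δ, ‖φ x‖ₑ
      ≤ ENNReal.ofReal (N.card * (C * δ)) * ∫⁻ x in collar U ((1 + C) * δ), ‖fderiv ℝ φ x‖ₑ := by
  have hE' := measurableSet_collar hU ((1 + C) * δ)
  set E' := collar U ((1 + C) * δ) with hE'def
  let h : Space d → ℝ≥0∞ := E'.indicator fun x => ‖fderiv ℝ φ x‖ₑ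
  have hcd : Continuous (fderiv ℝ φ) := hφ.continuous_fderiv one_ne_zero
  have hh : Measurable h := (Continuous.measurable (by fun_prop)).indicator hE'
  let R := ENNReal.ofReal (C * δ)
  have hCδ : 0 < C * δ := by positivity
  have hpt : ∀ x ∈ collar U δ,
      ‖φ x‖ₑ ≤ ∑ ν ∈ N, ∫⁻ s in Ioc (0 : ℝ) 1, h (x - s • ((C * δ) • ν)) * R := by
    intro x hx
    obtain ⟨ν, hν, hout⟩ := hexit x hx.1 hx.2
    refine le_trans ?_ (Finset.single_le_sum
      (f := fun ν => ∫⁻ s in Ioc (0 : ℝ) 1, h (x - s • ((C * δ) • ν)) * R)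
      (fun _ _ => zero_le) hν)
    have h0 : φ (x - (C * δ) • ν) = 0 := image_eq_zero_of_notMem_tsupport fun h' => hout (hφt h')
    have h1 := enorm_sub_le_lintegral_fderiv hφ x ((C * δ) • ν)
    rw [h0, sub_zero] at h1
    refine h1.trans (setLIntegral_mono' measurableSet_Ioc fun s hs => ?_)
    have hw : ‖(C * δ) • ν‖ = C * δ := by
      rw [norm_smul, hN ν hν, mul_one, Real.norm_of_nonneg hCδ.le]
    have hwe : ‖(C * δ) • ν‖ₑ = R := by rw [← ofReal_norm, hw]
    rw [hwe]
    -- The segment may leave `U` before its end, but `∇φ` vanishes outside `U`. Inside `U`, its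
    -- points are at distance less than `(1 + C) δ` from the complement.
    by_cases hU' : x - s • ((C * δ) • ν) ∈ U
    · have hmem : x - s • ((C * δ) • ν) ∈ E' := by
        refine ⟨hU', ?_⟩
        have hx2 := hx.2
        rw [Metric.mem_thickening_iff] at hx2 ⊢
        obtain ⟨z, hz, hxz⟩ := hx2
        refine ⟨z, hz, (dist_triangle _ x z).trans_lt ?_⟩
        have : dist (x - s • ((C * δ) • ν)) x ≤ C * δ := by
          rw [dist_eq_norm, sub_sub_cancel_left, norm_neg, norm_smul, hw,
            Real.norm_of_nonneg hs.1.le]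
          exact mul_le_of_le_one_left hCδ.le hs.2
        linarith
      simp only [h, indicator_of_mem hmem, le_refl]
    · have hz : fderiv ℝ φ (x - s • ((C * δ) • ν)) = 0 := by
        by_contra hne
        exact hU' (hφt (support_fderiv_subset ℝ hne))
      rw [← ofReal_norm, hz, norm_zero, ENNReal.ofReal_zero, zero_mul]
      exact zero_le
  calc ∫⁻ x in collar U δ, ‖φ x‖ₑ
      ≤ ∫⁻ x in collar U δ, ∑ ν ∈ N, ∫⁻ s in Ioc (0 : ℝ) 1, h (x - s • ((C * δ) • ν)) * R :=
        setLIntegral_mono' (measurableSet_collar hU δ) hpt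
    _ ≤ ∫⁻ x, ∑ ν ∈ N, ∫⁻ s in Ioc (0 : ℝ) 1, h (x - s • ((C * δ) • ν)) * R :=
        setLIntegral_le_lintegral _ _
    _ = ∑ ν ∈ N, ∫⁻ x, ∫⁻ s in Ioc (0 : ℝ) 1, h (x - s • ((C * δ) • ν)) * R := by
        refine lintegral_finsetSum _ fun ν _ => Measurable.lintegral_prod_right' ?_
          (f := fun p : Space d × ℝ => h (p.1 - p.2 • ((C * δ) • ν)) * R)
        exact (hh.comp (Continuous.measurable (by fun_prop))).mul_const _
    _ = ∑ _ν ∈ N, R * ∫⁻ x in E', ‖fderiv ℝ φ x‖ₑ := by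
        refine Finset.sum_congr rfl fun ν _ => ?_
        rw [lintegral_lintegral_swap]
        · have : ∀ s : ℝ, ∫⁻ x, h (x - s • ((C * δ) • ν)) * R
              = R * ∫⁻ x in E', ‖fderiv ℝ φ x‖ₑ := by
            intro s
            rw [lintegral_mul_const' _ _ ENNReal.ofReal_ne_top, lintegral_sub_right_eq_self h,
              lintegral_indicator hE', mul_comm]
          simp [this]
        · exact ((hh.comp (Continuous.measurable (by fun_prop))).mul_const _).aemeasurable
    _ = _ := by
        rw [Finset.sum_const, nsmul_eq_mul, ← mul_assoc, ENNReal.ofReal_mul (by positivity)]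
        simp [R]

theorem integral_collar_le_of_contDiff {d : ℕ} {U : Set (Space d)} (hU : IsOpen U)
    {N : Finset (Space d)} {C δ : ℝ} (hC : 0 < C) (hδ : 0 < δ) (hN : ∀ ν ∈ N, ‖ν‖ = 1)
    (hexit : ∀ x ∈ U, x ∈ Metric.thickening δ Uᶜ → ∃ ν ∈ N, x - (C * δ) • ν ∉ U)
    {φ : Space d → Space d} (hφ : ContDiff ℝ ∞ φ) (hφs : HasCompactSupport φ)
    (hφt : tsupport φ ⊆ U) :
    ∫ x in collar U δ, ‖φ x‖
      ≤ N.card * (C * δ) * ∑ i, ∫ x in collar U ((1 + C) * δ), ‖fderiv ℝ φ x (basisVec i)‖ := by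
  obtain ⟨hi, hdi⟩ := integrable_of_contDiff hφ hφs
  have hDi : Integrable (fderiv ℝ φ) := (hφ.continuous_fderiv
    (by simp)).integrable_of_hasCompactSupport (hφs.fderiv (𝕜 := ℝ))
  have h1 := lintegral_collar_le_of_contDiff hU hC hδ hN hexit (hφ.of_le (by simp)) hφt
  have h2 : ∫ x in collar U δ, ‖φ x‖
      ≤ N.card * (C * δ) * ∫ x in collar U ((1 + C) * δ), ‖fderiv ℝ φ x‖ := by
    rw [integral_norm_eq_lintegral_enorm hi.aestronglyMeasurable.restrict,
      integral_norm_eq_lintegral_enorm hDi.aestronglyMeasurable.restrict]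
    have h3 := ENNReal.toReal_mono (ENNReal.mul_ne_top ENNReal.ofReal_ne_top
      hDi.integrableOn.2.ne) h1
    rwa [ENNReal.toReal_mul, ENNReal.toReal_ofReal (by positivity)] at h3
  refine h2.trans ?_
  gcongr
  rw [← integral_finsetSum _ fun i _ => (hdi i).integrableOn.norm]
  exact integral_mono hDi.integrableOn.norm
    (integrable_finsetSum _ fun i _ => (hdi i).integrableOn.norm) fun x => norm_clm_le_sum _

theorem IsSobolevLimit.integral_collar_le {d : ℕ} {U : Set (Space d)} (hU : IsOpen U)
    {N : Finset (Space d)} {C δ : ℝ} (hC : 0 < C) (hδ : 0 < δ) (hN : ∀ ν ∈ N, ‖ν‖ = 1)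
    (hexit : ∀ x ∈ U, x ∈ Metric.thickening δ Uᶜ → ∃ ν ∈ N, x - (C * δ) • ν ∉ U)
    {v : Space d → Space d} {G : Fin d → Space d → Space d} (hv : IsSobolevLimit U v G) :
    ∫ x in collar U δ, ‖v x‖
      ≤ N.card * (C * δ) * ∑ i, ∫ x in collar U ((1 + C) * δ), ‖G i x‖ := by
  obtain ⟨φ, hφ, hφs, hφt, hlim⟩ := hv.approx
  set A : ℝ := N.card * (C * δ) with hA
  have hA0 : 0 ≤ A := by positivity
  have tri : ∀ {a b : Space d → Space d} (S : Set (Space d)), Integrable a → Integrable b →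
      ∫ x in S, ‖a x‖ ≤ (∫ x, ‖a x - b x‖) + ∫ x in S, ‖b x‖ := by
    intro a b S ha hb
    have hab : Integrable fun x => a x - b x := ha.sub hb
    calc ∫ x in S, ‖a x‖ ≤ (∫ x in S, ‖a x - b x‖) + ∫ x in S, ‖b x‖ := by
          rw [← integral_add hab.integrableOn.norm hb.integrableOn.norm]
          refine integral_mono ha.integrableOn.norm
            (hab.integrableOn.norm.add hb.integrableOn.norm) fun x => ?_
          simpa using norm_add_le (a x - b x) (b x)
      _ ≤ _ := by
          exact add_le_add (setIntegral_le_integral hab.norm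
            (Eventually.of_forall fun _ => norm_nonneg _)) le_rfl
  have key : ∀ n, ∫ x in collar U δ, ‖v x‖
      ≤ A * (∑ i, ∫ x in collar U ((1 + C) * δ), ‖G i x‖) + (1 + A)
        * fieldSize (fun x => φ n x - v x)
          (fun i x => fderiv ℝ (φ n) x (basisVec i) - G i x) := by
    intro n
    obtain ⟨hi, hdi⟩ := integrable_of_contDiff (hφ n) (hφs n)
    have h1 := integral_collar_le_of_contDiff hU hC hδ hN hexit (hφ n) (hφs n) (hφt n)
    have h2 := tri (collar U δ) hv.integrable hi
    simp only [norm_sub_rev (v _)] at h2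
    have h3 := Finset.sum_le_sum fun i (_ : i ∈ Finset.univ) =>
      tri (collar U ((1 + C) * δ)) (hdi i) (hv.integrable_grad i)
    rw [Finset.sum_add_distrib] at h3
    have h4 := h1.trans (mul_le_mul_of_nonneg_left h3 hA0)
    have h5 : 0 ≤ A * ∫ x, ‖φ n x - v x‖ :=
      mul_nonneg hA0 (integral_nonneg fun _ => norm_nonneg _)
    have h6 : 0 ≤ ∑ i, ∫ x, ‖fderiv ℝ (φ n) x (basisVec i) - G i x‖ :=
      Finset.sum_nonneg fun _ _ => integral_nonneg fun _ => norm_nonneg _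
    unfold fieldSize
    linarith
  have hl := (hlim.const_mul (1 + A)).const_add
    (A * (∑ i, ∫ x in collar U ((1 + C) * δ), ‖G i x‖))
  rw [mul_zero, add_zero] at hl
  exact ge_of_tendsto' hl key

/-- The mass of a velocity field with zero trace in a boundary layer is small compared to the width
of the layer. -/
theorem tendsto_integral_collar_div {d : ℕ} {Ω : Opens (Space d)}
    (hΩ : IsBoundedLipschitzDomain Ω) {u : ℝ × Space d → Space d}
    {G : Fin d → ℝ × Space d → Space d} (hu : Integrable u) (hG : ∀ i, Integrable (G i))
    (hs : ∀ᵐ t : ℝ, IsSobolevLimit (Ω : Set (Space d)) (fun x => u (t, x))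
      (fun i x => G i (t, x))) {δ : ℕ → ℝ} (hδ : ∀ n, 0 < δ n) (hδa : Antitone δ)
    (hδ0 : Tendsto δ atTop (𝓝 0)) :
    Tendsto (fun n => (δ n)⁻¹ * ∫ p in univ ×ˢ collar (Ω : Set (Space d)) (δ n), ‖u p‖) atTop
      (𝓝 0) := by
  obtain ⟨N, C, δ₀, hC, hδ₀, hN, hexit⟩ := hΩ.exists_exit_directions
  set A : ℝ := N.card * C
  have hU := Ω.isOpen
  have hmeas : ∀ r, MeasurableSet ((univ : Set ℝ) ×ˢ collar (Ω : Set (Space d)) r) := fun r =>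
    MeasurableSet.univ.prod (measurableSet_collar hU r)
  have hlim : Tendsto (fun n => A * ∑ i, ∫ p in univ ×ˢ
      collar (Ω : Set (Space d)) ((1 + C) * δ n), ‖G i p‖) atTop (𝓝 0) := by
    have h1 : ∀ i, Tendsto (fun n => ∫ p in univ ×ˢ
        collar (Ω : Set (Space d)) ((1 + C) * δ n), ‖G i p‖) atTop (𝓝 0) := by
      intro i
      have h2 := tendsto_setIntegral_of_antitone (μ := volume) (f := fun p => ‖G i p‖)
        (s := fun n => (univ : Set ℝ) ×ˢ collar (Ω : Set (Space d)) ((1 + C) * δ n))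
        (fun n => hmeas _) (fun m n hmn => prod_mono_right (collar_mono _ (by
          have := hδa hmn
          gcongr))) ⟨0, (hG i).norm.integrableOn⟩
      have h3 : ⋂ n, (univ : Set ℝ) ×ˢ collar (Ω : Set (Space d)) ((1 + C) * δ n) = ∅ := by
        refine eq_empty_of_forall_notMem fun p hp => ?_
        rw [mem_iInter] at hp
        have h4 : Tendsto (fun n => (1 + C) * δ n) atTop (𝓝 0) := by
          simpa using hδ0.const_mul (1 + C)
        obtain ⟨n, hn⟩ := (eventually_notMem_thickening hU (hp 0).2.1 h4).exists
        exact hn (hp n).2.2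
      rw [h3] at h2
      simpa using h2
    have h5 := (tendsto_finsetSum Finset.univ fun i _ => h1 i).const_mul A
    simpa using h5
  refine squeeze_zero' (Eventually.of_forall fun n => ?_) ?_ hlim
  · have := hδ n
    exact mul_nonneg (by positivity) (integral_nonneg fun _ => norm_nonneg _)
  -- The slicewise layer estimate, integrated in time; it is available once the width is below `δ₀`.
  · filter_upwards [hδ0.eventually (gt_mem_nhds hδ₀)] with n hn
    have hδn := hδ n
    rw [inv_mul_le_iff₀ hδn]
    rw [Measure.volume_eq_prod] at hu
    simp only [Measure.volume_eq_prod] at hG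
    have e1 : ∫ p in univ ×ˢ collar (Ω : Set (Space d)) (δ n), ‖u p‖
        = ∫ t, ∫ x in collar (Ω : Set (Space d)) (δ n), ‖u (t, x)‖ := by
      rw [Measure.volume_eq_prod, setIntegral_prod _ hu.norm.integrableOn, setIntegral_univ]
    have e2 : ∀ i, ∫ p in univ ×ˢ collar (Ω : Set (Space d)) ((1 + C) * δ n), ‖G i p‖
        = ∫ t, ∫ x in collar (Ω : Set (Space d)) ((1 + C) * δ n), ‖G i (t, x)‖ := fun i => by
      rw [Measure.volume_eq_prod, setIntegral_prod _ (hG i).norm.integrableOn, setIntegral_univ]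
    have hint : ∀ {a : ℝ × Space d → Space d} (r : ℝ), Integrable a (volume.prod volume) →
        Integrable fun t => ∫ x in collar (Ω : Set (Space d)) r, ‖a (t, x)‖ := by
      intro a r ha
      have h := ha.norm.integrableOn (s := univ ×ˢ collar (Ω : Set (Space d)) r)
      rw [IntegrableOn, ← Measure.prod_restrict, Measure.restrict_univ] at h
      exact h.integral_prod_left
    rw [e1]
    simp only [e2]
    rw [← integral_finsetSum _ fun i _ => hint _ (hG i), ← integral_const_mul,
      ← integral_const_mul]
    refine integral_mono_ae (hint _ hu)
      (((integrable_finsetSum _ fun i _ => hint _ (hG i)).const_mul _).const_mul _) ?_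
    filter_upwards [hs] with t ht
    refine (ht.integral_collar_le hU hC hδn hN (fun x hx hxt =>
      hexit (δ n) hδn hn x hx hxt)).trans (le_of_eq ?_)
    simp only [A]; ring

/-- A velocity field with zero trace does not see the boundary: the continuity equation in `Ω` may
be tested with functions that do not vanish near `∂Ω`. -/
theorem weak_extension {d : ℕ} {Ω : Opens (Space d)} (hΩ : IsBoundedLipschitzDomain Ω) {T M : ℝ}
    {ρ : ℝ × Space d → ℝ} {u : ℝ × Space d → Space d} {G : Fin d → ℝ × Space d → Space d}
    (hρb : ∀ p, ‖ρ p‖ ≤ M) (hρi : Integrable ρ) (hρ0 : ∀ p : ℝ × Space d, p.2 ∉ Ω → ρ p = 0)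
    (hu : Integrable u) (hG : ∀ i, Integrable (G i))
    (hs : ∀ᵐ t : ℝ, IsSobolevLimit (Ω : Set (Space d)) (fun x => u (t, x))
      (fun i x => G i (t, x)))
    (hweak : ∀ ψ : ℝ × Space d → ℝ, ContDiff ℝ ∞ ψ → HasCompactSupport ψ →
      tsupport ψ ⊆ Ioo 0 T ×ˢ (Ω : Set (Space d)) →
      ∫ p, (ρ p * fderiv ℝ ψ p (1, 0) + ρ p * fderiv ℝ ψ p (0, u p)) = 0)
    {ξ : ℝ → ℝ} {κ : Space d → ℝ} (hξ : ContDiff ℝ ∞ ξ) (hξs : HasCompactSupport ξ)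
    (hξt : tsupport ξ ⊆ Ioo 0 T) (hκ : ContDiff ℝ ∞ κ) (hκs : HasCompactSupport κ) :
    ∫ p : ℝ × Space d, (ρ p * (deriv ξ p.1 * κ p.2) + ρ p * ξ p.1 * fderiv ℝ κ p.2 (u p)) = 0 := by
  have hM : 0 ≤ M := (norm_nonneg _).trans (hρb 0)
  obtain ⟨C, hC, hcut⟩ := exists_cutoff d
  let ε : ℕ → ℝ := fun n => 1 / ((n : ℝ) + 1)
  have hε0 : ∀ n, 0 < ε n := fun n => by positivity
  have hε : Tendsto ε atTop (𝓝 0) := tendsto_one_div_add_atTop_nhds_zero_nat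
  have hεa : Antitone fun n => 3 * ε n := fun m n hmn => by
    have : (m : ℝ) ≤ n := by exact_mod_cast hmn
    simp only [ε]
    gcongr
  have h3ε : Tendsto (fun n => 3 * ε n) atTop (𝓝 0) := by simpa using hε.const_mul 3
  choose χ hχ hχ0 hχ1 hχb hχd hχd0 using fun n => hcut (Ω : Set (Space d))ᶜ (ε n) (hε0 n)
  obtain ⟨A₀, hA₀⟩ := hξ.continuous.bounded_above_of_compact_support hξs
  obtain ⟨A₁, hA₁⟩ := (hξ.continuous_deriv (by simp)).bounded_above_of_compact_support hξs.deriv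
  obtain ⟨B₀, hB₀⟩ := hκ.continuous.bounded_above_of_compact_support hκs
  obtain ⟨B₁, hB₁⟩ := (hκ.continuous_fderiv (by simp)).bounded_above_of_compact_support
    (hκs.fderiv (𝕜 := ℝ))
  have hA₀0 : 0 ≤ A₀ := (norm_nonneg _).trans (hA₀ 0)
  have hB₀0 : 0 ≤ B₀ := (norm_nonneg _).trans (hB₀ 0)
  have hB₁0 : 0 ≤ B₁ := (norm_nonneg _).trans (hB₁ 0)
  set Q : ℝ × Space d → ℝ := fun p =>
    ρ p * (deriv ξ p.1 * κ p.2) + ρ p * ξ p.1 * fderiv ℝ κ p.2 (u p) with hQ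
  have hfl : ∀ L : Space d → (Space d →L[ℝ] ℝ), Continuous L →
      AEStronglyMeasurable (fun p : ℝ × Space d => L p.2 (u p)) volume := fun L hL =>
    (ContinuousLinearMap.apply ℝ ℝ).flip.aestronglyMeasurable_comp₂
      (hL.comp continuous_snd).aestronglyMeasurable hu.aestronglyMeasurable
  have hlin : ∀ (L : Space d → (Space d →L[ℝ] ℝ)) (D : ℝ), Continuous L → (∀ x, ‖L x‖ ≤ D) →
      Integrable fun p : ℝ × Space d => ρ p * ξ p.1 * L p.2 (u p) := by
    intro L D hL hD
    refine Integrable.bdd_mul (c := M * A₀) ?_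
      (hρi.aestronglyMeasurable.mul (hξ.continuous.comp continuous_fst).aestronglyMeasurable)
      (Eventually.of_forall fun p => ?_)
    · refine Integrable.mono' (hu.norm.const_mul D) (hfl L hL) (Eventually.of_forall fun p => ?_)
      exact (ContinuousLinearMap.le_opNorm _ _).trans (by gcongr; exact hD _)
    · change ‖ρ p * ξ p.1‖ ≤ _
      rw [norm_mul]
      gcongr
      · exact hρb p
      · exact hA₀ _
  have hQi : Integrable Q := by
    refine Integrable.add ?_ (hlin (fderiv ℝ κ) B₁ (hκ.continuous_fderiv (by simp)) hB₁)
    refine hρi.mul_bdd (c := A₁ * B₀) ?_ (Eventually.of_forall fun p => ?_)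
    · exact (((hξ.continuous_deriv (by simp)).comp continuous_fst).mul
        (hκ.continuous.comp continuous_snd)).aestronglyMeasurable
    · rw [norm_mul]
      have := (norm_nonneg _).trans (hA₁ 0)
      gcongr
      · exact hA₁ _
      · exact hB₀ _
  have hcd : ∀ n, Continuous fun x => κ x • fderiv ℝ (χ n) x := fun n =>
    hκ.continuous.smul ((hχ n).continuous_fderiv (by simp))
  have hcb : ∀ n x, ‖κ x • fderiv ℝ (χ n) x‖ ≤ B₀ * (C / ε n) := fun n x => by
    rw [norm_smul]
    gcongr
    · exact hB₀ x
    · exact hχd n x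
  -- The equation in `Ω` tested with `ξ κ χ_n`; the right-hand side is the error from `∇χ_n`.
  have hId : ∀ n, ∫ p, Q p * χ n p.2
      = - ∫ p : ℝ × Space d, ρ p * ξ p.1 * (κ p.2 • fderiv ℝ (χ n) p.2) (u p) := by
    intro n
    let ψ : ℝ × Space d → ℝ := fun p => ξ p.1 * (κ p.2 * χ n p.2)
    have hψ : ContDiff ℝ ∞ ψ :=
      (hξ.comp contDiff_fst).mul ((hκ.comp contDiff_snd).mul ((hχ n).comp contDiff_snd))
    have hψsub : tsupport ψ ⊆ tsupport ξ ×ˢ (tsupport κ ∩ (Metric.thickening (ε n) (Ω : Set (Space d))ᶜ)ᶜ) := by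
      refine closure_minimal (fun p hp => ⟨?_, ?_, ?_⟩)
        ((isClosed_tsupport _).prod ((isClosed_tsupport _).inter
          Metric.isOpen_thickening.isClosed_compl))
      · exact subset_tsupport _ fun h => hp (by simp [ψ, h])
      · exact subset_tsupport _ fun h => hp (by simp [ψ, h])
      · exact fun h => hp (by simp [ψ, hχ0 n _ h])
    have hψs : HasCompactSupport ψ :=
      (hξs.isCompact.prod (hκs.isCompact.inter_right
        Metric.isOpen_thickening.isClosed_compl)).of_isClosed_subset (isClosed_tsupport _) hψsub
    have hψt : tsupport ψ ⊆ Ioo 0 T ×ˢ (Ω : Set (Space d)) := fun p hp => by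
      refine ⟨hξt (hψsub hp).1, ?_⟩
      by_contra hne
      exact (hψsub hp).2.2 (Metric.self_subset_thickening (hε0 n) _ hne)
    have hfd1 : ∀ p : ℝ × Space d, fderiv ℝ ψ p (1, 0) = deriv ξ p.1 * (κ p.2 * χ n p.2) := by
      rintro ⟨t, x⟩
      rw [← deriv_slice hψ]
      simp only [ψ]
      rw [deriv_mul_const (hξ.differentiable (by simp) t)]
    have hfd2 : ∀ (p : ℝ × Space d) w, fderiv ℝ ψ p (0, w)
        = ξ p.1 * (χ n p.2 * fderiv ℝ κ p.2 w + (κ p.2 • fderiv ℝ (χ n) p.2) w) := by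
      rintro ⟨t, x⟩ w
      rw [← fderiv_slice hψ]
      have h1 := ((hκ.differentiable (by simp) x).hasFDerivAt.mul
        ((hχ n).differentiable (by simp) x).hasFDerivAt).const_mul (ξ t)
      have h2 : fderiv ℝ (fun x => ψ (t, x)) x = _ := h1.fderiv
      rw [h2]
      simp only [smul_apply, add_apply, smul_eq_mul]
      ring
    have h0 := hweak ψ hψ hψs hψt
    simp only [hfd1, hfd2] at h0
    have hi1 : Integrable fun p => Q p * χ n p.2 :=
      hQi.mul_bdd (c := C) ((hχ n).continuous.comp continuous_snd).aestronglyMeasurable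
        (Eventually.of_forall fun p => hχb n _)
    have hi2 := hlin _ _ (hcd n) (hcb n)
    rw [eq_neg_iff_add_eq_zero, ← integral_add hi1 hi2, ← h0]
    refine integral_congr_ae (Eventually.of_forall fun p => ?_)
    simp only [hQ]; ring
  have l1 : Tendsto (fun n => ∫ p, Q p * χ n p.2) atTop (𝓝 (∫ p, Q p)) := by
    refine tendsto_integral_of_dominated_convergence (fun p => ‖Q p‖ * C) (fun n => ?_)
      (hQi.norm.mul_const _) (fun n => Eventually.of_forall fun p => ?_)
      (Eventually.of_forall fun p => ?_)
    · exact hQi.aestronglyMeasurable.mul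
        ((hχ n).continuous.comp continuous_snd).aestronglyMeasurable
    · rw [norm_mul]
      gcongr
      exact hχb n _
    · by_cases hp : p.2 ∈ Ω
      · refine tendsto_const_nhds.congr' ?_
        filter_upwards [eventually_notMem_thickening Ω.isOpen hp h3ε] with n hn
        rw [hχ1 n _ hn, mul_one]
      · simp [hQ, hρ0 p hp]
  have l2 : Tendsto (fun n =>
      - ∫ p : ℝ × Space d, ρ p * ξ p.1 * (κ p.2 • fderiv ℝ (χ n) p.2) (u p)) atTop (𝓝 0) := by
    -- `|∇χ_n| ≤ C / ε_n` acts only in the layer of width `3 ε_n`; the factor `3` converts `ε_n⁻¹`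
    -- into a multiple of the inverse width.
    have h1 := (tendsto_integral_collar_div hΩ hu hG hs (fun n => by have := hε0 n; positivity)
      hεa h3ε).const_mul (3 * (M * A₀ * (B₀ * C)))
    rw [mul_zero] at h1
    refine squeeze_zero_norm (fun n => ?_) h1
    have hεn := hε0 n
    have hm : MeasurableSet ((univ : Set ℝ) ×ˢ collar (Ω : Set (Space d)) (3 * ε n)) :=
      MeasurableSet.univ.prod (measurableSet_collar Ω.isOpen _)
    rw [norm_neg]
    calc _ ≤ ∫ p in univ ×ˢ collar (Ω : Set (Space d)) (3 * ε n),
          M * A₀ * (B₀ * (C / ε n)) * ‖u p‖ := by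
          rw [← integral_indicator hm]
          refine norm_integral_le_of_norm_le
            (((hu.norm.const_mul _).integrableOn).integrable_indicator hm)
            (Eventually.of_forall fun p => ?_)
          by_cases hp : p ∈ (univ : Set ℝ) ×ˢ collar (Ω : Set (Space d)) (3 * ε n)
          · rw [indicator_of_mem hp, norm_mul, norm_mul, mul_assoc (M * A₀)]
            gcongr
            · exact hρb p
            · exact hA₀ _
            · exact (ContinuousLinearMap.le_opNorm _ _).trans (by gcongr; exact hcb n _)
          · rw [indicator_of_notMem hp]
            by_cases hpΩ : p.2 ∈ Ω
            · have : p.2 ∉ Metric.thickening (3 * ε n) (Ω : Set (Space d))ᶜ := fun h =>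
                hp ⟨mem_univ _, hpΩ, h⟩
              simp [hχd0 n _ this]
            · simp [hρ0 p hpΩ]
      _ = _ := by
          rw [integral_const_mul]
          field_simp
  exact tendsto_nhds_unique l1 (l2.congr fun n => (hId n).symm)

/-! ### Slices in `W^{1,2}_0` as limits in `W^{1,1}`. -/

theorem tendsto_integral_norm_of_tendsto_eLpNorm {X F : Type*} [MeasurableSpace X]
    [NormedAddCommGroup F] {μ : Measure X} [IsFiniteMeasure μ] {f : ℕ → X → F}
    (hf : ∀ n, AEStronglyMeasurable (f n) μ)
    (h : Tendsto (fun n => eLpNorm (f n) 2 μ) atTop (𝓝 0)) :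
    Tendsto (fun n => ∫ x, ‖f n x‖ ∂μ) atTop (𝓝 0) := by
  have h1 : Tendsto (fun n => eLpNorm (f n) 1 μ) atTop (𝓝 0) := by
    set c := μ univ ^ (1 / (1 : ℝ≥0∞).toReal - 1 / (2 : ℝ≥0∞).toReal) with hc
    have hct : c ≠ ⊤ := ENNReal.rpow_ne_top_of_nonneg (by norm_num) (measure_ne_top _ _)
    have h2 := ENNReal.Tendsto.mul_const h (Or.inr hct)
    rw [zero_mul] at h2
    exact tendsto_of_tendsto_of_tendsto_of_le_of_le tendsto_const_nhds h2 (fun _ => zero_le)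
      fun n => eLpNorm_le_eLpNorm_mul_rpow_measure_univ (by norm_num) (hf n)
  have h3 := (ENNReal.tendsto_toReal (by simp)).comp h1
  simp only [ENNReal.toReal_zero] at h3
  refine h3.congr fun n => ?_
  rw [integral_norm_eq_lintegral_enorm (hf n)]
  simp [eLpNorm_one_eq_lintegral_enorm]

/-- On a set of finite measure, convergence in `L²` implies convergence in `L¹`. All functions
vanish outside `Ω`, so integrals over `Ω` are integrals over the whole space. -/
theorem MemW12Zero.isSobolevLimit {d : ℕ} {Ω : Opens (Space d)}
    (hΩ : volume (Ω : Set (Space d)) ≠ ⊤) {v : Space d → Space d}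
    {G : Fin d → Space d → Space d} (h : MemW12Zero Ω v G) {v' : Space d → Space d}
    {G' : Fin d → Space d → Space d}
    (hv : v' =ᵐ[volume.restrict (Ω : Set (Space d))] v) (hv0 : ∀ x ∉ Ω, v' x = 0)
    (hG : ∀ i, G' i =ᵐ[volume.restrict (Ω : Set (Space d))] G i) (hG0 : ∀ i, ∀ x ∉ Ω, G' i x = 0) :
    IsSobolevLimit (Ω : Set (Space d)) v' G' := by
  have : IsFiniteMeasure (volume.restrict (Ω : Set (Space d))) := ⟨by simpa using hΩ.lt_top⟩
  have hΩm : MeasurableSet (Ω : Set (Space d)) := Ω.isOpen.measurableSet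
  have hint : ∀ {a a' : Space d → Space d}, MemLp a 2 (volume.restrict (Ω : Set (Space d))) →
      a' =ᵐ[volume.restrict (Ω : Set (Space d))] a → (∀ x ∉ Ω, a' x = 0) → Integrable a' := by
    intro a a' ha haa h0
    have h1 : IntegrableOn a' (Ω : Set (Space d)) := (ha.integrable (by norm_num)).congr haa.symm
    exact (integrableOn_iff_integrable_of_support_subset fun x hx => by
      by_contra hne
      exact hx (h0 x hne)).1 h1
  obtain ⟨φ, hφ1, hφ2⟩ := h.approx
  refine ⟨hint h.memLp hv hv0, fun i => hint (h.memLp_grad i) (hG i) (hG0 i), fun n => φ n,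
    fun n => (φ n).contDiff, fun n => (φ n).hasCompactSupport, fun n => (φ n).tsupport_subset, ?_⟩
  have key : ∀ {a : ℕ → Space d → Space d} {b b' : Space d → Space d},
      (∀ n, Continuous (a n)) → (∀ n, ∀ x ∉ Ω, a n x = 0) →
      MemLp b 2 (volume.restrict (Ω : Set (Space d))) →
      b' =ᵐ[volume.restrict (Ω : Set (Space d))] b → (∀ x ∉ Ω, b' x = 0) →
      Tendsto (fun n => eLpNorm (fun x => a n x - b x) 2 (volume.restrict (Ω : Set (Space d))))
        atTop (𝓝 0) →
      Tendsto (fun n => ∫ x, ‖a n x - b' x‖) atTop (𝓝 0) := by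
    intro a b b' ha ha0 hb hbb hb0 hlim
    have h1 := tendsto_integral_norm_of_tendsto_eLpNorm
      (fun n => (ha n).aestronglyMeasurable.sub hb.aestronglyMeasurable) hlim
    refine h1.congr fun n => ?_
    have h2 : ∫ x, ‖a n x - b' x‖ = ∫ x in (Ω : Set (Space d)), ‖a n x - b' x‖ :=
      (setIntegral_eq_integral_of_forall_compl_eq_zero fun x hx => by
        simp [ha0 n x hx, hb0 x hx]).symm
    rw [h2]
    refine integral_congr_ae ?_
    filter_upwards [hbb] with x hx
    simp [hx]
  have hz : ∀ n, ∀ x ∉ Ω, x ∉ tsupport (φ n) := fun n x hx hx' => hx ((φ n).tsupport_subset hx')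
  have l1 := key (a := fun n => φ n) (fun n => (φ n).continuous)
    (fun n x hx => image_eq_zero_of_notMem_tsupport (hz n x hx)) h.memLp hv hv0 hφ1
  have l2 : ∀ i, Tendsto (fun n => ∫ x, ‖fderiv ℝ (φ n) x (basisVec i) - G' i x‖) atTop (𝓝 0) :=
    fun i => key (a := fun n x => fderiv ℝ (φ n) x (basisVec i))
      (fun n => ((φ n).contDiff.continuous_fderiv (by simp)).clm_apply continuous_const)
      (fun n x hx => by
        have : fderiv ℝ (φ n) x = 0 := by
          by_contra hne
          exact hz n x hx (support_fderiv_subset ℝ hne)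
        simp [this]) (h.memLp_grad i) (hG i) (hG0 i) (hφ2 i)
  simpa [fieldSize] using l1.add (tendsto_finsetSum Finset.univ fun i _ => l2 i)

/-! ### Bounded `C¹` cutoffs of the renormalizing function. -/

theorem hasDerivAt_derivOn {R : ℝ} {b : ℝ → ℝ} (hb : ContDiffOn ℝ 1 b (Ico 0 R)) {s : ℝ}
    (hs : s ∈ Ioo 0 R) : HasDerivAt b (derivOn R b s) s := by
  have hn : Ico 0 R ∈ 𝓝 s := Ico_mem_nhds hs.1 hs.2
  exact ((hb.differentiableOn one_ne_zero) s (Ioo_subset_Ico_self hs)).hasDerivWithinAt.hasDerivAt hn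

theorem derivOn_nonneg_of_monotoneOn {r R : ℝ} {b : ℝ → ℝ} (hb : ContDiffOn ℝ 1 b (Ico 0 R))
    (hr : 0 < r) (hmono : MonotoneOn b (Ico r R)) {s : ℝ} (hs : s ∈ Ioo r R) :
    0 ≤ derivOn R b s := by
  have h1 := hasDerivAt_derivOn hb (s := s) ⟨hr.trans hs.1, hs.2⟩
  have h2 : derivWithin b (Ico r R) s = derivOn R b s :=
    h1.hasDerivWithinAt.derivWithin ((uniqueDiffOn_Ico r R) s (Ioo_subset_Ico_self hs))
  rw [← h2]
  exact hmono.derivWithin_nonneg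

/-- Cutting off the derivative of `b` near `R` gives a bounded `C¹` function on the line with bounded
derivative. -/
theorem exists_contDiff_cutoff {r a c R : ℝ} {b : ℝ → ℝ} (hb : ContDiffOn ℝ 1 b (Ico 0 R))
    (hr : 0 < r) (hmono : MonotoneOn b (Ico r R)) (hra : r ≤ a) (hac : a < c) (hcR : c < R) :
    ∃ (β : ℝ → ℝ) (K₀ K₁ : ℝ), ContDiff ℝ 1 β ∧ (∀ s, ‖β s‖ ≤ K₀) ∧ (∀ s, ‖deriv β s‖ ≤ K₁) ∧
      (∀ s ∈ Icc 0 a, β s = b s ∧ deriv β s = derivOn R b s) ∧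
      (∀ s ∈ Icc a c, b a ≤ β s ∧ β s ≤ b s) ∧
      (∀ s, c ≤ s → β s = β c ∧ deriv β s = 0) ∧
      ∀ s ∈ Ico 0 R, ‖deriv β s‖ ≤ ‖derivOn R b s‖ := by
  have ha0 : 0 < a := hr.trans_le hra
  have hc0 : 0 < c := ha0.trans hac
  have hca : 0 < c - a := sub_pos.2 hac
  have hb' : ContinuousOn (derivOn R b) (Ico 0 R) :=
    hb.continuousOn_derivWithin (uniqueDiffOn_Ico 0 R) le_rfl
  -- The second factor switches `b'` off between `a` and `c`. The first one switches it off on `[-1,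
  -- 0]`, where `b` carries no information, so that the primitive is bounded on the whole line.
  -- Clamping the argument to `[0, c]` keeps the product continuous on `ℝ`.
  let η : ℝ → ℝ := fun s => max 0 (min 1 (s + 1)) * max 0 (min 1 ((c - s) / (c - a)))
  let clamp : ℝ → ℝ := fun s => max 0 (min s c)
  have hclamp : ∀ s, clamp s ∈ Ico 0 R := fun s =>
    ⟨le_max_left _ _, max_lt (hc0.trans hcR) ((min_le_right _ _).trans_lt hcR)⟩
  let g : ℝ → ℝ := fun s => η s * derivOn R b (clamp s)
  have hη : Continuous η := by fun_prop
  have hgc : Continuous g :=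
    hη.mul (hb'.comp_continuous (by fun_prop) hclamp)
  have hη0 : ∀ s, 0 ≤ η s := fun s => mul_nonneg (le_max_left _ _) (le_max_left _ _)
  have hη1 : ∀ s, η s ≤ 1 := fun s =>
    mul_le_one₀ (max_le zero_le_one (min_le_left _ _)) (le_max_left _ _)
      (max_le zero_le_one (min_le_left _ _))
  have hηc : ∀ s, c ≤ s → η s = 0 := fun s hs => by
    have : (c - s) / (c - a) ≤ 0 := div_nonpos_of_nonpos_of_nonneg (by linarith) hca.le
    have h2 : max 0 (min 1 ((c - s) / (c - a))) = 0 := max_eq_left ((min_le_right _ _).trans this)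
    simp only [η, h2, mul_zero]
  have hηa : ∀ s ∈ Icc 0 a, η s = 1 := fun s hs => by
    have h1 : 1 ≤ (c - s) / (c - a) := by rw [le_div_iff₀ hca]; linarith [hs.2]
    have h2 : (1 : ℝ) ≤ s + 1 := by linarith [hs.1]
    simp [η, min_eq_left h1, min_eq_left h2]
  have hηm : ∀ s, s ≤ -1 → η s = 0 := fun s hs => by
    have : max 0 (min 1 (s + 1)) = 0 := max_eq_left ((min_le_right _ _).trans (by linarith))
    simp only [η, this, zero_mul]
  have hgR : ∀ s ∈ Ico 0 R, g s = η s * derivOn R b s := fun s hs => by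
    rcases le_or_gt c s with h | h
    · simp [g, hηc s h]
    · simp only [g, clamp, min_eq_left h.le, max_eq_right hs.1]
  have hgs : HasCompactSupport g :=
    HasCompactSupport.intro (isCompact_Icc (a := -1) (b := c)) fun s hs => by
      rw [mem_Icc, not_and_or, not_le, not_le] at hs
      rcases hs with h | h
      · simp [g, hηm s h.le]
      · simp [g, hηc s h.le]
  have hgi : Integrable g := hgc.integrable_of_hasCompactSupport hgs
  obtain ⟨K₁, hK₁⟩ := hgc.bounded_above_of_compact_support hgs
  let β : ℝ → ℝ := fun s => b 0 + ∫ x in (0 : ℝ)..s, g x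
  have hβd : ∀ s, HasDerivAt β (g s) s := fun s =>
    (intervalIntegral.integral_hasDerivAt_right (hgc.intervalIntegrable _ _)
      (hgc.stronglyMeasurableAtFilter _ _) hgc.continuousAt).const_add _
  have hβ' : deriv β = g := funext fun s => (hβd s).deriv
  have hβ : ContDiff ℝ 1 β := by
    rw [contDiff_one_iff_deriv]
    exact ⟨fun s => (hβd s).differentiableAt, hβ' ▸ hgc⟩
  have hdiff : ∀ s t, β t - β s = ∫ x in s..t, g x := fun s t =>
    (intervalIntegral.integral_eq_sub_of_hasDerivAt (fun x _ => hβd x)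
      (hgc.intervalIntegrable _ _)).symm
  have hbc : ContinuousOn b (Ico 0 R) := hb.continuousOn
  have hFTC : ∀ s t, 0 ≤ s → s ≤ t → t < R →
      IntervalIntegrable (derivOn R b) volume s t ∧ ∫ x in s..t, derivOn R b x = b t - b s := by
    intro s t hs hst ht
    have hsub : Icc s t ⊆ Ico 0 R := fun x hx => ⟨hs.trans hx.1, hx.2.trans_lt ht⟩
    have hi : IntervalIntegrable (derivOn R b) volume s t :=
      (hb'.mono (by rwa [uIcc_of_le hst])).intervalIntegrable
    exact ⟨hi, intervalIntegral.integral_eq_sub_of_hasDerivAt_of_le hst (hbc.mono hsub)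
      (fun x hx => hasDerivAt_derivOn hb ⟨hs.trans_lt hx.1, hx.2.trans ht⟩) hi⟩
  have hβ0 : β 0 = b 0 := by simp [β]
  have hβa : ∀ s ∈ Icc 0 a, β s = b s := by
    intro s hs
    have h1 := hdiff 0 s
    have h2 := (hFTC 0 s le_rfl hs.1 (hs.2.trans_lt (hac.trans hcR))).2
    have h3 : ∫ x in (0 : ℝ)..s, g x = ∫ x in (0 : ℝ)..s, derivOn R b x := by
      refine intervalIntegral.integral_congr fun x hx => ?_
      rw [uIcc_of_le hs.1] at hx
      rw [hgR x ⟨hx.1, by linarith [hx.2, hs.2]⟩, hηa x ⟨hx.1, hx.2.trans hs.2⟩, one_mul]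
    rw [h3, h2, hβ0] at h1
    linarith
  refine ⟨β, ‖b 0‖ + ∫ x, ‖g x‖, K₁, hβ, ?_, ?_, ?_, ?_, ?_, ?_⟩
  · intro s
    refine (norm_add_le _ _).trans (add_le_add le_rfl ?_)
    refine intervalIntegral.norm_integral_le_integral_norm_uIoc.trans ?_
    exact setIntegral_le_integral hgi.norm (Eventually.of_forall fun _ => norm_nonneg _)
  · rw [hβ']; exact hK₁
  · intro s hs
    refine ⟨hβa s hs, ?_⟩
    rw [hβ', hgR s ⟨hs.1, by linarith [hs.2]⟩, hηa s hs, one_mul]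
  · intro s hs
    have h1 := hdiff a s
    rw [hβa a ⟨ha0.le, le_rfl⟩] at h1
    obtain ⟨hi, h2⟩ := hFTC a s ha0.le hs.1 (hs.2.trans_lt hcR)
    -- Beyond `a ≥ r` the derivative of `b` is nonnegative, so the factor `η ∈ [0, 1]` can only
    -- decrease the increments: this is where monotonicity yields `b a ≤ β ≤ b`.
    have hpos : ∀ x ∈ Ioo a s, 0 ≤ derivOn R b x := fun x hx =>
      derivOn_nonneg_of_monotoneOn hb hr hmono
        ⟨hra.trans_lt hx.1, hx.2.trans (hs.2.trans_lt hcR)⟩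
    have hgx : ∀ x ∈ Ioo a s, g x = η x * derivOn R b x := fun x hx =>
      hgR x ⟨(ha0.trans hx.1).le, hx.2.trans (hs.2.trans_lt hcR)⟩
    have h3 : 0 ≤ ∫ x in a..s, g x := by
      rw [intervalIntegral.integral_of_le hs.1, integral_Ioc_eq_integral_Ioo]
      refine setIntegral_nonneg measurableSet_Ioo fun x hx => ?_
      rw [hgx x hx]
      exact mul_nonneg (hη0 x) (hpos x hx)
    have h4 : ∫ x in a..s, g x ≤ ∫ x in a..s, derivOn R b x := by
      refine intervalIntegral.integral_mono_on_of_le_Ioo hs.1 (hgc.intervalIntegrable _ _) hi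
        fun x hx => ?_
      rw [hgx x hx]
      exact mul_le_of_le_one_left (hpos x hx) (hη1 x)
    constructor <;> linarith
  · intro s hs
    refine ⟨?_, by rw [hβ']; simp [g, hηc s hs]⟩
    have h1 := hdiff c s
    have h2 : ∫ x in c..s, g x = ∫ _ in c..s, (0 : ℝ) := by
      refine intervalIntegral.integral_congr fun x hx => ?_
      rw [uIcc_of_le hs] at hx
      simp [g, hηc x hx.1]
    rw [h2, intervalIntegral.integral_zero] at h1
    linarith
  · intro s hs
    rw [hβ', hgR s hs, norm_mul, Real.norm_of_nonneg (hη0 s)]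
    exact mul_le_of_le_one_left (norm_nonneg _) (hη1 s)

/-! ### Representatives extended by zero. -/

theorem locallyIntegrableOn_congr {X F : Type*} [TopologicalSpace X] [MeasurableSpace X]
    [NormedAddCommGroup F] {μ : Measure X} {s : Set X} {f g : X → F}
    (hf : LocallyIntegrable f μ) (h : f =ᵐ[μ.restrict s] g) : LocallyIntegrableOn g s μ := by
  intro x hx
  obtain ⟨U, hU, hi⟩ := hf x
  refine ⟨U ∩ s, inter_mem (mem_nhdsWithin_of_mem_nhds hU) self_mem_nhdsWithin, ?_⟩
  exact (hi.mono_set inter_subset_left).congr (ae_restrict_of_ae_restrict_of_subset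
    inter_subset_right h)

theorem measurableSet_cylinder {d : ℕ} (T : ℝ) (Ω : Opens (Space d)) :
    MeasurableSet (cylinder T Ω : Set (ℝ × Space d)) := (cylinder T Ω).isOpen.measurableSet

theorem IsBoundedLipschitzDomain.volume_ne_top {d : ℕ} {Ω : Opens (Space d)}
    (hΩ : IsBoundedLipschitzDomain Ω) : volume (Ω : Set (Space d)) ≠ ⊤ :=
  hΩ.bounded.measure_lt_top.ne

theorem IsBoundedLipschitzDomain.isFiniteMeasure_restrict_cylinder {d : ℕ} {Ω : Opens (Space d)}
    (hΩ : IsBoundedLipschitzDomain Ω) (T : ℝ) :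
    IsFiniteMeasure (volume.restrict (cylinder T Ω : Set (ℝ × Space d))) := by
  refine ⟨?_⟩
  rw [Measure.restrict_apply_univ]
  change volume (Ioo 0 T ×ˢ (Ω : Set (Space d))) < ⊤
  rw [Measure.volume_eq_prod, Measure.prod_prod]
  exact ENNReal.mul_lt_top (by simp) hΩ.volume_ne_top.lt_top

theorem ae_ae_of_ae_restrict_cylinder {d : ℕ} {T : ℝ} {Ω : Opens (Space d)}
    {P : ℝ × Space d → Prop}
    (h : ∀ᵐ p ∂(volume.restrict (cylinder T Ω : Set (ℝ × Space d))), P p) :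
    ∀ᵐ t ∂(volume.restrict (Ioo 0 T)), ∀ᵐ x ∂(volume.restrict (Ω : Set (Space d))), P (t, x) := by
  have e : volume.restrict (cylinder T Ω : Set (ℝ × Space d))
      = (volume.restrict (Ioo 0 T)).prod (volume.restrict (Ω : Set (Space d))) := by
    rw [Measure.prod_restrict]; rfl
  rw [e] at h
  exact Measure.ae_ae_of_ae_prod h

/-- A measurable representative, vanishing outside of `s`, of a function defined on `s`. -/
theorem exists_stronglyMeasurable_indicator {X F : Type*} [MeasurableSpace X]
    [NormedAddCommGroup F] {μ : Measure X} {s : Set X} (hs : MeasurableSet s) {f : X → F}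
    (hf : AEStronglyMeasurable f (μ.restrict s)) :
    ∃ g : X → F, StronglyMeasurable g ∧ g =ᵐ[μ.restrict s] f ∧ ∀ x ∉ s, g x = 0 := by
  refine ⟨s.indicator (hf.mk f), hf.stronglyMeasurable_mk.indicator hs, ?_,
    fun x hx => indicator_of_notMem hx _⟩
  filter_upwards [hf.ae_eq_mk, ae_restrict_mem hs] with x hx hxs
  rw [indicator_of_mem hxs, hx]

theorem integrable_of_memLp_two_of_eq_zero {X F : Type*} [MeasurableSpace X]
    [NormedAddCommGroup F] {μ : Measure X} {s : Set X} [IsFiniteMeasure (μ.restrict s)] {f g : X → F}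
    (hf : MemLp f 2 (μ.restrict s)) (h : g =ᵐ[μ.restrict s] f) (h0 : ∀ x ∉ s, g x = 0) :
    Integrable g μ :=
  (integrableOn_iff_integrable_of_support_subset fun x hx => by
    by_contra hne
    exact hx (h0 x hne)).1 ((hf.integrable (by norm_num)).congr h.symm)

/-- Measurable representatives that vanish outside the cylinder make bounds, measurability of slices
and supports hold at every point instead of almost everywhere. -/
theorem exists_transportPair {d : ℕ} {T : ℝ} (hT : 0 < T) {Ω : Opens (Space d)}
    (hΩ : IsBoundedLipschitzDomain Ω) {R : ℝ} (hR : 0 < R) {ρ : ℝ × Space d → ℝ}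
    (hρ : MemLp ρ ⊤ (volume.restrict (cylinder T Ω : Set (ℝ × Space d))))
    (hρR : ∀ᵐ p ∂(volume.restrict (cylinder T Ω : Set (ℝ × Space d))), 0 ≤ ρ p ∧ ρ p < R)
    {u : ℝ × Space d → Space d} {Du : Fin d → ℝ × Space d → Space d}
    (hu : MemL2W12Zero T Ω u Du)
    (hcont : HoldsInDistributions (cylinder T Ω) ρ (fun p => ρ p • u p) (fun _ => 0)) :
    ∃ (ρ' : ℝ × Space d → ℝ) (u' : ℝ × Space d → Space d) (G : Fin d → ℝ × Space d → Space d),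
      TransportPair T R (Ω : Set (Space d)) ρ' u' G ∧ (∀ p, ρ' p ∈ Ico 0 R) ∧
      (∀ p ∉ cylinder T Ω, ρ' p = 0) ∧ (∀ p ∉ cylinder T Ω, u' p = 0) ∧
      (∀ i, ∀ p ∉ cylinder T Ω, G i p = 0) ∧
      ρ' =ᵐ[volume.restrict (cylinder T Ω : Set (ℝ × Space d))] ρ ∧
      u' =ᵐ[volume.restrict (cylinder T Ω : Set (ℝ × Space d))] u ∧
      ∀ i, G i =ᵐ[volume.restrict (cylinder T Ω : Set (ℝ × Space d))] Du i := by
  have hQ := measurableSet_cylinder T Ω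
  have := hΩ.isFiniteMeasure_restrict_cylinder T
  obtain ⟨ρ₁, hρ₁m, hρ₁e, hρ₁0⟩ := exists_stronglyMeasurable_indicator hQ hρ.aestronglyMeasurable
  obtain ⟨u', hum, hue, hu0⟩ := exists_stronglyMeasurable_indicator hQ hu.memLp.aestronglyMeasurable
  choose G hGm hGe hG0 using fun i =>
    exists_stronglyMeasurable_indicator hQ (hu.memLp_grad i).aestronglyMeasurable
  -- Values outside `[0, R)`, taken on a null subset of the cylinder, are replaced by `0`.
  let ρ' : ℝ × Space d → ℝ := (ρ₁ ⁻¹' Ico 0 R).indicator ρ₁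
  have hρ'm : StronglyMeasurable ρ' := hρ₁m.indicator (hρ₁m.measurable measurableSet_Ico)
  have hρ'R : ∀ p, ρ' p ∈ Ico 0 R := fun p => by
    by_cases hp : p ∈ ρ₁ ⁻¹' Ico 0 R
    · simp only [ρ', indicator_of_mem hp]; exact hp
    · simp only [ρ', indicator_of_notMem hp]; exact ⟨le_rfl, hR⟩
  have hρ'e : ρ' =ᵐ[volume.restrict (cylinder T Ω : Set (ℝ × Space d))] ρ := by
    filter_upwards [hρ₁e, hρR] with p h1 h2
    have hp : p ∈ ρ₁ ⁻¹' Ico 0 R := by rw [mem_preimage, h1]; exact h2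
    simp only [ρ', indicator_of_mem hp, h1]
  have hρ'0 : ∀ p ∉ cylinder T Ω, ρ' p = 0 := fun p hp => by
    by_cases hp' : p ∈ ρ₁ ⁻¹' Ico 0 R
    · simp only [ρ', indicator_of_mem hp', hρ₁0 p hp]
    · simp only [ρ', indicator_of_notMem hp']
  have hρ'b : ∀ p, ‖ρ' p‖ ≤ R := fun p => by
    rw [Real.norm_of_nonneg (hρ'R p).1]; exact (hρ'R p).2.le
  have hρ'i : Integrable ρ' := integrable_of_memLp_two_of_eq_zero
    (hρ.mono_exponent le_top) hρ'e hρ'0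
  have hui : Integrable u' := integrable_of_memLp_two_of_eq_zero hu.memLp hue hu0
  have hGi : ∀ i, Integrable (G i) := fun i =>
    integrable_of_memLp_two_of_eq_zero (hu.memLp_grad i) (hGe i) (hG0 i)
  have hs : ∀ᵐ t : ℝ, IsSobolevLimit (Ω : Set (Space d)) (fun x => u' (t, x))
      (fun i x => G i (t, x)) := by
    have h1 := hu.slice
    have h2 := ae_ae_of_ae_restrict_cylinder hue
    have h3 := ae_all_iff.2 fun i => ae_ae_of_ae_restrict_cylinder (hGe i)
    rw [ae_restrict_iff' measurableSet_Ioo] at h1 h2 h3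
    filter_upwards [h1, h2, h3] with t h1 h2 h3
    by_cases ht : t ∈ Ioo 0 T
    · exact (h1 ht).isSobolevLimit hΩ.volume_ne_top (h2 ht) (fun x hx => hu0 _ fun h => hx h.2)
        (h3 ht) fun i x hx => hG0 i _ fun h => hx h.2
    · have e1 : (fun x => u' (t, x)) = fun _ => 0 := funext fun x => hu0 _ fun h => ht h.1
      have e2 : (fun i x => G i (t, x)) = fun _ _ => 0 :=
        funext fun i => funext fun x => hG0 i _ fun h => ht h.1
      rw [e1, e2]
      refine ⟨integrable_zero _ _ _, fun i => integrable_zero _ _ _, fun _ _ => 0,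
        fun _ => contDiff_const, fun _ => HasCompactSupport.zero, fun _ => ?_, ?_⟩
      · rw [show (fun _ : Space d => (0 : Space d)) = 0 from rfl, tsupport_zero]
        exact empty_subset _
      · simp [fieldSize]
  refine ⟨ρ', u', G, ⟨hT, hρ'm, hρ'b, hρ'i, hum, hui, hGi, hs, fun ξ κ hξ hξs hξt hκ hκs =>
    weak_extension hΩ hρ'b hρ'i (fun p hp => hρ'0 p fun h => hp h.2) hui hGi hs
      (fun ψ hψ hψs hψt => ?_) hξ hξs hξt hκ hκs⟩, hρ'R, hρ'0, hu0, hG0, hρ'e, hue, hGe⟩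
  have h1 := hcont.weak ⟨ψ, hψ, hψs, hψt⟩
  have h2 : ∫ p, (ρ' p * fderiv ℝ ψ p (1, 0) + ρ' p * fderiv ℝ ψ p (0, u' p))
      = ∫ p in (cylinder T Ω : Set (ℝ × Space d)),
        (ρ' p * fderiv ℝ ψ p (1, 0) + ρ' p * fderiv ℝ ψ p (0, u' p)) :=
    (setIntegral_eq_integral_of_forall_compl_eq_zero fun p hp => by simp [hρ'0 p hp]).symm
  rw [h2]
  refine Eq.trans (integral_congr_ae ?_) h1
  filter_upwards [hρ'e, hue] with p e1 e2
  have e3 : ((0 : ℝ), ρ p • u p) = ρ p • ((0 : ℝ), u p) := by simp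
  change ρ' p * fderiv ℝ ψ p (1, 0) + ρ' p * fderiv ℝ ψ p (0, u' p)
    = ρ p * fderiv ℝ ψ p (1, 0) + fderiv ℝ ψ p (0, ρ p • u p) - 0 * ψ p
  rw [e1, e2, e3, map_smul, smul_eq_mul, zero_mul, sub_zero]

/-! ### Unbounded renormalizing functions. -/

/-- The renormalized equation passes to dominated pointwise limits of renormalizing functions. -/
theorem TransportPair.renormalized_of_tendsto {d : ℕ} {T R : ℝ} {Ω : Opens (Space d)}
    (hΩ : IsBoundedLipschitzDomain Ω) {ρ : ℝ × Space d → ℝ} {u : ℝ × Space d → Space d}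
    {G : Fin d → ℝ × Space d → Space d} (h : TransportPair T R (Ω : Set (Space d)) ρ u G)
    (hρR : ∀ p, ρ p ∈ Ico 0 R) (hρ0 : ∀ p ∉ cylinder T Ω, ρ p = 0)
    (hu0 : ∀ p ∉ cylinder T Ω, u p = 0) (hG0 : ∀ i, ∀ p ∉ cylinder T Ω, G i p = 0)
    (hu : MemLp u 2 (volume.restrict (cylinder T Ω : Set (ℝ × Space d))))
    (hG : ∀ i, MemLp (G i) 2 (volume.restrict (cylinder T Ω : Set (ℝ × Space d))))
    {b b' : ℝ → ℝ} (hb : MemLp (fun p => b (ρ p)) 2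
      (volume.restrict (cylinder T Ω : Set (ℝ × Space d))))
    (hb' : MemLp (fun p => b' (ρ p)) 2 (volume.restrict (cylinder T Ω : Set (ℝ × Space d))))
    {β : ℕ → ℝ → ℝ} {c : ℝ} {B B' : ℝ → ℝ} (hβ : ∀ n, ContDiff ℝ 1 (β n))
    (hβ₀ : ∀ n, ∃ K₀, ∀ s, ‖β n s‖ ≤ K₀) (hβ₁ : ∀ n, ∃ K₁, ∀ s, ‖deriv (β n) s‖ ≤ K₁)
    (hdom : ∀ n, ∀ s ∈ Ico 0 R, ‖β n s‖ ≤ ‖b s‖ + c)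
    (hdom' : ∀ n, ∀ s ∈ Ico 0 R, ‖deriv (β n) s‖ ≤ ‖b' s‖)
    (hlim : ∀ s ∈ Ico 0 R, Tendsto (fun n => β n s) atTop (𝓝 (B s)))
    (hlim' : ∀ s ∈ Ico 0 R, Tendsto (fun n => deriv (β n) s) atTop (𝓝 (B' s))) :
    LocallyIntegrable (fun p => B (ρ p)) ∧ Integrable (fun p => B (ρ p) • u p) ∧
      Integrable (fun p => (B' (ρ p) * ρ p - B (ρ p)) * ∑ i, G i p i) ∧
      ∀ ψ : ℝ × Space d → ℝ, ContDiff ℝ ∞ ψ → HasCompactSupport ψ →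
        tsupport ψ ⊆ Ioo 0 T ×ˢ univ →
        ∫ p, (B (ρ p) * fderiv ℝ ψ p (1, 0) + fderiv ℝ ψ p (0, B (ρ p) • u p)
          - (B' (ρ p) * ρ p - B (ρ p)) * (∑ i, G i p i) * ψ p) = 0 := by
  have hfin := hΩ.isFiniteMeasure_restrict_cylinder T
  have hQ := measurableSet_cylinder T Ω
  set D : ℝ × Space d → ℝ := fun p => ∑ i, G i p i with hD
  have hsupp : ∀ {f : ℝ × Space d → ℝ}, IntegrableOn f (cylinder T Ω : Set (ℝ × Space d)) →
      (∀ p ∉ cylinder T Ω, f p = 0) → Integrable f := fun hf h0 =>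
    (integrableOn_iff_integrable_of_support_subset fun p hp => by
      by_contra hne
      exact hp (h0 p hne)).1 hf
  have hmB : StronglyMeasurable fun p => B (ρ p) :=
    stronglyMeasurable_of_tendsto atTop
      (fun n => (hβ n).continuous.comp_stronglyMeasurable h.measurable)
      (tendsto_pi_nhds.2 fun p => hlim _ (hρR p))
  have hmB' : StronglyMeasurable fun p => B' (ρ p) :=
    stronglyMeasurable_of_tendsto atTop
      (fun n => ((hβ n).continuous_deriv le_rfl).comp_stronglyMeasurable h.measurable)
      (tendsto_pi_nhds.2 fun p => hlim' _ (hρR p))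
  have hBd : ∀ p, ‖B (ρ p)‖ ≤ ‖b (ρ p)‖ + c := fun p =>
    le_of_tendsto' (hlim _ (hρR p)).norm fun n => hdom n _ (hρR p)
  have hBd' : ∀ p, ‖B' (ρ p)‖ ≤ ‖b' (ρ p)‖ := fun p =>
    le_of_tendsto' (hlim' _ (hρR p)).norm fun n => hdom' n _ (hρR p)
  -- Outside the cylinder this function is the constant `b 0`, so it is only locally integrable on
  -- the whole space; the flux and the source vanish there with `u` and `div u`.
  have hbl : LocallyIntegrable fun p => b (ρ p) := by
    have h1 : Integrable ((cylinder T Ω : Set (ℝ × Space d)).indicator fun p => b (ρ p)) :=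
      (integrable_indicator_iff hQ).2 (hb.integrable (by norm_num))
    have h2 : LocallyIntegrable ((cylinder T Ω : Set (ℝ × Space d))ᶜ.indicator fun _ => b 0)
        (volume : Measure (ℝ × Space d)) := (locallyIntegrable_const (b 0)).indicator hQ.compl
    refine (h1.locallyIntegrable.add h2).congr (Eventually.of_forall fun p => ?_)
    by_cases hp : p ∈ cylinder T Ω
    · simp [hp]
    · simp [hp, hρ0 p hp]
  have hFl : LocallyIntegrable fun p => ‖b (ρ p)‖ + c :=
    LocallyIntegrable.add (fun x => (hbl x).norm) (locallyIntegrable_const c)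
  have hF2 : MemLp (fun p => ‖b (ρ p)‖ + c) 2
      (volume.restrict (cylinder T Ω : Set (ℝ × Space d))) := hb.norm.add (memLp_const c)
  have hFu : Integrable fun p => (‖b (ρ p)‖ + c) * ‖u p‖ :=
    hsupp (hF2.integrable_mul hu.norm) fun p hp => by simp [hu0 p hp]
  have hH2 : MemLp (fun p => ‖b' (ρ p)‖ * R + (‖b (ρ p)‖ + c)) 2
      (volume.restrict (cylinder T Ω : Set (ℝ × Space d))) := (hb'.norm.mul_const R).add hF2
  have hD2 : MemLp D 2 (volume.restrict (cylinder T Ω : Set (ℝ × Space d))) :=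
    memLp_finsetSum _ fun i _ =>
      (EuclideanSpace.proj i : Space d →L[ℝ] ℝ).comp_memLp' (hG i)
  have hHD : Integrable fun p => (‖b' (ρ p)‖ * R + (‖b (ρ p)‖ + c)) * ‖D p‖ :=
    hsupp (hH2.integrable_mul hD2.norm) fun p hp => by simp [hD, hG0 _ p hp]
  have hDm : AEStronglyMeasurable D volume :=
    (integrable_finsetSum _ fun i _ =>
      (EuclideanSpace.proj i : Space d →L[ℝ] ℝ).integrable_comp
        (h.integrable_grad i)).aestronglyMeasurable
  have hsrc : ∀ {x y z : ℝ} {p : ℝ × Space d}, ‖x‖ ≤ ‖b' (ρ p)‖ → ‖y‖ ≤ ‖b (ρ p)‖ + c →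
      ‖(x * ρ p - y) * z‖ ≤ (‖b' (ρ p)‖ * R + (‖b (ρ p)‖ + c)) * ‖z‖ := by
    intro x y z p hx hy
    rw [norm_mul]
    gcongr
    refine (norm_sub_le _ _).trans ?_
    rw [norm_mul]
    gcongr
    exact h.bound p
  refine ⟨hFl.mono hmB.aestronglyMeasurable (Eventually.of_forall fun p => (hBd p).trans
      (le_abs_self _)), ?_, ?_, ?_⟩
  · refine hFu.mono' (hmB.aestronglyMeasurable.smul h.integrable_velocity.aestronglyMeasurable)
      (Eventually.of_forall fun p => ?_)
    rw [norm_smul]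
    gcongr
    exact hBd p
  · refine hHD.mono' (((hmB'.mul h.measurable).sub hmB).aestronglyMeasurable.mul hDm)
      (Eventually.of_forall fun p => hsrc (hBd' p) (hBd p))
  · intro ψ hψ hψs hψt
    obtain ⟨A, hA⟩ := hψ.continuous.bounded_above_of_compact_support hψs
    obtain ⟨E, hE⟩ := (hψ.continuous_fderiv (by simp)).bounded_above_of_compact_support
      (hψs.fderiv (𝕜 := ℝ))
    have hA0 : 0 ≤ A := (norm_nonneg _).trans (hA 0)
    have hE0 : 0 ≤ E := (norm_nonneg _).trans (hE 0)
    have hc1 : Continuous fun p : ℝ × Space d => fderiv ℝ ψ p (1, 0) :=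
      (hψ.continuous_fderiv (by simp)).clm_apply continuous_const
    have hd1 : Integrable fun p => (‖b (ρ p)‖ + c) * ‖fderiv ℝ ψ p (1, 0)‖ := by
      have := hFl.integrable_smul_left_of_hasCompactSupport hc1.norm
        (hψs.fderiv_apply (𝕜 := ℝ) (1, 0)).norm
      simpa [mul_comm] using this
    have hl : Tendsto (fun n => ∫ p, (β n (ρ p) * fderiv ℝ ψ p (1, 0)
        + fderiv ℝ ψ p (0, β n (ρ p) • u p)
        - (deriv (β n) (ρ p) * ρ p - β n (ρ p)) * D p * ψ p)) atTop
        (𝓝 (∫ p, (B (ρ p) * fderiv ℝ ψ p (1, 0) + fderiv ℝ ψ p (0, B (ρ p) • u p)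
          - (B' (ρ p) * ρ p - B (ρ p)) * D p * ψ p))) := by
      refine tendsto_integral_of_dominated_convergence
        (fun p => (‖b (ρ p)‖ + c) * ‖fderiv ℝ ψ p (1, 0)‖ + E * ((‖b (ρ p)‖ + c) * ‖u p‖)
          + (‖b' (ρ p)‖ * R + (‖b (ρ p)‖ + c)) * ‖D p‖ * A) (fun n => ?_)
        ((hd1.add (hFu.const_mul E)).add (hHD.mul_const A))
        (fun n => Eventually.of_forall fun p => ?_) (Eventually.of_forall fun p => ?_)
      · have m1 : StronglyMeasurable fun p => β n (ρ p) :=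
          (hβ n).continuous.comp_stronglyMeasurable h.measurable
        have m2 : StronglyMeasurable fun p => deriv (β n) (ρ p) :=
          ((hβ n).continuous_deriv le_rfl).comp_stronglyMeasurable h.measurable
        refine ((m1.aestronglyMeasurable.mul hc1.aestronglyMeasurable).add ?_).sub
          ((((m2.mul h.measurable).sub m1).aestronglyMeasurable.mul hDm).mul
            hψ.continuous.aestronglyMeasurable)
        exact (ContinuousLinearMap.apply ℝ ℝ).flip.aestronglyMeasurable_comp₂
          (hψ.continuous_fderiv (by simp)).aestronglyMeasurable
          (aestronglyMeasurable_const.prodMk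
            (m1.aestronglyMeasurable.smul h.integrable_velocity.aestronglyMeasurable))
      · have h1 := hdom n _ (hρR p)
        have h2 := hdom' n _ (hρR p)
        refine (norm_sub_le _ _).trans (add_le_add ((norm_add_le _ _).trans (add_le_add ?_ ?_)) ?_)
        · rw [norm_mul]
          gcongr
        · refine (ContinuousLinearMap.le_opNorm _ _).trans ?_
          have : ‖((0 : ℝ), β n (ρ p) • u p)‖ = ‖β n (ρ p)‖ * ‖u p‖ := by
            rw [Prod.norm_def, norm_zero, norm_smul]
            exact max_eq_right (by positivity)
          rw [this]
          gcongr
          exact hE p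
        · rw [norm_mul]
          have h3 : ‖(deriv (β n) (ρ p) * ρ p - β n (ρ p)) * D p‖
            ≤ (‖b' (ρ p)‖ * R + (‖b (ρ p)‖ + c)) * ‖D p‖ := hsrc h2 h1
          exact mul_le_mul h3 (hA p) (norm_nonneg _) ((norm_nonneg _).trans h3)
      · have h1 := hlim _ (hρR p)
        have h2 := hlim' _ (hρR p)
        refine ((h1.mul_const _).add ?_).sub ((((h2.mul_const _).sub h1).mul_const _).mul_const _)
        exact ((fderiv ℝ ψ p).continuous.tendsto _).comp
          (tendsto_const_nhds.prodMk_nhds (h1.smul_const (u p)))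
    refine tendsto_nhds_unique hl ?_
    refine tendsto_const_nhds.congr fun n => ?_
    obtain ⟨K₀, hK₀⟩ := hβ₀ n
    obtain ⟨K₁, hK₁⟩ := hβ₁ n
    exact (h.renormalized (hβ n) hK₀ hK₁ hψ hψs hψt).symm

/-! ### Convergence of the cutoffs and conclusion. -/

theorem zeroExt_ae_eq {d : ℕ} {F : Type*} [Zero F] {T : ℝ} {Ω : Opens (Space d)}
    {f g : ℝ × Space d → F}
    (h : g =ᵐ[volume.restrict (cylinder T Ω : Set (ℝ × Space d))] f)
    (h0 : ∀ p ∉ cylinder T Ω, g p = 0) :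
    g =ᵐ[volume.restrict (cylinder T (⊤ : Opens (Space d)) : Set (ℝ × Space d))] zeroExt Ω f := by
  have h1 := (ae_restrict_iff' (measurableSet_cylinder T Ω)).1 h
  filter_upwards [ae_restrict_of_ae (s := (cylinder T (⊤ : Opens (Space d)) : Set (ℝ × Space d))) h1,
    ae_restrict_mem (measurableSet_cylinder T ⊤)] with p hp hpT
  by_cases hpΩ : p.2 ∈ Ω
  · rw [hp ⟨hpT.1, hpΩ⟩, zeroExt, indicator_of_mem (s := {p : ℝ × Space d | p.2 ∈ Ω}) hpΩ]
  · rw [h0 p fun h => hpΩ h.2, zeroExt, indicator_of_notMem (s := {p : ℝ × Space d | p.2 ∈ Ω}) hpΩ]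

/-- Below `c` the sequence is eventually equal to `b`. From `c` on, each `β n` is the constant `β n
c`, squeezed between `b (a n)` and `b c`, and its derivative is zero; at `s = c` this agrees with
the value prescribed at the kink. -/
theorem tendsto_truncation_cutoff {R c r : ℝ} {b : ℝ → ℝ} (hb : ContDiffOn ℝ 1 b (Ico 0 R))
    (hr : 0 < r) (hrc : r < c) (hcR : c < R) {a : ℕ → ℝ} (hac : ∀ n, a n < c)
    (hlim : Tendsto a atTop (𝓝 c)) {β : ℕ → ℝ → ℝ}
    (hβa : ∀ n, ∀ s ∈ Icc 0 (a n), β n s = b s ∧ deriv (β n) s = derivOn R b s)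
    (hβac : ∀ n, ∀ s ∈ Icc (a n) c, b (a n) ≤ β n s ∧ β n s ≤ b s)
    (hβc : ∀ n s, c ≤ s → β n s = β n c ∧ deriv (β n) s = 0) {s : ℝ} (hs : s ∈ Ico 0 R) :
    Tendsto (fun n => β n s) atTop (𝓝 (truncation R (R - c) b s)) ∧
      Tendsto (fun n => deriv (β n) s) atTop (𝓝 (truncationDeriv R (R - c) b s)) := by
  have hRc : R - (R - c) = c := by ring
  have hc0 : 0 < c := hr.trans hrc
  rcases lt_or_ge s c with h | h
  · have hev : ∀ᶠ n in atTop, s ∈ Icc 0 (a n) := by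
      filter_upwards [hlim.eventually (lt_mem_nhds h)] with n hn using ⟨hs.1, hn.le⟩
    have e1 : truncation R (R - c) b s = b s := by rw [truncation, hRc, if_pos h.le]
    have e2 : truncationDeriv R (R - c) b s = derivOn R b s := by
      rw [truncationDeriv, hRc, if_neg h.ne]
      unfold derivOn
      refine Filter.EventuallyEq.derivWithin_eq ?_ e1
      filter_upwards [mem_nhdsWithin_of_mem_nhds (Iio_mem_nhds h)] with x hx
      rw [truncation, hRc, if_pos (le_of_lt hx)]
    rw [e1, e2]
    exact ⟨tendsto_const_nhds.congr' (hev.mono fun n hn => (hβa n s hn).1.symm),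
      tendsto_const_nhds.congr' (hev.mono fun n hn => (hβa n s hn).2.symm)⟩
  · have e1 : truncation R (R - c) b s = b c := by
      rw [truncation, hRc]
      split_ifs with h'
      · rw [le_antisymm h' h]
      · rfl
    have e2 : truncationDeriv R (R - c) b s = 0 := by
      rw [truncationDeriv, hRc]
      split_ifs with h'
      · rfl
      · have hlt : c < s := lt_of_le_of_ne h (Ne.symm h')
        unfold derivOn
        have : derivWithin (truncation R (R - c) b) (Ico 0 R) s
            = derivWithin (fun _ => b c) (Ico 0 R) s := by
          refine Filter.EventuallyEq.derivWithin_eq ?_ e1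
          filter_upwards [mem_nhdsWithin_of_mem_nhds (Ioi_mem_nhds hlt)] with x hx
          rw [truncation, hRc, if_neg (not_le.2 hx)]
        rw [this]
        simp
    rw [e1, e2]
    refine ⟨?_, tendsto_const_nhds.congr fun n => (hβc n s h).2.symm⟩
    have hbc : ContinuousAt b c := (hasDerivAt_derivOn hb ⟨hc0, hcR⟩).continuousAt
    refine tendsto_of_tendsto_of_tendsto_of_le_of_le (hbc.tendsto.comp hlim) tendsto_const_nhds
      (fun n => ?_) fun n => ?_
    · simp only [Function.comp_def]
      rw [(hβc n s h).1]
      exact (hβac n c ⟨(hac n).le, le_rfl⟩).1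
    · simp only
      rw [(hβc n s h).1]
      exact (hβac n c ⟨(hac n).le, le_rfl⟩).2

/-- The cutoffs of `b` are dominated by `b`. -/
theorem norm_cutoff_le {r a c R : ℝ} {b β : ℝ → ℝ}
    (hmono : MonotoneOn b (Ico r R)) (hra : r ≤ a) (hac : a < c) (hcR : c < R)
    (hβa : ∀ s ∈ Icc 0 a, β s = b s ∧ deriv β s = derivOn R b s)
    (hβac : ∀ s ∈ Icc a c, b a ≤ β s ∧ β s ≤ b s)
    (hβc : ∀ s, c ≤ s → β s = β c ∧ deriv β s = 0) {s : ℝ} (hs : s ∈ Ico 0 R) :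
    ‖β s‖ ≤ ‖b s‖ + ‖b r‖ := by
  have haR : a < R := hac.trans hcR
  have hra' : b r ≤ b a := hmono ⟨le_rfl, hra.trans_lt haR⟩ ⟨hra, haR⟩ hra
  rcases le_or_gt s a with h | h
  · rw [(hβa s ⟨hs.1, h⟩).1]
    exact le_add_of_nonneg_right (norm_nonneg _)
  · have key : b r ≤ β s ∧ β s ≤ b s := by
      rcases le_or_gt s c with h' | h'
      · have := hβac s ⟨h.le, h'⟩
        exact ⟨hra'.trans this.1, this.2⟩
      · have h1 := hβac c ⟨hac.le, le_rfl⟩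
        have h2 : b c ≤ b s := hmono ⟨hra.trans hac.le, hcR⟩ ⟨(hra.trans hac.le).trans h'.le, hs.2⟩
          h'.le
        rw [(hβc s h'.le).1]
        exact ⟨hra'.trans h1.1, h1.2.trans h2⟩
    rw [Real.norm_eq_abs, Real.norm_eq_abs, Real.norm_eq_abs, abs_le]
    constructor
    · linarith [neg_abs_le (b r), abs_nonneg (b s)]
    · linarith [le_abs_self (b s), abs_nonneg (b r)]

theorem renormalizedContinuityEq_zeroExt {d : ℕ} {T : ℝ} (hT : 0 < T) {Ω : Opens (Space d)}
    (hΩ : IsBoundedLipschitzDomain Ω)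
    {R : ℝ} {ρ : ℝ × Space d → ℝ}
    (hρ : MemLp ρ ⊤
      (volume.restrict (cylinder T Ω : Set (ℝ × Space d))))
    (hρR : ∀ᵐ p ∂(volume.restrict (cylinder T Ω : Set (ℝ × Space d))),
      0 ≤ ρ p ∧ ρ p < R)
    {u : ℝ × Space d → Space d}
    {Du : Fin d → ℝ × Space d → Space d}
    (hu : MemL2W12Zero T Ω u Du)
    (hcont : HoldsInDistributions (cylinder T Ω)
      ρ (fun p => ρ p • u p) (fun _ => 0))
    {b : ℝ → ℝ} (hb : ContDiffOn ℝ 1 b (Ico 0 R))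
    (hbρ : MemLp (fun p => b (ρ p)) 2
      (volume.restrict (cylinder T Ω : Set (ℝ × Space d))))
    (hb'ρ : MemLp (fun p => derivOn R b (ρ p)) 2
      (volume.restrict (cylinder T Ω : Set (ℝ × Space d))))
    {α₀ : ℝ} (hα₀ : α₀ ∈ Ioo 0 R)
    (hbmono : MonotoneOn b (Ico (R - α₀) R)) :
    RenormalizedContinuityEq (cylinder T ⊤)
        b (derivOn R b)
        (zeroExt Ω ρ) (zeroExt Ω u)
        (divergence (fun i => zeroExt Ω (Du i))) ∧
      ∀ α ∈ Ioo 0 α₀,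
        RenormalizedContinuityEq (cylinder T ⊤)
          (truncation R α b) (truncationDeriv R α b)
          (zeroExt Ω ρ) (zeroExt Ω u)
          (divergence (fun i => zeroExt Ω (Du i))) := by
  have hR : 0 < R := hα₀.1.trans hα₀.2
  have hr : 0 < R - α₀ := sub_pos.2 hα₀.2
  obtain ⟨ρ', u', G, h, hρ'R, hρ'0, hu'0, hG0, hρe, hue, hGe⟩ :=
    exists_transportPair hT hΩ hR hρ hρR hu hcont
  have hρz := zeroExt_ae_eq hρe hρ'0
  have huz := zeroExt_ae_eq hue hu'0
  have hGz := ae_all_iff.2 fun i => zeroExt_ae_eq (hGe i) (hG0 i)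
  have hbρ' : MemLp (fun p => b (ρ' p)) 2
      (volume.restrict (cylinder T Ω : Set (ℝ × Space d))) :=
    hbρ.ae_eq (by filter_upwards [hρe] with p hp using by rw [hp])
  have hb'ρ' : MemLp (fun p => derivOn R b (ρ' p)) 2
      (volume.restrict (cylinder T Ω : Set (ℝ × Space d))) :=
    hb'ρ.ae_eq (by filter_upwards [hρe] with p hp using by rw [hp])
  -- Both assertions are instances of one limit theorem and differ only in the choice of the
  -- cutoffs.
  have key : ∀ {β : ℕ → ℝ → ℝ} {c : ℝ} {B B' : ℝ → ℝ}, (∀ n, ContDiff ℝ 1 (β n)) →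
      (∀ n, ∃ K₀, ∀ s, ‖β n s‖ ≤ K₀) → (∀ n, ∃ K₁, ∀ s, ‖deriv (β n) s‖ ≤ K₁) →
      (∀ n, ∀ s ∈ Ico 0 R, ‖β n s‖ ≤ ‖b s‖ + c) →
      (∀ n, ∀ s ∈ Ico 0 R, ‖deriv (β n) s‖ ≤ ‖derivOn R b s‖) →
      (∀ s ∈ Ico 0 R, Tendsto (fun n => β n s) atTop (𝓝 (B s))) →
      (∀ s ∈ Ico 0 R, Tendsto (fun n => deriv (β n) s) atTop (𝓝 (B' s))) →
      RenormalizedContinuityEq (cylinder T ⊤) B B' (zeroExt Ω ρ) (zeroExt Ω u)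
        (divergence (fun i => zeroExt Ω (Du i))) := by
    intro β c B B' hβ hβ₀ hβ₁ hdom hdom' hlim hlim'
    obtain ⟨h1, h2, h3, h4⟩ := h.renormalized_of_tendsto hΩ hρ'R hρ'0 hu'0 hG0
      (hu.memLp.ae_eq hue.symm) (fun i => (hu.memLp_grad i).ae_eq (hGe i).symm) hbρ' hb'ρ' hβ hβ₀ hβ₁
      hdom hdom' hlim hlim'
    refine ⟨locallyIntegrableOn_congr h1 ?_, locallyIntegrableOn_congr h2.locallyIntegrable ?_,
      locallyIntegrableOn_congr h3.locallyIntegrable ?_, fun ψ => ?_⟩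
    · filter_upwards [hρz] with p e1 using by rw [e1]
    · filter_upwards [hρz, huz] with p e1 e2 using by rw [e1, e2]
    · filter_upwards [hρz, hGz] with p e1 e3
      simp only [divergence, e1, e3]
    · have h5 := h4 ψ ψ.contDiff ψ.hasCompactSupport ψ.tsupport_subset
      rw [← setIntegral_eq_integral_of_forall_compl_eq_zero
        (s := (cylinder T (⊤ : Opens (Space d)) : Set (ℝ × Space d)))] at h5
      · refine Eq.trans (integral_congr_ae ?_) h5
        filter_upwards [hρz, huz, hGz] with p e1 e2 e3
        simp only [divergence, e1, e2, e3]
      · intro p hp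
        have hp' : p ∉ tsupport ψ := fun hp' => hp (ψ.tsupport_subset hp')
        have hd0 : fderiv ℝ ψ p = 0 := by
          by_contra hne
          exact hp' (support_fderiv_subset ℝ hne)
        simp [hd0, image_eq_zero_of_notMem_tsupport hp']
  have hnat : ∀ n : ℕ, (0 : ℝ) < (n : ℝ) + 1 := fun n => by positivity
  refine ⟨?_, fun α hα => ?_⟩
  -- The intervals `[a n, c n]` on which `b'` is switched off move to `R`, starting at `a 0 = R -
  -- α₀`, so they stay in the region where `b` is monotone.
  · let a : ℕ → ℝ := fun n => R - α₀ * (1 / ((n : ℝ) + 1))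
    let c : ℕ → ℝ := fun n => R - α₀ / 2 * (1 / ((n : ℝ) + 1))
    have hpos : ∀ n : ℕ, 0 < α₀ * (1 / ((n : ℝ) + 1)) := fun n =>
      mul_pos hα₀.1 (one_div_pos.2 (hnat n))
    have hra : ∀ n, R - α₀ ≤ a n := fun n => by
      have h1 : 1 / ((n : ℝ) + 1) ≤ 1 := by
        rw [div_le_one (hnat n)]; linarith [(Nat.cast_nonneg n : (0 : ℝ) ≤ n)]
      have := mul_le_of_le_one_right hα₀.1.le h1
      simp only [a]; linarith
    have hac : ∀ n, a n < c n := fun n => by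
      have := hpos n
      simp only [a, c]; linarith
    have hcR : ∀ n, c n < R := fun n => by
      have := hpos n
      simp only [c]; linarith
    have hlim : Tendsto a atTop (𝓝 R) := by
      simpa [a] using (tendsto_one_div_add_atTop_nhds_zero_nat.const_mul α₀).const_sub R
    choose β K₀ K₁ hβ hβ₀ hβ₁ hβa hβac hβc hβ' using fun n =>
      exists_contDiff_cutoff hb hr hbmono (hra n) (hac n) (hcR n)
    have hev : ∀ s ∈ Ico 0 R, ∀ᶠ n in atTop, s ∈ Icc 0 (a n) := fun s hs => by
      filter_upwards [hlim.eventually (lt_mem_nhds hs.2)] with n hn using ⟨hs.1, hn.le⟩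
    exact key hβ (fun n => ⟨K₀ n, hβ₀ n⟩) (fun n => ⟨K₁ n, hβ₁ n⟩)
      (fun n s hs => norm_cutoff_le hbmono (hra n) (hac n) (hcR n) (hβa n) (hβac n) (hβc n) hs)
      hβ'
      (fun s hs => tendsto_const_nhds.congr' ((hev s hs).mono fun n hn => (hβa n s hn).1.symm))
      fun s hs => tendsto_const_nhds.congr' ((hev s hs).mono fun n hn => (hβa n s hn).2.symm)
  · obtain ⟨c, rfl⟩ : ∃ c, α = R - c := ⟨R - α, by ring⟩
    have hcR : c < R := sub_pos.1 hα.1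
    have hrc : R - α₀ < c := by linarith [hα.2]
    -- Here the right end `c = R - α` is fixed and the left ends increase to it from `R - α₀`.
    let a : ℕ → ℝ := fun n => c - (c - (R - α₀)) * (1 / ((n : ℝ) + 1))
    have hra : ∀ n, R - α₀ ≤ a n := fun n => by
      have h1 : 1 / ((n : ℝ) + 1) ≤ 1 := by
        rw [div_le_one (hnat n)]; linarith [(Nat.cast_nonneg n : (0 : ℝ) ≤ n)]
      have := mul_le_of_le_one_right (sub_pos.2 hrc).le h1
      simp only [a]; linarith
    have hac : ∀ n, a n < c := fun n =>
      sub_lt_self _ (mul_pos (sub_pos.2 hrc) (one_div_pos.2 (hnat n)))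
    have hlim : Tendsto a atTop (𝓝 c) := by
      simpa [a] using
        (tendsto_one_div_add_atTop_nhds_zero_nat.const_mul (c - (R - α₀))).const_sub c
    choose β K₀ K₁ hβ hβ₀ hβ₁ hβa hβac hβc hβ' using fun n =>
      exists_contDiff_cutoff hb hr hbmono (hra n) (hac n) hcR
    have htr := fun s (hs : s ∈ Ico 0 R) =>
      tendsto_truncation_cutoff hb hr hrc hcR hac hlim hβa hβac hβc hs
    exact key hβ (fun n => ⟨K₀ n, hβ₀ n⟩) (fun n => ⟨K₁ n, hβ₁ n⟩)
      (fun n s hs => norm_cutoff_le hbmono (hra n) (hac n) hcR (hβa n) (hβac n) (hβc n) hs)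
      hβ' (fun s hs => (htr s hs).1) fun s hs => (htr s hs).2

end RenormCE

theorem mainTheorem4 (d : ℕ) (hd : 2 ≤ d) (T : ℝ) (hT : 0 < T)
    (Ω : TopologicalSpace.Opens (RenormCE.Space d))
    (hΩ : RenormCE.IsBoundedLipschitzDomain Ω)
    (R : ℝ) (ρ : ℝ × RenormCE.Space d → ℝ)
    (hρ : MemLp ρ ⊤
      (volume.restrict (RenormCE.cylinder T Ω : Set (ℝ × RenormCE.Space d))))
    (hρR : ∀ᵐ p ∂(volume.restrict (RenormCE.cylinder T Ω : Set (ℝ × RenormCE.Space d))),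
      0 ≤ ρ p ∧ ρ p < R)
    (u : ℝ × RenormCE.Space d → RenormCE.Space d)
    (Du : Fin d → ℝ × RenormCE.Space d → RenormCE.Space d)
    (hu : RenormCE.MemL2W12Zero T Ω u Du)
    (hcont : RenormCE.HoldsInDistributions (RenormCE.cylinder T Ω)
      ρ (fun p => ρ p • u p) (fun _ => 0))
    (b : ℝ → ℝ) (hb : ContDiffOn ℝ 1 b (Set.Ico 0 R))
    (hbρ : MemLp (fun p => b (ρ p)) 2
      (volume.restrict (RenormCE.cylinder T Ω : Set (ℝ × RenormCE.Space d))))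
    (hb'ρ : MemLp (fun p => RenormCE.derivOn R b (ρ p)) 2
      (volume.restrict (RenormCE.cylinder T Ω : Set (ℝ × RenormCE.Space d))))
    (α₀ : ℝ) (hα₀ : α₀ ∈ Set.Ioo 0 R)
    (hbmono : MonotoneOn b (Set.Ico (R - α₀) R))
    (hb'mono : MonotoneOn (RenormCE.derivOn R b) (Set.Ico (R - α₀) R)) :
    RenormCE.RenormalizedContinuityEq (RenormCE.cylinder T ⊤)
        b (RenormCE.derivOn R b)
        (RenormCE.zeroExt Ω ρ) (RenormCE.zeroExt Ω u)
        (RenormCE.divergence (fun i => RenormCE.zeroExt Ω (Du i))) ∧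
      ∀ α ∈ Set.Ioo 0 α₀,
        RenormCE.RenormalizedContinuityEq (RenormCE.cylinder T ⊤)
          (RenormCE.truncation R α b) (RenormCE.truncationDeriv R α b)
          (RenormCE.zeroExt Ω ρ) (RenormCE.zeroExt Ω u)
          (RenormCE.divergence (fun i => RenormCE.zeroExt Ω (Du i))) :=
  RenormCE.renormalizedContinuityEq_zeroExt hT hΩ hρ hρR hu hcont hb hbρ hb'ρ hα₀ hbmono
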